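/- **Theorem 4.1.** Let $n\ge 1$, let $\Omega\subset\mathbb R^n$ be a bounded domain, $T>0$, $\beta>0$, $Q_T=\Omega\times(0,T)$, $S_T=\partial\Omega\times(0,T)$. Consider the mean field games system $$u_t+\beta\Delta u+\tfrac{\varkappa^2(x)}{2}|\nabla u|^2+G\Big(x,t,\int_\Omega K(x,y)p(y,t)\,dy,\;p(x,t)\Big)=0\quad\text{in }Q_T,\tag{1}$$ $$p_t-\beta\Delta p+\nabla\cdot\big(\varkappa^2(x)\,p\,\nabla u\big)=0\quad\text{in }Q_T,\tag{2}$$ with $\partial_n u=\partial_n p=0$ on $S_T$; $\nabla$ and $\Delta$ act in $x$, derivatives are weak, and the equations hold a.e. Let $H^2_0(Q_T)$ be the set of $v\in H^2(Q_T)$ with $\partial_n v=0$ on $S_T$, understood as $\int_{Q_T}(\varphi\,\Delta v+\nabla v\cdot\nabla\varphi)\,dx\,dt=0$ for all $\varphi\in H^1(Q_T)$ (for piecewise smooth $\partial\Omega$ admitting Green's formula this is the usual condition on the trace). Put $\|v\|^2_{H^{1,0}(Q_T)}=\int_{Q_T}(v^2+|\nabla v|^2)\,dx\,dt$. Let $N_1,N_2,N_3,N_4>0$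 and $N=\max(N_1,N_2,N_3,N_4)$. Assume: * $G=G(x,t,y,z):\overline{Q}_T\times\mathbb R^2\to\mathbb R$ is bounded on bounded sets, $G_y,G_z$ exist and are continuous on $\overline{Q}_T\times\mathbb R^2$, and $|G_y|,|G_z|\le N_1$ on $Q_T\times\mathbb R^2$; * $K$ is bounded on $\overline\Omega\times\overline\Omega$, measurable in its second argument, and $|K|\le N_2$ on $\Omega\times\Omega$; * $\varkappa\in C^1(\overline\Omega)$, with $|\varkappa|\le N_2$ and $|\partial_{x_i}\varkappa|\le N_2$ on $\Omega$ for all $i$. Let $$D_3=\{u\in H^2_0(Q_T):\ \sup_{Q_T}|u|,\ \sup_{Q_T}|\nabla u|,\ \sup_{Q_T}|\Delta u|\le N_3\},\qquad D_4=\{p\in H^2_0(Q_T):\ \sup_{Q_T}|p|,\ \sup_{Q_T}|\nabla p|\le N_4\}$$ (essential suprema). Let $(u_1,p_1),(u_2,p_2)\in D_3\times D_4$ both satisfy (1), (2), and let their time traces be $u_i(\cdot,T)=u_T^{(i)}$, $u_i(\cdot,0)=u_0^{(i)}$, $p_i(\cdot,0)=p_0^{(i)}$ in $\Omega$, $i=1,2$.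 Then $u_T^{(1)}-u_T^{(2)}\in H^1(\Omega)$ and $$\|u_1-u_2\|_{H^{1,0}(Q_T)}+\|p_1-p_2\|_{H^{1,0}(Q_T)}\le C\Big(\|u_T^{(1)}-u_T^{(2)}\|_{H^1(\Omega)}+\|u_0^{(1)}-u_0^{(2)}\|_{L^2(\Omega)}+\|p_0^{(1)}-p_0^{(2)}\|_{L^2(\Omega)}\Big),$$ where, for the fixed domain $\Omega$, the constant $C=C(\beta,N,T)>0$ depends only on $\beta,N,T$. Moreover, if $u_T^{(1)}=u_T^{(2)}$, $u_0^{(1)}=u_0^{(2)}$ and $p_0^{(1)}=p_0^{(2)}$ a.e. in $\Omega$, then $u_1=u_2$ and $p_1=p_2$ a.e. in $Q_T$. -/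

import Mathlib

open MeasureTheory Set Filter Topology
open scoped ContDiff ENNReal

noncomputable section

namespace MFG

/-! ### Weak derivatives and Sobolev spaces on an open set -/

section Sobolev

variable {X : Type*} [NormedAddCommGroup X] [NormedSpace ℝ X] [MeasureSpace X]

/-- `g` is a weak derivative of `f` on `U` in the direction `v`. -/
structure HasWeakDeriv (U : Set X) (v : X) (f g : X → ℝ) : Prop where
  locInt : LocallyIntegrableOn f U volume
  locInt_deriv : LocallyIntegrableOn g U volume
  integral_eq : ∀ φ : X → ℝ, ContDiff ℝ ∞ φ → HasCompactSupport φ → tsupport φ ⊆ U →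
    ∫ x in U, f x * fderiv ℝ φ x v = -∫ x in U, g x * φ x

open Classical in
/-- The weak derivative of `f` on `U` in the direction `v` (a chosen representative, unique up to
null sets of an open `U`; zero if there is no weak derivative). -/
def weakDeriv (U : Set X) (v : X) (f : X → ℝ) : X → ℝ :=
  if h : ∃ g, HasWeakDeriv U v f g then h.choose else 0

/-- `f ∈ H¹(U)`: `f` and its first order weak derivatives exist and lie in `L²(U)`. -/
def MemH1 (U : Set X) (f : X → ℝ) : Prop :=
  MemLp f 2 (volume.restrict U) ∧
    ∀ v : X, ∃ g, HasWeakDeriv U v f g ∧ MemLp g 2 (volume.restrict U)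

/-- `f ∈ H²(U)`: `f ∈ L²(U)` and its first order weak derivatives exist and lie in `H¹(U)`. -/
def MemH2 (U : Set X) (f : X → ℝ) : Prop :=
  MemLp f 2 (volume.restrict U) ∧ ∀ v : X, ∃ g, HasWeakDeriv U v f g ∧ MemH1 U g

end Sobolev

/-! ### Functions of position -/

/-- The norm of `L²(Ω)`. -/
def normL2 {n : ℕ} (Ω : Set (EuclideanSpace ℝ (Fin n))) (g : EuclideanSpace ℝ (Fin n) → ℝ) : ℝ :=
  √(∫ x in Ω, g x ^ 2)

/-- The norm of `H¹(Ω)`. -/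
def normH1 {n : ℕ} (Ω : Set (EuclideanSpace ℝ (Fin n))) (g : EuclideanSpace ℝ (Fin n) → ℝ) : ℝ :=
  √(∫ x in Ω, (g x ^ 2 + ∑ i, weakDeriv Ω (EuclideanSpace.single i 1) g x ^ 2))

/-- `κ ∈ C¹(closure Ω)`, where `κ` and its first order partial derivatives are bounded by `M`
on `Ω`. -/
def C1Bounded {n : ℕ} (Ω : Set (EuclideanSpace ℝ (Fin n))) (M : ℝ)
    (κ : EuclideanSpace ℝ (Fin n) → ℝ) : Prop :=
  ContinuousOn κ (closure Ω) ∧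
  (∃ D : EuclideanSpace ℝ (Fin n) → (EuclideanSpace ℝ (Fin n) →L[ℝ] ℝ),
    ContinuousOn D (closure Ω) ∧ ∀ x ∈ Ω, HasFDerivAt κ (D x) x) ∧
  (∀ x ∈ Ω, |κ x| ≤ M) ∧
  ∀ x ∈ Ω, ∀ i, |fderiv ℝ κ x (EuclideanSpace.single i 1)| ≤ M

/-! ### Functions of position and time on the cylinder `Ω × (0, T)` -/

/-- The space-time cylinder `Q_T = Ω × (0, T)`. -/
def cyl {n : ℕ} (Ω : Set (EuclideanSpace ℝ (Fin n))) (T : ℝ) :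
    Set (EuclideanSpace ℝ (Fin n) × ℝ) :=
  Ω ×ˢ Ioo 0 T

section SpaceTime

variable {n : ℕ} (Ω : Set (EuclideanSpace ℝ (Fin n))) (T : ℝ)

/-- The weak derivative `u_{x_i}` on `Q_T`. -/
def dx (i : Fin n) (u : EuclideanSpace ℝ (Fin n) × ℝ → ℝ) :
    EuclideanSpace ℝ (Fin n) × ℝ → ℝ :=
  weakDeriv (cyl Ω T) (EuclideanSpace.single i 1, 0) u

/-- The weak derivative `u_t` on `Q_T`. -/
def dt (u : EuclideanSpace ℝ (Fin n) × ℝ → ℝ) : EuclideanSpace ℝ (Fin n) × ℝ → ℝ :=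
  weakDeriv (cyl Ω T) (0, 1) u

/-- The squared length `(∇u)²` of the gradient in the position variable. -/
def gradSq (u : EuclideanSpace ℝ (Fin n) × ℝ → ℝ) : EuclideanSpace ℝ (Fin n) × ℝ → ℝ :=
  fun z => ∑ i, dx Ω T i u z ^ 2

/-- The Laplacian `Δu` in the position variable. -/
def lap (u : EuclideanSpace ℝ (Fin n) × ℝ → ℝ) : EuclideanSpace ℝ (Fin n) × ℝ → ℝ :=
  fun z => ∑ i, dx Ω T i (dx Ω T i u) z

/-- The norm of `H^{1,0}(Q_T)`: only derivatives in the position variable are involved. -/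
def normH10 (u : EuclideanSpace ℝ (Fin n) × ℝ → ℝ) : ℝ :=
  √(∫ z in cyl Ω T, (u z ^ 2 + gradSq Ω T u z))

/-- The normal derivative `∂_n u` on the lateral boundary `S_T = ∂Ω × (0, T)`, as the functional
`φ ↦ ∫_{Q_T} (φ Δu + ∇u · ∇φ)` on `H¹(Q_T)`. This is the usual definition of the normal trace of a
square integrable vector field with square integrable divergence; when `∂Ω` is regular enough for
a surface measure and Green's formula, its value is the integral of `φ ∂_n u` over `S_T`. -/
def normalDeriv (u φ : EuclideanSpace ℝ (Fin n) × ℝ → ℝ) : ℝ :=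
  ∫ z in cyl Ω T, (φ z * lap Ω T u z + ∑ i, dx Ω T i u z * dx Ω T i φ z)

/-- `u ∈ H²₀(Q_T)`: `u ∈ H²(Q_T)` and `∂_n u = 0` on `S_T`. -/
def MemH20 (u : EuclideanSpace ℝ (Fin n) × ℝ → ℝ) : Prop :=
  MemH2 (cyl Ω T) u ∧ ∀ φ, MemH1 (cyl Ω T) φ → normalDeriv Ω T u φ = 0

/-- `g ∈ L²(Ω)` is the trace `u(·, τ)`: the mean square distance of `u(·, t)` from `g`, over the
times `t ∈ (0, T)` at distance less than `h` from `τ`, tends to zero as `h → 0`. -/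
def HasTimeTrace (u : EuclideanSpace ℝ (Fin n) × ℝ → ℝ) (τ : ℝ)
    (g : EuclideanSpace ℝ (Fin n) → ℝ) : Prop :=
  MemLp g 2 (volume.restrict Ω) ∧
  Tendsto (fun h : ℝ => (ENNReal.ofReal h)⁻¹ *
      ∫⁻ z in Ω ×ˢ (Ioo 0 T ∩ Ioo (τ - h) (τ + h)), ‖u z - g z.1‖ₑ ^ 2)
    (𝓝[>] 0) (𝓝 0)

/-- The set `D₃(M)`; suprema over `Q_T` of Sobolev functions are essential suprema. -/
structure MemD3 (M : ℝ) (u : EuclideanSpace ℝ (Fin n) × ℝ → ℝ) : Prop where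
  memH20 : MemH20 Ω T u
  bound : ∀ᵐ z ∂volume.restrict (cyl Ω T), |u z| ≤ M
  bound_grad : ∀ᵐ z ∂volume.restrict (cyl Ω T), √(gradSq Ω T u z) ≤ M
  bound_lap : ∀ᵐ z ∂volume.restrict (cyl Ω T), |lap Ω T u z| ≤ M

/-- The set `D₄(M)`. -/
structure MemD4 (M : ℝ) (p : EuclideanSpace ℝ (Fin n) × ℝ → ℝ) : Prop where
  memH20 : MemH20 Ω T p
  bound : ∀ᵐ z ∂volume.restrict (cyl Ω T), |p z| ≤ M
  bound_grad : ∀ᵐ z ∂volume.restrict (cyl Ω T), √(gradSq Ω T p z) ≤ M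

/-- The conditions on the interaction term `G(x, t, y, z)`: it is bounded on bounded subsets of
`closure Q_T × ℝ²`, the derivatives `G_y`, `G_z` exist and are continuous on `closure Q_T × ℝ²`,
and they are bounded by `M` on `Q_T × ℝ²`. -/
structure IsInteraction (M : ℝ) (G : EuclideanSpace ℝ (Fin n) × ℝ → ℝ → ℝ → ℝ) : Prop where
  bounded : ∀ B : Set ((EuclideanSpace ℝ (Fin n) × ℝ) × ℝ × ℝ), B ⊆ closure (cyl Ω T) ×ˢ univ →
    Bornology.IsBounded B → ∃ R : ℝ, ∀ q ∈ B, |G q.1 q.2.1 q.2.2| ≤ R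
  diff_y : ∀ w ∈ closure (cyl Ω T), ∀ y z : ℝ, DifferentiableAt ℝ (fun s => G w s z) y
  diff_z : ∀ w ∈ closure (cyl Ω T), ∀ y z : ℝ, DifferentiableAt ℝ (fun s => G w y s) z
  cont_y : ContinuousOn
    (fun q : (EuclideanSpace ℝ (Fin n) × ℝ) × ℝ × ℝ => deriv (fun s => G q.1 s q.2.2) q.2.1)
    (closure (cyl Ω T) ×ˢ univ)
  cont_z : ContinuousOn
    (fun q : (EuclideanSpace ℝ (Fin n) × ℝ) × ℝ × ℝ => deriv (fun s => G q.1 q.2.1 s) q.2.2)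
    (closure (cyl Ω T) ×ˢ univ)
  bound_y : ∀ w ∈ cyl Ω T, ∀ y z : ℝ, |deriv (fun s => G w s z) y| ≤ M
  bound_z : ∀ w ∈ cyl Ω T, ∀ y z : ℝ, |deriv (fun s => G w y s) z| ≤ M

/-- The conditions on the kernel `K(x, y)`: measurable in `y`, bounded on the closure of `Ω × Ω`,
and bounded by `M` on `Ω × Ω`. -/
structure IsKernel (M : ℝ) (K : EuclideanSpace ℝ (Fin n) → EuclideanSpace ℝ (Fin n) → ℝ) :
    Prop where
  meas : ∀ᵐ x ∂volume.restrict Ω, AEStronglyMeasurable (K x) (volume.restrict Ω)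
  bounded : ∃ R : ℝ, ∀ x ∈ closure Ω, ∀ y ∈ closure Ω, |K x y| ≤ R
  bound : ∀ x ∈ Ω, ∀ y ∈ Ω, |K x y| ≤ M

/-- The mean field games system: the Bellman equation
`u_t + β Δu + (κ²/2) (∇u)² + G(x, t, ∫_Ω K(x, y) p(y, t) dy, p) = 0`
and the Fokker-Planck equation `p_t - β Δp + ∇ · (κ² p ∇u) = 0`, almost everywhere in `Q_T`.
The zero Neumann conditions are part of the space `H²₀(Q_T)`. -/
structure SolvesMFG (β : ℝ) (κ : EuclideanSpace ℝ (Fin n) → ℝ)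
    (K : EuclideanSpace ℝ (Fin n) → EuclideanSpace ℝ (Fin n) → ℝ)
    (G : EuclideanSpace ℝ (Fin n) × ℝ → ℝ → ℝ → ℝ)
    (u p : EuclideanSpace ℝ (Fin n) × ℝ → ℝ) : Prop where
  bellman : ∀ᵐ z ∂volume.restrict (cyl Ω T),
    dt Ω T u z + β * lap Ω T u z + κ z.1 ^ 2 / 2 * gradSq Ω T u z
      + G z (∫ y in Ω, K z.1 y * p (y, z.2)) (p z) = 0
  fokkerPlanck : ∀ᵐ z ∂volume.restrict (cyl Ω T),
    dt Ω T p z - β * lap Ω T p z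
      + ∑ i, dx Ω T i (fun w => κ w.1 ^ 2 * p w * dx Ω T i u w) z = 0

end SpaceTime

end MFG

end

/-!
Let `u = u₁ - u₂` and `p = p₁ - p₂`. All data of the problem are bounded, so `u` solves a backward
heat equation whose right-hand side `f` satisfies `|f| ≲ |∇u| + |p| + ∫_Ω |p|` (`bellman_difference`),
and `p` solves a forward heat equation whose right-hand side is the divergence of a flux bounded by
`|p| + |∇u|`; tested with `p`, it is absorbed by the diffusion up to `|p|² + |∇u|²`
(`fokkerPlanck_difference`). The two equations evolve in opposite directions of time and are coupled
with constants that need not be small, so no Gronwall argument closes the estimate; a Carleman weight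
`E(t) = exp (2 Λ e^{-μ t})` does. Write `σ = Λ μ e^{-μ t}`, so that `E' = -2 σ E` and `σ' = -μ σ`.

* The function `(a + b)²`, `a = u_t - σ u`, `b = β Δu + σ u`, is at least `2 a b`. Multiplied by `E`
  and integrated by parts in space, `2 a b` becomes a total derivative in time plus `μ σ E u²`, which
  is positive because the exponent of the weight is convex. Hence `μ ∫ σ E u²` is bounded by
  `∫ E f²` and the data (`MemH20.carleman_estimate`). This is where `∇u(·, T)` and `u(·, 0)` enter.
* Testing the equation of `u` with `E u` bounds `β ∫ E |∇u|²` by `∫ σ E u²` and lower order terms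
  (`MemH20.backward_energy`); the weight acts against the backward equation here.
* Testing the equation of `p` with `E p` bounds `∫ σ E p² + β ∫ E |∇p|²` (`MemH20.forward_energy`);
  here the decay of the weight helps.

A multiple of the second estimate, chosen so that `∫ E |∇u|²` absorbs the gradient terms, is added to
the other two; then `μ` is chosen so that the first one absorbs `∫ σ E u²`, and finally `Λ`, so that
`σ` is large on `(0, T)` and the lower order terms are absorbed (`absorption`). The weight is at least
one and depends only on `β`, `N`, `T` and the volume of `Ω`, so it disappears into the constant.

The integrations by parts in time need the traces: a square integrable function with square integrable
weak time derivative has an absolutely continuous representative on almost every vertical line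
(`HasWeakDeriv.exists_representation`), so its end values are its time traces, and its energy identity
holds (`HasWeakDeriv.exists_traces`). The trace of a weak derivative in space is the weak derivative of
the trace (`HasTimeTrace.hasWeakDeriv`), hence the trace of a function in `H²(Q_T)` lies in `H¹(Ω)`
(`MemH2.memH1_trace`). Integrations by parts in space hold by the definition of the Neumann
condition; for the divergence term the test functions are products of bounded functions in `H¹(Q_T)`,
for which the product rule holds by mollification (`HasWeakDeriv.mul_of_bounded`).
-/

noncomputable section

set_option linter.unusedSectionVars false

namespace MFG

/-! ### Test functions and weak derivatives -/

section TestFunctions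

variable {X : Type*} [NormedAddCommGroup X] [NormedSpace ℝ X] {U : Set X} {φ : X → ℝ}

/-- `φ` is a test function on `U`: smooth, with compact support contained in `U`. -/
structure IsTest (U : Set X) (φ : X → ℝ) : Prop where
  contDiff : ContDiff ℝ ∞ φ
  compact : HasCompactSupport φ
  subset : tsupport φ ⊆ U

namespace IsTest

theorem fderiv_apply (hφ : IsTest U φ) (v : X) : IsTest U (fun x => fderiv ℝ φ x v) where
  contDiff := (hφ.contDiff.fderiv_right (m := ∞) (by simp)).clm_apply contDiff_const
  compact := hφ.compact.fderiv_apply ℝ v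
  subset := (tsupport_fderiv_apply_subset ℝ v).trans hφ.subset

theorem mul_left {a : X → ℝ} (hφ : IsTest U φ) (ha : ContDiff ℝ ∞ a) :
    IsTest U (fun x => a x * φ x) where
  contDiff := ha.mul hφ.contDiff
  compact := hφ.compact.mul_left
  subset := (tsupport_mul_subset_right (f := a)).trans hφ.subset

theorem continuous (hφ : IsTest U φ) : Continuous φ := hφ.contDiff.continuous

theorem differentiableAt (hφ : IsTest U φ) (x : X) : DifferentiableAt ℝ φ x :=
  (hφ.contDiff.differentiable (by simp)) x

theorem eq_zero (hφ : IsTest U φ) {x : X} (hx : x ∉ U) : φ x = 0 :=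
  image_eq_zero_of_notMem_tsupport fun h => hx (hφ.subset h)

theorem exists_bound (hφ : IsTest U φ) : ∃ C : ℝ, ∀ x, ‖φ x‖ ≤ C :=
  hφ.compact.exists_bound_of_continuous hφ.continuous

end IsTest

end TestFunctions

section WeakDerivative

variable {X : Type*} [NormedAddCommGroup X] [NormedSpace ℝ X] [MeasureSpace X] [BorelSpace X]
  [FiniteDimensional ℝ X] {U : Set X} {v w : X} {f g f' g' φ : X → ℝ}

theorem IsTest.integrable_mul (hφ : IsTest U φ) (hf : LocallyIntegrableOn f U volume) :
    Integrable (fun x => f x * φ x) volume := by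
  have hK : IntegrableOn f (tsupport φ) volume :=
    hf.integrableOn_compact_subset hφ.subset hφ.compact
  obtain ⟨C, hC⟩ := hφ.exists_bound
  have h1 : IntegrableOn (fun x => f x * φ x) (tsupport φ) volume :=
    hK.mul_bdd (c := C) hφ.continuous.aestronglyMeasurable (ae_of_all _ hC)
  rw [integrableOn_iff_integrable_of_support_subset] at h1
  · exact h1
  · intro x hx
    exact subset_tsupport _ fun h => hx (by simp [h])

theorem IsTest.setIntegral_eq (hφ : IsTest U φ) (f : X → ℝ) :
    ∫ x in U, f x * φ x = ∫ x, f x * φ x :=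
  setIntegral_eq_integral_of_forall_compl_eq_zero fun x hx => by simp [hφ.eq_zero hx]

theorem HasWeakDeriv.integral_test (h : HasWeakDeriv U v f g) (hφ : IsTest U φ) :
    ∫ x in U, f x * fderiv ℝ φ x v = -∫ x in U, g x * φ x :=
  h.integral_eq φ hφ.contDiff hφ.compact hφ.subset

/-- A locally integrable function on an open set is determined up to null sets by its integrals
against test functions. -/
theorem ae_eq_of_integral_test (hU : IsOpen U) (hf : LocallyIntegrableOn f U volume)
    (hg : LocallyIntegrableOn g U volume)
    (h : ∀ φ, IsTest U φ → ∫ x in U, f x * φ x = ∫ x in U, g x * φ x) :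
    f =ᵐ[volume.restrict U] g := by
  rw [EventuallyEq, ae_restrict_iff' hU.measurableSet]
  have := hU.ae_eq_zero_of_integral_contDiff_smul_eq_zero (μ := volume) (hf.sub hg) ?_
  · filter_upwards [this] with x hx hxU
    simpa [sub_eq_zero] using hx hxU
  · intro φ h1 h2 h3
    have hφ : IsTest U φ := ⟨h1, h2, h3⟩
    have h4 := h φ hφ
    rw [hφ.setIntegral_eq, hφ.setIntegral_eq] at h4
    have h5 : ∀ x, φ x • (f - g) x = f x * φ x - g x * φ x := fun x => by
      simp only [Pi.sub_apply, smul_eq_mul]; ring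
    simp_rw [h5]
    rw [integral_sub (hφ.integrable_mul hf) (hφ.integrable_mul hg), h4, sub_self]

theorem HasWeakDeriv.unique (hU : IsOpen U) (h : HasWeakDeriv U v f g)
    (h' : HasWeakDeriv U v f g') : g =ᵐ[volume.restrict U] g' :=
  ae_eq_of_integral_test hU h.locInt_deriv h'.locInt_deriv fun φ hφ => by
    have := h.integral_test hφ
    rw [h'.integral_test hφ] at this
    linarith

theorem locallyIntegrableOn_congr (hU : IsOpen U) (hf : LocallyIntegrableOn f U volume)
    (h : f =ᵐ[volume.restrict U] g) : LocallyIntegrableOn g U volume := by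
  have h1 := (locallyIntegrableOn_iff hU.isLocallyClosed).1 hf
  refine (locallyIntegrableOn_iff hU.isLocallyClosed).2 fun k hk hkc => ?_
  exact (h1 k hk hkc).congr (ae_restrict_of_ae_restrict_of_subset hk h)

theorem HasWeakDeriv.congr (hU : IsOpen U) (h : HasWeakDeriv U v f g)
    (hf : f =ᵐ[volume.restrict U] f') (hg : g =ᵐ[volume.restrict U] g') :
    HasWeakDeriv U v f' g' where
  locInt := locallyIntegrableOn_congr hU h.locInt hf
  locInt_deriv := locallyIntegrableOn_congr hU h.locInt_deriv hg
  integral_eq φ h1 h2 h3 := by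
    have e1 : ∫ x in U, f x * fderiv ℝ φ x v = ∫ x in U, f' x * fderiv ℝ φ x v :=
      integral_congr_ae (hf.mono fun x hx => by simp only [hx])
    have e2 : ∫ x in U, g x * φ x = ∫ x in U, g' x * φ x :=
      integral_congr_ae (hg.mono fun x hx => by simp only [hx])
    rw [← e1, ← e2, h.integral_eq φ h1 h2 h3]

theorem HasWeakDeriv.weakDeriv (h : HasWeakDeriv U v f g) :
    HasWeakDeriv U v f (weakDeriv U v f) := by
  have h' : ∃ g, HasWeakDeriv U v f g := ⟨g, h⟩
  rw [MFG.weakDeriv, dif_pos h']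
  exact h'.choose_spec

theorem HasWeakDeriv.weakDeriv_ae_eq (hU : IsOpen U) (h : HasWeakDeriv U v f g) :
    MFG.weakDeriv U v f =ᵐ[volume.restrict U] g :=
  h.weakDeriv.unique hU h

theorem HasWeakDeriv.sub (h : HasWeakDeriv U v f f') (h' : HasWeakDeriv U v g g') :
    HasWeakDeriv U v (f - g) (f' - g') where
  locInt := h.locInt.sub h'.locInt
  locInt_deriv := h.locInt_deriv.sub h'.locInt_deriv
  integral_eq φ h1 h2 h3 := by
    have hφ : IsTest U φ := ⟨h1, h2, h3⟩
    simp only [Pi.sub_apply, sub_mul]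
    rw [integral_sub ((hφ.fderiv_apply v).integrable_mul h.locInt).integrableOn
        ((hφ.fderiv_apply v).integrable_mul h'.locInt).integrableOn,
      integral_sub (hφ.integrable_mul h.locInt_deriv).integrableOn
        (hφ.integrable_mul h'.locInt_deriv).integrableOn,
      h.integral_test hφ, h'.integral_test hφ]
    ring

/-- Leibniz rule for the product with a smooth function. -/
theorem HasWeakDeriv.smooth_mul {a : X → ℝ} (h : HasWeakDeriv U v f g) (ha : ContDiff ℝ ∞ a)
    (hU : IsOpen U) :
    HasWeakDeriv U v (fun x => a x * f x) (fun x => a x * g x + fderiv ℝ a x v * f x) where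
  locInt := h.locInt.continuousOn_mul ha.continuous.continuousOn hU.isLocallyClosed
  locInt_deriv := by
    refine (h.locInt_deriv.continuousOn_mul ha.continuous.continuousOn hU.isLocallyClosed).add
      (h.locInt.continuousOn_mul ?_ hU.isLocallyClosed)
    exact (((ha.fderiv_right (m := ∞) (by simp)).clm_apply
      contDiff_const).continuous).continuousOn
  integral_eq φ h1 h2 h3 := by
    have hφ : IsTest U φ := ⟨h1, h2, h3⟩
    have ha' : ContDiff ℝ ∞ (fun x => fderiv ℝ a x v) :=
      (ha.fderiv_right (m := ∞) (by simp)).clm_apply contDiff_const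
    have hd : ∀ x, fderiv ℝ (fun x => a x * φ x) x v
        = a x * fderiv ℝ φ x v + fderiv ℝ a x v * φ x := fun x => by
      rw [fderiv_fun_mul ((ha.differentiable (by simp)) x) (hφ.differentiableAt x)]
      simp; ring
    have e := h.integral_test (hφ.mul_left ha)
    simp only [hd, mul_add] at e
    rw [integral_add (((hφ.fderiv_apply v).mul_left ha).integrable_mul h.locInt).integrableOn
      ((hφ.mul_left ha').integrable_mul h.locInt).integrableOn] at e
    have e2 : ∫ x in U, (a x * g x + fderiv ℝ a x v * f x) * φ x
        = (∫ x in U, g x * (a x * φ x)) + ∫ x in U, f x * (fderiv ℝ a x v * φ x) := by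
      rw [← integral_add ((hφ.mul_left ha).integrable_mul h.locInt_deriv).integrableOn
        ((hφ.mul_left ha').integrable_mul h.locInt).integrableOn]
      exact integral_congr_ae (ae_of_all _ fun x => by ring)
    have e3 : ∫ x in U, a x * f x * fderiv ℝ φ x v
        = ∫ x in U, f x * (a x * fderiv ℝ φ x v) :=
      integral_congr_ae (ae_of_all _ fun x => by ring)
    rw [e2, e3]
    linarith

/-- Weak derivatives in two directions commute. -/
theorem HasWeakDeriv.comm (hU : IsOpen U) {h k : X → ℝ} (hv : HasWeakDeriv U v f f')
    (hw : HasWeakDeriv U w f g') (hvw : HasWeakDeriv U w f' h) (hk : HasWeakDeriv U v g' k) :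
    h =ᵐ[volume.restrict U] k :=
  ae_eq_of_integral_test hU hvw.locInt_deriv hk.locInt_deriv fun φ hφ => by
    have e1 := hvw.integral_test hφ
    have e2 := hk.integral_test hφ
    have e3 := hv.integral_test (hφ.fderiv_apply w)
    have e4 := hw.integral_test (hφ.fderiv_apply v)
    have hd : Differentiable ℝ (fderiv ℝ φ) :=
      (hφ.contDiff.fderiv_right (m := ∞) (by simp)).differentiable (by simp)
    have key : ∀ x, fderiv ℝ (fun y => fderiv ℝ φ y w) x v
        = fderiv ℝ (fun y => fderiv ℝ φ y v) x w := fun x => by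
      rw [fderiv_clm_apply (hd x) (by fun_prop), fderiv_clm_apply (hd x) (by fun_prop)]
      have := (hφ.contDiff.contDiffAt (x := x)).isSymmSndFDerivAt
        (by simpa using WithTop.coe_le_coe.2 (le_top : (2 : ℕ∞) ≤ ⊤))
      simpa using this v w
    simp only [key] at e3
    linarith

/-- The classical derivative of a function that is continuously differentiable on `U` is its weak
derivative. -/
theorem hasWeakDeriv_of_hasFDerivAt [(volume : Measure X).IsAddHaarMeasure] (hU : IsOpen U)
    {D : X → X →L[ℝ] ℝ}
    (hf : ∀ x ∈ U, HasFDerivAt f (D x) x) (hD : ContinuousOn D U) :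
    HasWeakDeriv U v f (fun x => D x v) where
  locInt := ContinuousOn.locallyIntegrableOn
    (fun x hx => (hf x hx).continuousAt.continuousWithinAt) hU.measurableSet
  locInt_deriv := ContinuousOn.locallyIntegrableOn
    (hD.clm_apply continuousOn_const) hU.measurableSet
  integral_eq φ h1 h2 h3 := by
    have hφ : IsTest U φ := ⟨h1, h2, h3⟩
    have l1 : LocallyIntegrableOn f U volume := ContinuousOn.locallyIntegrableOn
      (fun x hx => (hf x hx).continuousAt.continuousWithinAt) hU.measurableSet
    have l2 : LocallyIntegrableOn (fun x => D x v) U volume :=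
      ContinuousOn.locallyIntegrableOn (hD.clm_apply continuousOn_const) hU.measurableSet
    rw [(hφ.fderiv_apply v).setIntegral_eq, hφ.setIntegral_eq]
    refine integral_bilinear_hasLineDerivAt_right_eq_neg_left_of_integrable
      (B := ContinuousLinearMap.mul ℝ ℝ) (f' := fun x => D x v)
      (hφ.integrable_mul l2) ((hφ.fderiv_apply v).integrable_mul l1) (hφ.integrable_mul l1)
      (fun x hx => (hf x (hφ.subset hx)).hasLineDerivAt v)
      (fun x _ => (hφ.differentiableAt x).hasFDerivAt.hasLineDerivAt v)

end WeakDerivative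

/-! ### The product rule for bounded functions -/

section ProductRule

open scoped Convolution

variable {X : Type*} [NormedAddCommGroup X] [NormedSpace ℝ X] [MeasureSpace X] [BorelSpace X]
  [FiniteDimensional ℝ X] [(volume : Measure X).IsAddHaarMeasure]
  {U : Set X} {v : X} {f g f' g' : X → ℝ} {M : ℝ}

variable (X) in
/-- A sequence of smooth bumps shrinking to the origin. -/
def shrinkingBump (k : ℕ) : ContDiffBump (0 : X) where
  rIn := 1 / (k + 1)
  rOut := 2 / (k + 1)
  rIn_pos := by positivity
  rIn_lt_rOut := by gcongr; norm_num

variable (X) in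
/-- The mollifying kernels: normalized bumps shrinking to the origin. -/
def mollifier (k : ℕ) : X → ℝ := (shrinkingBump X k).normed volume

/-- The regularization of a function by convolution with a mollifying kernel. -/
def mollify (k : ℕ) (g : X → ℝ) (x : X) : ℝ := ∫ y, mollifier X k (x - y) * g y

theorem mollify_eq_convolution (k : ℕ) (g : X → ℝ) :
    mollify k g = (mollifier X k ⋆[ContinuousLinearMap.lsmul ℝ ℝ, volume] g) := by
  ext x
  rw [convolution_eq_swap]
  rfl

theorem tendsto_shrinkingBump_rOut : Tendsto (fun k => (shrinkingBump X k).rOut) atTop (𝓝 0) :=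
  (tendsto_const_div_atTop_nhds_zero_nat (2 : ℝ)).comp (tendsto_add_atTop_nat 1) |>.congr
    fun k => by simp [shrinkingBump]

theorem mollifier_nonneg (k : ℕ) (x : X) : 0 ≤ mollifier X k x := ContDiffBump.nonneg_normed _ x

theorem mollifier_neg (k : ℕ) (x : X) : mollifier X k (-x) = mollifier X k x :=
  ContDiffBump.normed_neg _ x

theorem contDiff_mollifier (k : ℕ) : ContDiff ℝ ∞ (mollifier X k) := ContDiffBump.contDiff_normed _

theorem hasCompactSupport_mollifier (k : ℕ) : HasCompactSupport (mollifier X k) :=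
  ContDiffBump.hasCompactSupport_normed _

theorem integral_mollifier_sub (k : ℕ) (x : X) : ∫ y, mollifier X k (x - y) = 1 := by
  rw [integral_sub_left_eq_self (mollifier X k) volume x]
  exact ContDiffBump.integral_normed _

theorem contDiff_mollify (k : ℕ) (hg : LocallyIntegrable g volume) :
    ContDiff ℝ ∞ (mollify k g) := by
  rw [mollify_eq_convolution]
  exact (hasCompactSupport_mollifier k).contDiff_convolution_left _ (contDiff_mollifier k) hg

theorem ae_tendsto_mollify (hg : LocallyIntegrable g volume) :
    ∀ᵐ x, Tendsto (fun k => mollify k g x) atTop (𝓝 (g x)) := by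
  simp_rw [mollify_eq_convolution]
  refine ContDiffBump.ae_convolution_tendsto_right_of_locallyIntegrable (K := 2)
    (φ := shrinkingBump X) tendsto_shrinkingBump_rOut ?_ hg
  refine Eventually.of_forall fun k => ?_
  simp only [shrinkingBump]
  apply le_of_eq; ring

theorem abs_mollify_le (k : ℕ) (hM : ∀ᵐ x, |g x| ≤ M) (x : X) :
    |mollify k g x| ≤ M := by
  have hi : Integrable (fun y => mollifier X k (x - y)) volume :=
    (((contDiff_mollifier k).continuous.integrable_of_hasCompactSupport
      (hasCompactSupport_mollifier (X := X) k)).comp_sub_left x)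
  calc |mollify k g x| ≤ ∫ y, mollifier X k (x - y) * M := by
        rw [← Real.norm_eq_abs]
        refine norm_integral_le_of_norm_le (hi.mul_const M) ?_
        filter_upwards [hM] with y hy
        rw [norm_mul, Real.norm_eq_abs, Real.norm_eq_abs, abs_of_nonneg (mollifier_nonneg k _)]
        exact mul_le_mul_of_nonneg_left hy (mollifier_nonneg k _)
    _ = M := by rw [integral_mul_const, integral_mollifier_sub, one_mul]

/-- Differentiation falls on the kernel. -/
theorem fderiv_mollify (k : ℕ) (hg : LocallyIntegrable g volume) (x v : X) :
    fderiv ℝ (mollify k g) x v = ∫ y, fderiv ℝ (mollifier X k) (x - y) v * g y := by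
  have hd := (hasCompactSupport_mollifier k).hasFDerivAt_convolution_left
    (ContinuousLinearMap.lsmul ℝ ℝ) ((contDiff_mollifier k).of_le (by simp)) hg x
  rw [mollify_eq_convolution, hd.fderiv, convolution_eq_swap,
    ContinuousLinearMap.integral_apply]
  · exact integral_congr_ae (ae_of_all _ fun y => by simp)
  · have h1 : ContDiff ℝ ∞ (fderiv ℝ (mollifier X k)) :=
      (contDiff_mollifier k).fderiv_right (by simp)
    have h2 := ((hasCompactSupport_mollifier (X := X) k).fderiv ℝ).convolutionExists_left
      (μ := volume) ((ContinuousLinearMap.lsmul ℝ ℝ : ℝ →L[ℝ] ℝ →L[ℝ] ℝ).precompL X)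
      h1.continuous hg x
    exact h2.integrable_swap

theorem isTest_mollifier_sub (k : ℕ) {x : X}
    (hx : Metric.closedBall x (shrinkingBump X k).rOut ⊆ U) :
    IsTest U (fun y => mollifier X k (x - y)) where
  contDiff := (contDiff_mollifier k).comp (contDiff_const.sub contDiff_id)
  compact := (hasCompactSupport_mollifier k).comp_homeomorph (Homeomorph.subLeft x)
  subset := by
    refine (closure_minimal ?_ Metric.isClosed_closedBall).trans hx
    intro y hy
    have h1 : x - y ∈ Function.support ((shrinkingBump X k).normed volume) := hy
    rw [ContDiffBump.support_normed_eq] at h1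
    rw [Metric.mem_closedBall, dist_comm, dist_eq_norm]
    simpa using (Metric.mem_ball.1 h1).le

/-- Mollification commutes with weak differentiation away from the boundary. -/
theorem HasWeakDeriv.fderiv_mollify (hU : IsOpen U) (h : HasWeakDeriv U v g g')
    (hg : IntegrableOn g U volume) (k : ℕ) {x : X}
    (hx : Metric.closedBall x (shrinkingBump X k).rOut ⊆ U) :
    fderiv ℝ (mollify k (U.indicator g)) x v = mollify k (U.indicator g') x := by
  have hg1 : LocallyIntegrable (U.indicator g) volume :=
    ((integrable_indicator_iff hU.measurableSet).2 hg).locallyIntegrable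
  have ht := isTest_mollifier_sub k hx
  rw [MFG.fderiv_mollify k hg1]
  have hd : ∀ y, fderiv ℝ (fun y => mollifier X k (x - y)) y v
      = -fderiv ℝ (mollifier X k) (x - y) v := fun y => by
    have h1 : HasFDerivAt (fun y => x - y) (-ContinuousLinearMap.id ℝ X) y :=
      (hasFDerivAt_id y).const_sub x
    have h2 := (((contDiff_mollifier (X := X) k).differentiable (by simp))
      (x - y)).hasFDerivAt.comp y h1
    have h3 : HasFDerivAt (fun y => mollifier X k (x - y)) _ y := h2
    rw [h3.fderiv]
    simp
  have e := h.integral_test ht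
  simp only [hd] at e
  have e1 : ∫ y, fderiv ℝ (mollifier X k) (x - y) v * U.indicator g y
      = ∫ y in U, g y * fderiv ℝ (mollifier X k) (x - y) v := by
    rw [← integral_indicator hU.measurableSet]
    refine integral_congr_ae (ae_of_all _ fun y => ?_)
    by_cases hy : y ∈ U <;> simp [hy, mul_comm]
  have e2 : mollify k (U.indicator g') x = ∫ y in U, g' y * mollifier X k (x - y) := by
    rw [mollify, ← integral_indicator hU.measurableSet]
    refine integral_congr_ae (ae_of_all _ fun y => ?_)
    by_cases hy : y ∈ U <;> simp [hy, mul_comm]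
  rw [e1, e2]
  simp only [mul_neg, integral_neg] at e
  linarith

/-- Mollification is self-adjoint, the kernel being even. -/
theorem integral_mul_mollify (k : ℕ) (hf : Integrable f volume) (hg : Integrable g volume) :
    ∫ x, f x * mollify k g x = ∫ y, mollify k f y * g y := by
  obtain ⟨C, hC⟩ := (hasCompactSupport_mollifier (X := X) k).exists_bound_of_continuous
    (contDiff_mollifier k).continuous
  have hi : Integrable (fun z : X × X => mollifier X k (z.1 - z.2) * (f z.1 * g z.2))
      (volume.prod volume) :=
    (hf.mul_prod hg).bdd_mul (c := C)
      ((contDiff_mollifier k).continuous.comp (by fun_prop)).aestronglyMeasurable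
      (ae_of_all _ fun z => hC _)
  have h1 : ∀ x, f x * mollify k g x = ∫ y, mollifier X k (x - y) * (f x * g y) := fun x => by
    rw [mollify, ← integral_const_mul]
    exact integral_congr_ae (ae_of_all _ fun y => by ring)
  have h2 : ∀ y, mollify k f y * g y = ∫ x, mollifier X k (x - y) * (f x * g y) := fun y => by
    rw [mollify, ← integral_mul_const]
    refine integral_congr_ae (ae_of_all _ fun x => ?_)
    simp only
    rw [← mollifier_neg, neg_sub]
    ring
  simp_rw [h1, h2]
  exact integral_integral_swap hi

/-- The product rule for essentially bounded functions with integrable weak derivatives. One factor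
is mollified; no integrability of the products of derivatives is needed in the limit, because the
kernel can be moved to the bounded factors. -/
theorem HasWeakDeriv.mul_of_bounded (hU : IsOpen U)
    (hf : HasWeakDeriv U v f f') (hg : HasWeakDeriv U v g g')
    (hfi : IntegrableOn f U volume) (hfi' : IntegrableOn f' U volume)
    (hgi : IntegrableOn g U volume) (hgi' : IntegrableOn g' U volume)
    (hfM : ∀ᵐ x ∂volume.restrict U, |f x| ≤ M) (hgM : ∀ᵐ x ∂volume.restrict U, |g x| ≤ M) :
    HasWeakDeriv U v (fun x => f x * g x) (fun x => f' x * g x + f x * g' x) := by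
  have hUm := hU.measurableSet
  have i1 : IntegrableOn (fun x => f x * g x) U volume := hfi.mul_bdd hgi.1 hgM
  have i2 : IntegrableOn (fun x => f' x * g x) U volume := hfi'.mul_bdd hgi.1 hgM
  have i3 : IntegrableOn (fun x => f x * g' x) U volume := hgi'.bdd_mul hfi.1 hfM
  refine ⟨i1.locallyIntegrableOn, (i2.add i3).locallyIntegrableOn, fun φ hφ1 hφ2 hφ3 => ?_⟩
  have hφ : IsTest U φ := ⟨hφ1, hφ2, hφ3⟩
  have hφv := hφ.fderiv_apply v
  obtain ⟨C, hC⟩ := hφ.exists_bound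
  obtain ⟨C', hC'⟩ := hφv.exists_bound
  have jg : Integrable (U.indicator g) volume := (integrable_indicator_iff hUm).2 hgi
  have jg' : Integrable (U.indicator g') volume := (integrable_indicator_iff hUm).2 hgi'
  have jfφ : Integrable (fun x => f x * φ x) volume := hφ.integrable_mul hfi.locallyIntegrableOn
  have hgM' : ∀ᵐ x, x ∈ U → |g x| ≤ M := (ae_restrict_iff' hUm).1 hgM
  have hfM' : ∀ᵐ x, x ∈ U → |f x| ≤ M := (ae_restrict_iff' hUm).1 hfM
  rcases U.eq_empty_or_nonempty with hne | hne
  · simp [hne]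
  by_cases hM : 0 ≤ M
  swap
  · -- a negative bound forces `U` to be null
    have h0 : volume.restrict U = 0 := by
      rw [← ae_eq_bot]
      by_contra hb
      have : (ae (volume.restrict U)).NeBot := ⟨hb⟩
      obtain ⟨x, hx⟩ := hfM.exists
      exact hM ((abs_nonneg _).trans hx)
    simp [h0]
  have hgb : ∀ᵐ x, |U.indicator g x| ≤ M := by
    filter_upwards [hgM'] with x hx
    by_cases hxU : x ∈ U <;> simp [hxU, hM, hx]
  have hfb : ∀ᵐ x, |f x * φ x| ≤ M * C := by
    filter_upwards [hfM'] with x hx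
    by_cases hxU : x ∈ U
    · rw [abs_mul]
      exact mul_le_mul (hx hxU) (hC x) (abs_nonneg _) hM
    · rw [hφ.eq_zero hxU]
      simpa using mul_nonneg hM ((norm_nonneg _).trans (hC x))
  -- the mollified identity
  obtain ⟨δ, hδ, hδU⟩ := hφ.compact.exists_cthickening_subset_open hU hφ.subset
  have hev : ∀ᶠ k in atTop, (shrinkingBump X k).rOut < δ :=
    tendsto_shrinkingBump_rOut.eventually (gt_mem_nhds hδ)
  have key : ∀ᶠ k in atTop,
      (∫ x in U, f x * fderiv ℝ φ x v * mollify k (U.indicator g) x)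
        + ∫ y, mollify k (fun x => f x * φ x) y * U.indicator g' y
      = -∫ x in U, f' x * φ x * mollify k (U.indicator g) x := by
    filter_upwards [hev] with k hk
    have hs := contDiff_mollify k jg.locallyIntegrable
    have hball : ∀ x ∈ tsupport φ, Metric.closedBall x (shrinkingBump X k).rOut ⊆ U := by
      intro x hx y hy
      refine hδU (Metric.mem_cthickening_of_dist_le y x δ _ hx ?_)
      exact (Metric.mem_closedBall.1 hy).trans hk.le
    have e := hf.integral_test (hφ.mul_left hs)
    have hd : ∀ x, fderiv ℝ (fun x => mollify k (U.indicator g) x * φ x) x v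
        = mollify k (U.indicator g) x * fderiv ℝ φ x v
          + mollify k (U.indicator g') x * φ x := fun x => by
      rw [fderiv_fun_mul ((hs.differentiable (by simp)) x) (hφ.differentiableAt x)]
      by_cases hx : x ∈ tsupport φ
      · rw [← hg.fderiv_mollify hU hgi k (hball x hx)]
        simp; ring
      · simp [image_eq_zero_of_notMem_tsupport hx]
    rw [← integral_mul_mollify k jfφ jg']
    have e1 : ∀ x, f x * fderiv ℝ (fun x => mollify k (U.indicator g) x * φ x) x v
        = f x * fderiv ℝ φ x v * mollify k (U.indicator g) x
          + f x * (mollify k (U.indicator g') x * φ x) := fun x => by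
      rw [hd]; ring
    simp only [e1] at e
    have hs' := contDiff_mollify k jg'.locallyIntegrable
    rw [integral_add] at e
    · rw [(hφ.mul_left hs').setIntegral_eq f] at e
      convert e using 3
      · ext x; ring
      · ext x; ring
    · exact (((hφv.mul_left hs).integrable_mul hfi.locallyIntegrableOn).congr
        (ae_of_all _ fun x => by ring)).integrableOn
    · exact ((hφ.mul_left hs').integrable_mul hfi.locallyIntegrableOn).integrableOn
  have hgt : ∀ᵐ x ∂volume.restrict U,
      Tendsto (fun k => mollify k (U.indicator g) x) atTop (𝓝 (g x)) := by
    rw [ae_restrict_iff' hUm]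
    filter_upwards [ae_tendsto_mollify jg.locallyIntegrable] with x hx hxU
    simpa [hxU] using hx
  have lim : ∀ F : X → ℝ, IntegrableOn F U volume →
      Tendsto (fun k => ∫ x in U, F x * mollify k (U.indicator g) x) atTop
        (𝓝 (∫ x in U, F x * g x)) := by
    intro F hF
    refine tendsto_integral_of_dominated_convergence (fun x => |F x| * M) ?_ ?_ ?_ ?_
    · intro k
      exact hF.1.mul (contDiff_mollify k jg.locallyIntegrable).continuous.aestronglyMeasurable
    · exact hF.abs.mul_const M
    · intro k
      refine ae_of_all _ fun x => ?_
      rw [norm_mul]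
      exact mul_le_mul_of_nonneg_left (abs_mollify_le k hgb x) (norm_nonneg _)
    · filter_upwards [hgt] with x hx
      exact hx.const_mul _
  have lim1 := lim (fun x => f x * fderiv ℝ φ x v)
    (hφv.integrable_mul hfi.locallyIntegrableOn).integrableOn
  have lim2 := lim (fun x => f' x * φ x) (hφ.integrable_mul hfi'.locallyIntegrableOn).integrableOn
  have lim3 : Tendsto (fun k => ∫ y, mollify k (fun x => f x * φ x) y * U.indicator g' y) atTop
      (𝓝 (∫ y, f y * φ y * U.indicator g' y)) := by
    refine tendsto_integral_of_dominated_convergence (fun x => M * C * |U.indicator g' x|) ?_ ?_ ?_ ?_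
    · intro k
      exact (contDiff_mollify k jfφ.locallyIntegrable).continuous.aestronglyMeasurable.mul jg'.1
    · exact jg'.abs.const_mul _
    · intro k
      refine ae_of_all _ fun x => ?_
      rw [norm_mul]
      exact mul_le_mul_of_nonneg_right (abs_mollify_le k hfb x)
        (norm_nonneg _)
    · filter_upwards [ae_tendsto_mollify jfφ.locallyIntegrable] with x hx
      exact hx.mul_const _
  have e := tendsto_nhds_unique ((lim1.add lim3).congr' key) lim2.neg
  have e3 : ∫ y, f y * φ y * U.indicator g' y = ∫ y in U, f y * g' y * φ y := by
    rw [← integral_indicator hUm]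
    refine integral_congr_ae (ae_of_all _ fun y => ?_)
    by_cases hy : y ∈ U <;> simp [hy]; ring
  rw [e3] at e
  have e4 : ∫ x in U, (f' x * g x + f x * g' x) * φ x
      = (∫ x in U, f' x * φ x * g x) + ∫ x in U, f x * g' x * φ x := by
    rw [← integral_add]
    · exact integral_congr_ae (ae_of_all _ fun x => by ring)
    · exact ((hφ.integrable_mul i2.locallyIntegrableOn).congr
        (ae_of_all _ fun x => by ring)).integrableOn
    · exact (hφ.integrable_mul i3.locallyIntegrableOn).integrableOn
  have e5 : ∫ x in U, f x * g x * fderiv ℝ φ x v = ∫ x in U, f x * fderiv ℝ φ x v * g x :=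
    integral_congr_ae (ae_of_all _ fun x => by ring)
  rw [e4, e5]
  linarith

end ProductRule

/-! ### Slices of weak derivatives on a cylinder -/

section OneDimensional

variable {T : ℝ}

theorem exists_isTest_integral_eq_one (hT : 0 < T) :
    ∃ χ : ℝ → ℝ, IsTest (Ioo 0 T) χ ∧ ∫ t, χ t = 1 := by
  let b : ContDiffBump (T / 2) := ⟨T / 8, T / 4, by positivity, by linarith⟩
  refine ⟨b.normed volume, ⟨b.contDiff_normed, b.hasCompactSupport_normed, ?_⟩, b.integral_normed⟩
  rw [b.tsupport_normed_eq]
  intro t ht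
  rw [Metric.mem_closedBall, Real.dist_eq, abs_le] at ht
  simp only [b] at ht
  exact ⟨by linarith, by linarith⟩

/-- A test function of mean zero on an interval has a test function as primitive. -/
theorem IsTest.exists_primitive {θ : ℝ → ℝ} (hT : 0 < T) (hθ : IsTest (Ioo 0 T) θ)
    (h0 : ∫ t, θ t = 0) : ∃ χ : ℝ → ℝ, IsTest (Ioo 0 T) χ ∧ deriv χ = θ := by
  obtain ⟨α, β, hα, hβ, hs⟩ : ∃ α β : ℝ, 0 < α ∧ β < T ∧ tsupport θ ⊆ Icc α β := by
    rcases (tsupport θ).eq_empty_or_nonempty with he | hne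
    · exact ⟨T / 2, T / 2, by linarith, by linarith, by simp [he]⟩
    · have h1 := hθ.compact.isCompact.sInf_mem hne
      have h2 := hθ.compact.isCompact.sSup_mem hne
      refine ⟨_, _, (hθ.subset h1).1, (hθ.subset h2).2, fun x hx => ?_⟩
      exact ⟨csInf_le hθ.compact.isCompact.bddBelow hx, le_csSup hθ.compact.isCompact.bddAbove hx⟩
  have hz : ∀ t, t ∉ Icc α β → θ t = 0 := fun t ht =>
    image_eq_zero_of_notMem_tsupport fun h => ht (hs h)
  have hd : ∀ t, HasDerivAt (fun t => ∫ s in (0 : ℝ)..t, θ s) (θ t) t := fun t =>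
    intervalIntegral.integral_hasDerivAt_right (hθ.continuous.intervalIntegrable _ _)
      (hθ.continuous.stronglyMeasurableAtFilter _ _) hθ.continuous.continuousAt
  have hder : deriv (fun t => ∫ s in (0 : ℝ)..t, θ s) = θ := funext fun t => (hd t).deriv
  have hsupp : Function.support (fun t => ∫ s in (0 : ℝ)..t, θ s) ⊆ Icc α β := by
    intro t ht
    by_contra hn
    apply ht
    rcases lt_or_ge t α with h | h
    · refine (intervalIntegral.integral_congr fun s hs' => ?_).trans
        intervalIntegral.integral_zero
      refine hz s fun hm => ?_
      have h3 : s ≤ max 0 t := hs'.2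
      have : max 0 t < α := max_lt hα h
      linarith [hm.1]
    · have hβt : β < t := lt_of_not_ge fun h' => hn ⟨h, h'⟩
      have ht0 : 0 ≤ t := hα.le.trans h
      simp only
      rw [intervalIntegral.integral_of_le ht0]
      refine Eq.trans ?_ h0
      refine setIntegral_eq_integral_of_forall_compl_eq_zero fun s hs' => hz s fun hm => hs' ?_
      exact ⟨lt_of_lt_of_le hα hm.1, hm.2.trans hβt.le⟩
  refine ⟨_, ⟨?_, HasCompactSupport.of_support_subset_isCompact isCompact_Icc hsupp, ?_⟩, hder⟩
  · rw [contDiff_infty_iff_deriv, hder]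
    exact ⟨fun t => (hd t).differentiableAt, hθ.contDiff⟩
  · refine (closure_minimal hsupp isClosed_Icc).trans fun t ht => ?_
    exact ⟨hα.trans_le ht.1, ht.2.trans_lt hβ⟩

/-- The lemma of du Bois-Reymond. -/
theorem ae_eq_const_of_integral_mul_deriv_eq_zero {m : ℝ → ℝ} (hT : 0 < T)
    (hm : IntegrableOn m (Ioo 0 T) volume)
    (h : ∀ χ, IsTest (Ioo 0 T) χ → ∫ t in Ioo 0 T, m t * deriv χ t = 0) :
    ∃ k : ℝ, m =ᵐ[volume.restrict (Ioo 0 T)] fun _ => k := by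
  obtain ⟨χ₀, hχ₀, h1⟩ := exists_isTest_integral_eq_one hT
  have hml := hm.locallyIntegrableOn
  set k := ∫ t in Ioo 0 T, m t * χ₀ t with hk
  refine ⟨k, ae_eq_of_integral_test isOpen_Ioo hml (locallyIntegrableOn_const k) fun θ hθ => ?_⟩
  set a := ∫ t, θ t with ha
  have iθ : Integrable θ volume := hθ.continuous.integrable_of_hasCompactSupport hθ.compact
  have iχ : Integrable χ₀ volume := hχ₀.continuous.integrable_of_hasCompactSupport hχ₀.compact
  have ht : IsTest (Ioo 0 T) (fun t => θ t - a * χ₀ t) := by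
    have h2 := hχ₀.mul_left (contDiff_const (c := a))
    refine ⟨hθ.contDiff.sub h2.contDiff, hθ.compact.sub h2.compact, ?_⟩
    exact (tsupport_sub θ (fun t => a * χ₀ t)).trans (union_subset hθ.subset h2.subset)
  obtain ⟨χ, hχ, hd⟩ := ht.exists_primitive hT (by
    rw [integral_sub iθ (iχ.const_mul a), integral_const_mul, h1, ha]; ring)
  have e := h χ hχ
  rw [hd] at e
  have e1 : ∀ t, m t * (θ t - a * χ₀ t) = m t * θ t - a * (m t * χ₀ t) := fun t => by ring
  simp only [e1] at e
  rw [integral_sub (hθ.integrable_mul hml).integrableOn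
    ((hχ₀.integrable_mul hml).const_mul a).integrableOn, integral_const_mul] at e
  rw [integral_const_mul]
  have e2 : ∫ t in Ioo 0 T, θ t = a :=
    setIntegral_eq_integral_of_forall_compl_eq_zero fun t ht => hθ.eq_zero ht
  rw [e2, hk]
  linarith

end OneDimensional

section Cylinder

variable {n : ℕ} {Ω : Set (EuclideanSpace ℝ (Fin n))} {T : ℝ}

theorem isOpen_cyl (hΩ : IsOpen Ω) : IsOpen (cyl Ω T) := hΩ.prod isOpen_Ioo

theorem restrict_cyl : (volume : Measure (EuclideanSpace ℝ (Fin n) × ℝ)).restrict (cyl Ω T)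
    = (volume.restrict Ω).prod (volume.restrict (Ioo 0 T)) := by
  rw [Measure.prod_restrict]; rfl

theorem isFiniteMeasure_restrict (hΩ : Bornology.IsBounded Ω) :
    IsFiniteMeasure (volume.restrict Ω) :=
  ⟨by simpa using hΩ.measure_lt_top⟩

theorem isFiniteMeasure_restrict_cyl (hΩ : Bornology.IsBounded Ω) :
    IsFiniteMeasure (volume.restrict (cyl Ω T)) :=
  ⟨by
    rw [Measure.restrict_apply_univ]
    exact (hΩ.prod (Metric.isBounded_Ioo 0 T)).measure_lt_top⟩

variable {ζ : EuclideanSpace ℝ (Fin n) → ℝ} {χ : ℝ → ℝ}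

theorem IsTest.tensor (hζ : IsTest Ω ζ) (hχ : IsTest (Ioo 0 T) χ) :
    IsTest (cyl Ω T) (fun z => ζ z.1 * χ z.2) := by
  have hs : Function.support (fun z : EuclideanSpace ℝ (Fin n) × ℝ => ζ z.1 * χ z.2)
      ⊆ tsupport ζ ×ˢ tsupport χ := fun z hz =>
    ⟨subset_tsupport _ (left_ne_zero_of_mul hz), subset_tsupport _ (right_ne_zero_of_mul hz)⟩
  refine ⟨(hζ.contDiff.comp contDiff_fst).mul (hχ.contDiff.comp contDiff_snd),
    HasCompactSupport.of_support_subset_isCompact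
      (hζ.compact.isCompact.prod hχ.compact.isCompact) hs, ?_⟩
  exact (closure_minimal hs ((isClosed_tsupport _).prod (isClosed_tsupport _))).trans
    (prod_mono hζ.subset hχ.subset)

theorem IsTest.fderiv_tensor (hζ : IsTest Ω ζ) (hχ : IsTest (Ioo 0 T) χ)
    (z w : EuclideanSpace ℝ (Fin n) × ℝ) :
    fderiv ℝ (fun z : EuclideanSpace ℝ (Fin n) × ℝ => ζ z.1 * χ z.2) z w
      = fderiv ℝ ζ z.1 w.1 * χ z.2 + ζ z.1 * (deriv χ z.2 * w.2) := by
  have h1 : HasFDerivAt (fun z : EuclideanSpace ℝ (Fin n) × ℝ => ζ z.1) _ z :=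
    (hζ.differentiableAt z.1).hasFDerivAt.comp z hasFDerivAt_fst
  have h2 : HasFDerivAt (fun z : EuclideanSpace ℝ (Fin n) × ℝ => χ z.2) _ z :=
    (hχ.differentiableAt z.2).hasDerivAt.hasFDerivAt.comp z hasFDerivAt_snd
  rw [(h1.fun_mul h2).fderiv]
  simp
  ring

variable {f g : EuclideanSpace ℝ (Fin n) × ℝ → ℝ}

/-- Testing the weak time derivative against functions of time only, for almost every position. -/
theorem HasWeakDeriv.time_slice (hΩ : IsOpen Ω) (h : HasWeakDeriv (cyl Ω T) (0, 1) f g)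
    (hf : IntegrableOn f (cyl Ω T) volume) (hg : IntegrableOn g (cyl Ω T) volume)
    (hχ : IsTest (Ioo 0 T) χ) :
    ∀ᵐ x ∂volume.restrict Ω,
      ∫ t in Ioo 0 T, f (x, t) * deriv χ t = -∫ t in Ioo 0 T, g (x, t) * χ t := by
  rw [IntegrableOn, restrict_cyl] at hf hg
  obtain ⟨C, hC⟩ := hχ.exists_bound
  have hχd : IsTest (Ioo 0 T) (deriv χ) := by
    simpa using hχ.fderiv_apply 1
  obtain ⟨C', hC'⟩ := hχd.exists_bound
  have i1 : Integrable (fun z : EuclideanSpace ℝ (Fin n) × ℝ => f z * deriv χ z.2)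
      ((volume.restrict Ω).prod (volume.restrict (Ioo 0 T))) :=
    hf.mul_bdd (c := C') (hχd.continuous.comp continuous_snd).aestronglyMeasurable
      (ae_of_all _ fun z => hC' _)
  have i2 : Integrable (fun z : EuclideanSpace ℝ (Fin n) × ℝ => g z * χ z.2)
      ((volume.restrict Ω).prod (volume.restrict (Ioo 0 T))) :=
    hg.mul_bdd (c := C) (hχ.continuous.comp continuous_snd).aestronglyMeasurable
      (ae_of_all _ fun z => hC _)
  have j1 := i1.integral_prod_left
  have j2 := i2.integral_prod_left
  have key := ae_eq_of_integral_test (f := fun x => ∫ t in Ioo 0 T, f (x, t) * deriv χ t)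
    (g := fun x => -∫ t in Ioo 0 T, g (x, t) * χ t) hΩ
    (IntegrableOn.locallyIntegrableOn j1) (IntegrableOn.locallyIntegrableOn j2.neg) ?_
  · exact key
  intro ζ hζ
  obtain ⟨D, hD⟩ := hζ.exists_bound
  have e := h.integral_test (hζ.tensor hχ)
  simp only [hζ.fderiv_tensor hχ, map_zero, zero_mul, zero_add, mul_one] at e
  rw [restrict_cyl, integral_prod, integral_prod] at e
  · simp only [neg_mul, integral_neg, ← integral_mul_const]
    refine Eq.trans ?_ (e.trans (congrArg Neg.neg ?_))
    · exact integral_congr_ae (ae_of_all _ fun _ =>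
        integral_congr_ae (ae_of_all _ fun _ => by ring))
    · exact integral_congr_ae (ae_of_all _ fun _ =>
        integral_congr_ae (ae_of_all _ fun _ => by ring))
  · exact (i2.mul_bdd (c := D) (hζ.continuous.comp continuous_fst).aestronglyMeasurable
      (ae_of_all _ fun z => hD z.1)).congr (ae_of_all _ fun z => by simp only [Function.comp]; ring)
  · exact (i1.mul_bdd (c := D) (hζ.continuous.comp continuous_fst).aestronglyMeasurable
      (ae_of_all _ fun z => hD z.1)).congr (ae_of_all _ fun z => by simp only [Function.comp]; ring)

/-- Testing a weak derivative in a spatial direction against functions of position only, for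
almost every time. -/
theorem HasWeakDeriv.space_slice {v : EuclideanSpace ℝ (Fin n)}
    (h : HasWeakDeriv (cyl Ω T) (v, 0) f g)
    (hf : IntegrableOn f (cyl Ω T) volume) (hg : IntegrableOn g (cyl Ω T) volume)
    (hζ : IsTest Ω ζ) :
    ∀ᵐ t ∂volume.restrict (Ioo 0 T),
      ∫ x in Ω, f (x, t) * fderiv ℝ ζ x v = -∫ x in Ω, g (x, t) * ζ x := by
  rw [IntegrableOn, restrict_cyl] at hf hg
  obtain ⟨C, hC⟩ := hζ.exists_bound
  have hζd := hζ.fderiv_apply v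
  obtain ⟨C', hC'⟩ := hζd.exists_bound
  have i1 : Integrable (fun z : EuclideanSpace ℝ (Fin n) × ℝ => f z * fderiv ℝ ζ z.1 v)
      ((volume.restrict Ω).prod (volume.restrict (Ioo 0 T))) :=
    hf.mul_bdd (c := C') (hζd.continuous.comp continuous_fst).aestronglyMeasurable
      (ae_of_all _ fun z => hC' _)
  have i2 : Integrable (fun z : EuclideanSpace ℝ (Fin n) × ℝ => g z * ζ z.1)
      ((volume.restrict Ω).prod (volume.restrict (Ioo 0 T))) :=
    hg.mul_bdd (c := C) (hζ.continuous.comp continuous_fst).aestronglyMeasurable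
      (ae_of_all _ fun z => hC _)
  have j1 := i1.integral_prod_right
  have j2 := i2.integral_prod_right
  have key := ae_eq_of_integral_test (f := fun t => ∫ x in Ω, f (x, t) * fderiv ℝ ζ x v)
    (g := fun t => -∫ x in Ω, g (x, t) * ζ x) isOpen_Ioo
    (IntegrableOn.locallyIntegrableOn j1) (IntegrableOn.locallyIntegrableOn j2.neg) ?_
  · exact key
  intro χ hχ
  obtain ⟨D, hD⟩ := hχ.exists_bound
  have e := h.integral_test (hζ.tensor hχ)
  simp only [hζ.fderiv_tensor hχ, mul_zero, add_zero] at e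
  rw [restrict_cyl, integral_prod_symm, integral_prod_symm] at e
  · simp only [neg_mul, integral_neg, ← integral_mul_const]
    refine Eq.trans ?_ (e.trans (congrArg Neg.neg ?_))
    · exact integral_congr_ae (ae_of_all _ fun _ =>
        integral_congr_ae (ae_of_all _ fun _ => by ring))
    · exact integral_congr_ae (ae_of_all _ fun _ =>
        integral_congr_ae (ae_of_all _ fun _ => by ring))
  · exact (i2.mul_bdd (c := D) (hχ.continuous.comp continuous_snd).aestronglyMeasurable
      (ae_of_all _ fun z => hD z.2)).congr (ae_of_all _ fun z => by simp only [Function.comp]; ring)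
  · exact (i1.mul_bdd (c := D) (hχ.continuous.comp continuous_snd).aestronglyMeasurable
      (ae_of_all _ fun z => hD z.2)).congr (ae_of_all _ fun z => by simp only [Function.comp]; ring)

end Cylinder

/-- An integrable function on a product vanishes if its integrals over rectangles do. -/
theorem ae_eq_zero_of_forall_integral_rectangle {α γ : Type*} [MeasurableSpace α]
    [MeasurableSpace γ] {μ : Measure α} {ν : Measure γ} [IsFiniteMeasure μ] [IsFiniteMeasure ν]
    {d : α × γ → ℝ}
    (hd : Integrable d (μ.prod ν))
    (h : ∀ A B, MeasurableSet A → MeasurableSet B → ∫ z in A ×ˢ B, d z ∂μ.prod ν = 0) :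
    d =ᵐ[μ.prod ν] 0 := by
  refine hd.ae_eq_zero_of_forall_setIntegral_eq_zero fun s hs _ => ?_
  induction s, hs using MeasurableSpace.induction_on_inter generateFrom_prod.symm
    isPiSystem_prod with
  | empty => simp
  | basic t ht =>
    obtain ⟨A, hA, B, hB, rfl⟩ := ht
    exact h A B hA hB
  | compl t ht ih =>
    have h1 := integral_add_compl ht hd
    have h2 := h univ univ MeasurableSet.univ MeasurableSet.univ
    rw [univ_prod_univ, Measure.restrict_univ] at h2
    linarith [ih (measure_lt_top _ _)]
  | iUnion f hf hm ih =>
    rw [integral_iUnion hm hf hd.integrableOn]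
    simp [ih _ (measure_lt_top _ _)]

/-! ### Absolute continuity in time and time traces -/

section Auxiliary

/-- Cauchy–Schwarz against the constant function. -/
theorem sq_integral_le {α : Type*} [MeasurableSpace α] {m : Measure α} [IsFiniteMeasure m]
    {h : α → ℝ} (h2 : MemLp h 2 m) : (∫ x, h x ∂m) ^ 2 ≤ m.real univ * ∫ x, h x ^ 2 ∂m := by
  have i1 : Integrable h m := h2.integrable one_le_two
  have i2 : Integrable (fun x => h x ^ 2) m := h2.integrable_sq
  set a := ∫ x, h x ∂m
  set b := ∫ x, h x ^ 2 ∂m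
  set M := m.real univ
  have e : ∫ x, (M * h x - a) ^ 2 ∂m = M * (M * b - a ^ 2) := by
    have : ∀ x, (M * h x - a) ^ 2 = M ^ 2 * h x ^ 2 - 2 * M * a * h x + a ^ 2 := fun x => by ring
    simp_rw [this]
    rw [integral_add (by fun_prop) (by fun_prop), integral_sub (by fun_prop) (by fun_prop),
      integral_const_mul, integral_const_mul, integral_const]
    simp only [smul_eq_mul]
    ring
  have e0 : 0 ≤ M * (M * b - a ^ 2) := e ▸ integral_nonneg fun x => sq_nonneg _
  rcases (measureReal_nonneg (μ := m) (s := univ)).eq_or_lt with h0 | h0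
  · have hm : m = 0 := by
      rw [← Measure.measure_univ_eq_zero]
      exact (measureReal_eq_zero_iff).1 h0.symm
    have ha : a = 0 := by simp [a, hm]
    rw [ha]
    change (0 : ℝ) ^ 2 ≤ M * b
    rw [show M = 0 from h0.symm]
    simp
  · have := nonneg_of_mul_nonneg_right e0 h0
    linarith

variable {T : ℝ} {g : ℝ → ℝ}

theorem absolutelyContinuous_primitive (hT : 0 < T) (hg : IntegrableOn g (Ioo 0 T) volume)
    (c : ℝ) : AbsolutelyContinuousOnInterval (fun t => c + ∫ s in (0 : ℝ)..t, g s) 0 T := by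
  have hi : IntervalIntegrable g volume 0 T :=
    (intervalIntegrable_iff_integrableOn_Ioo_of_le hT.le).2 hg
  refine AbsolutelyContinuousOnInterval.add ?_
    (hi.absolutelyContinuousOnInterval_intervalIntegral (by simp))
  exact (contDiff_const (n := 1)).contDiffOn.absolutelyContinuousOnInterval

theorem ae_deriv_primitive (hT : 0 < T) (hg : IntegrableOn g (Ioo 0 T) volume) (c : ℝ) :
    ∀ᵐ t ∂volume.restrict (Ioo 0 T), HasDerivAt (fun t => c + ∫ s in (0 : ℝ)..t, g s) (g t) t := by
  have hi : IntervalIntegrable g volume 0 T :=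
    (intervalIntegrable_iff_integrableOn_Ioo_of_le hT.le).2 hg
  rw [ae_restrict_iff' measurableSet_Ioo]
  filter_upwards [hi.ae_hasDerivAt_integral] with t ht htT
  exact (ht (by rw [uIcc_of_le hT.le]; exact Ioo_subset_Icc_self htT) 0 (by simp)).const_add c

theorem intervalIntegral_eq_Ioo (hT : 0 < T) (h : ℝ → ℝ) :
    ∫ t in (0 : ℝ)..T, h t = ∫ t in Ioo 0 T, h t := by
  rw [intervalIntegral.integral_of_le hT.le, integral_Ioc_eq_integral_Ioo]

/-- The energy identity for an absolutely continuous function of one variable. -/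
theorem integral_deriv_sq_primitive (hT : 0 < T) (hg : IntegrableOn g (Ioo 0 T) volume) (c : ℝ)
    {η : ℝ → ℝ} (hη : ContDiff ℝ ∞ η) {φ : ℝ → ℝ}
    (hφ : φ = fun t => c + ∫ s in (0 : ℝ)..t, g s) :
    ∫ t in Ioo 0 T, (2 * η t * (φ t * g t) + deriv η t * φ t ^ 2)
      = η T * φ T ^ 2 - η 0 * φ 0 ^ 2 := by
  have h1 : AbsolutelyContinuousOnInterval φ 0 T :=
    hφ ▸ absolutelyContinuous_primitive hT hg c
  have h2 : AbsolutelyContinuousOnInterval η 0 T :=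
    (hη.of_le (by simp)).contDiffOn.absolutelyContinuousOnInterval
  have e := AbsolutelyContinuousOnInterval.integral_deriv_mul_eq_sub h1 (h2.fun_mul h1)
  rw [intervalIntegral_eq_Ioo hT] at e
  rw [show η T * φ T ^ 2 - η 0 * φ 0 ^ 2 = φ T * (η T * φ T) - φ 0 * (η 0 * φ 0) by ring, ← e]
  refine integral_congr_ae ?_
  filter_upwards [ae_deriv_primitive hT hg c] with t ht
  rw [← hφ] at ht
  have h3 := ((hη.differentiable (by simp)) t).hasDerivAt.fun_mul ht
  rw [h3.deriv, ht.deriv]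
  ring

/-- Integration by parts of a primitive against a test function. -/
theorem integral_primitive_mul_deriv (hT : 0 < T) (hg : IntegrableOn g (Ioo 0 T) volume)
    {χ : ℝ → ℝ} (hχ : IsTest (Ioo 0 T) χ) :
    ∫ t in Ioo 0 T, (∫ s in (0 : ℝ)..t, g s) * deriv χ t = -∫ t in Ioo 0 T, g t * χ t := by
  have h1 : AbsolutelyContinuousOnInterval (fun t => ∫ s in (0 : ℝ)..t, g s) 0 T := by
    simpa only [zero_add] using absolutelyContinuous_primitive hT hg 0
  have h2 : AbsolutelyContinuousOnInterval χ 0 T :=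
    (hχ.contDiff.of_le (by simp)).contDiffOn.absolutelyContinuousOnInterval
  have e := AbsolutelyContinuousOnInterval.integral_mul_deriv_eq_deriv_mul h1 h2
  rw [hχ.eq_zero (x := T) (by simp), hχ.eq_zero (x := 0) (by simp)] at e
  rw [← intervalIntegral_eq_Ioo hT (fun t => (∫ s in (0 : ℝ)..t, g s) * deriv χ t)]
  rw [e]
  rw [mul_zero, mul_zero, sub_self, zero_sub, intervalIntegral_eq_Ioo hT]
  refine congrArg Neg.neg (integral_congr_ae ?_)
  filter_upwards [ae_deriv_primitive hT hg 0] with t ht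
  simp only [zero_add] at ht
  rw [ht.deriv]

end Auxiliary

section Representation

variable {n : ℕ} {Ω : Set (EuclideanSpace ℝ (Fin n))} {T : ℝ}
  {f g : EuclideanSpace ℝ (Fin n) × ℝ → ℝ}

/-- The primitive in time, starting at time `0`. -/
def timePrim (g : EuclideanSpace ℝ (Fin n) × ℝ → ℝ) (z : EuclideanSpace ℝ (Fin n) × ℝ) : ℝ :=
  ∫ s in (0 : ℝ)..z.2, g (z.1, s)

theorem timePrim_eq {t : ℝ} (ht : t ∈ Icc 0 T) (x : EuclideanSpace ℝ (Fin n)) :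
    timePrim g (x, t) = ∫ s in Ioo 0 T, if s ≤ t then g (x, s) else 0 := by
  rw [timePrim, intervalIntegral.integral_of_le ht.1]
  have h1 : (fun s => if s ≤ t then g (x, s) else 0) = (Iic t).indicator fun s => g (x, s) := by
    ext s; simp [indicator]
  rw [h1, setIntegral_indicator measurableSet_Iic, integral_Ioc_eq_integral_Ioo,
    ← integral_Ioc_eq_integral_Ioo]
  rcases ht.2.eq_or_lt with h | h
  · have : Ioo 0 T ∩ Iic t = Ioo 0 t := by
      rw [← h]; ext s; simp only [mem_inter_iff, mem_Ioo, mem_Iic]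
      exact ⟨fun h => h.1, fun h => ⟨h, h.2.le⟩⟩
    rw [this, integral_Ioc_eq_integral_Ioo]
  · congr 2
    ext s
    simp only [mem_inter_iff, mem_Ioo, mem_Iic, mem_Ioc]
    exact ⟨fun h' => ⟨⟨h'.1, h'.2.trans_lt h⟩, h'.2⟩, fun h' => ⟨h'.1.1, h'.2⟩⟩

/-- The function `timePrim g`, written as an integral with a jointly measurable integrand. -/
theorem timePrim_ae_eq : timePrim g =ᵐ[(volume.restrict Ω).prod (volume.restrict (Ioo 0 T))]
    fun z => ∫ s in Ioo 0 T, if s ≤ z.2 then g (z.1, s) else 0 := by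
  have h2 : ∀ᵐ z ∂(volume.restrict Ω).prod (volume.restrict (Ioo 0 T)), z.2 ∈ Ioo 0 T :=
    Measure.quasiMeasurePreserving_snd.ae (ae_restrict_mem measurableSet_Ioo)
  filter_upwards [h2] with z hz
  exact timePrim_eq (Ioo_subset_Icc_self hz) z.1

theorem stronglyMeasurable_timePrim (hg : StronglyMeasurable g) :
    StronglyMeasurable fun z : EuclideanSpace ℝ (Fin n) × ℝ =>
      ∫ s in Ioo 0 T, if s ≤ z.2 then g (z.1, s) else 0 := by
  refine StronglyMeasurable.integral_prod_right
    (f := fun (z : EuclideanSpace ℝ (Fin n) × ℝ) (s : ℝ) => if s ≤ z.2 then g (z.1, s) else 0) ?_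
  refine StronglyMeasurable.ite ?_ (hg.comp_measurable (by fun_prop)) stronglyMeasurable_const
  exact measurableSet_le measurable_snd (measurable_snd.comp measurable_fst)

theorem aestronglyMeasurable_timePrim (hg : StronglyMeasurable g) :
    AEStronglyMeasurable (timePrim g) ((volume.restrict Ω).prod (volume.restrict (Ioo 0 T))) :=
  ((stronglyMeasurable_timePrim hg).aestronglyMeasurable).congr timePrim_ae_eq.symm

/-- Hölder continuity, with exponent `1/2`, of the primitive of a square integrable function. -/
theorem sq_intervalIntegral_le {g : ℝ → ℝ} (hg : MemLp g 2 (volume.restrict (Ioo 0 T)))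
    {a b : ℝ} (ha : a ∈ Icc 0 T) (hb : b ∈ Icc 0 T) :
    (∫ s in a..b, g s) ^ 2 ≤ |b - a| * ∫ s in Ioo 0 T, g s ^ 2 := by
  wlog hab : a ≤ b generalizing a b
  · rw [intervalIntegral.integral_symm, neg_sq, abs_sub_comm]
    exact this hb ha (le_of_not_ge hab)
  have hs : Ioo a b ⊆ Ioo 0 T := Ioo_subset_Ioo ha.1 hb.2
  rw [intervalIntegral.integral_of_le hab, integral_Ioc_eq_integral_Ioo]
  have h1 := sq_integral_le (hg.mono_measure (Measure.restrict_mono_set volume hs))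
  have h2 : (volume.restrict (Ioo a b)).real univ = |b - a| := by
    rw [measureReal_restrict_apply_univ, Real.volume_real_Ioo_of_le hab,
      abs_of_nonneg (by linarith)]
  rw [h2] at h1
  refine h1.trans (mul_le_mul_of_nonneg_left ?_ (abs_nonneg _))
  exact setIntegral_mono_set hg.integrable_sq (ae_of_all _ fun s => sq_nonneg _)
    (Eventually.of_forall hs)

end Representation

section Slices

variable {α γ : Type*} [MeasurableSpace α] [MeasurableSpace γ] {μ : Measure α} {ν : Measure γ}
  [IsFiniteMeasure μ] [IsFiniteMeasure ν]

theorem ae_memLp_slice {g : α × γ → ℝ} (hg : MemLp g 2 (μ.prod ν)) :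
    ∀ᵐ x ∂μ, MemLp (fun y => g (x, y)) 2 ν := by
  filter_upwards [hg.integrable_sq.prod_right_ae, hg.1.prodMk_left] with x h1 h2
  exact (memLp_two_iff_integrable_sq h2).2 h1

theorem ae_memLp_slice_left {g : α × γ → ℝ} (hg : MemLp g 2 (μ.prod ν)) :
    ∀ᵐ y ∂ν, MemLp (fun x => g (x, y)) 2 μ := by
  have h : MemLp (fun z : γ × α => g z.swap) 2 (ν.prod μ) :=
    hg.comp_measurePreserving Measure.measurePreserving_swap
  exact ae_memLp_slice h

theorem memLp_of_comp_fst (hν : ν ≠ 0) {c : α → ℝ}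
    (hc : MemLp (fun z : α × γ => c z.1) 2 (μ.prod ν)) : MemLp c 2 μ := by
  have : (ae ν).NeBot := ae_neBot.2 hν
  exact (ae_memLp_slice_left hc).exists.choose_spec

end Slices

section Representation

variable {n : ℕ} {Ω : Set (EuclideanSpace ℝ (Fin n))} {T : ℝ}
  {f g : EuclideanSpace ℝ (Fin n) × ℝ → ℝ}

theorem restrict_Ioo_ne_zero (hT : 0 < T) : (volume : Measure ℝ).restrict (Ioo 0 T) ≠ 0 := by
  rw [Ne, Measure.restrict_eq_zero, Real.volume_Ioo]
  simpa using hT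

theorem ae_snd_mem : ∀ᵐ z ∂(volume.restrict Ω).prod (volume.restrict (Ioo 0 T)),
    z.2 ∈ Ioo 0 T :=
  Measure.quasiMeasurePreserving_snd.ae (ae_restrict_mem measurableSet_Ioo)

theorem memLp_timePrim [IsFiniteMeasure (volume.restrict Ω)] (hT : 0 < T)
    (hg : MemLp g 2 ((volume.restrict Ω).prod (volume.restrict (Ioo 0 T))))
    (hgm : StronglyMeasurable g) :
    MemLp (timePrim g) 2 ((volume.restrict Ω).prod (volume.restrict (Ioo 0 T))) := by
  have hm := aestronglyMeasurable_timePrim (Ω := Ω) (T := T) hgm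
  rw [memLp_two_iff_integrable_sq hm]
  have hG := (hg.integrable_sq.integral_prod_left.const_mul T).comp_fst (volume.restrict (Ioo 0 T))
  refine hG.mono' (hm.pow 2) ?_
  filter_upwards [ae_snd_mem, Measure.quasiMeasurePreserving_fst.ae (ae_memLp_slice hg)] with z h1 h2
  rw [norm_pow, Real.norm_eq_abs, sq_abs]
  refine (sq_intervalIntegral_le h2 ⟨le_rfl, hT.le⟩ (Ioo_subset_Icc_self h1)).trans ?_
  refine mul_le_mul_of_nonneg_right ?_ (integral_nonneg fun _ => sq_nonneg _)
  rw [sub_zero, abs_of_pos h1.1]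
  exact h1.2.le

/-- A square integrable function on the cylinder with square integrable weak time derivative `g`
is, up to a null set, a function of position plus the primitive of `g` in time. -/
theorem HasWeakDeriv.exists_representation [IsFiniteMeasure (volume.restrict Ω)] (hΩ : IsOpen Ω)
    (hT : 0 < T) (h : HasWeakDeriv (cyl Ω T) (0, 1) f g)
    (hf : MemLp f 2 ((volume.restrict Ω).prod (volume.restrict (Ioo 0 T))))
    (hg : MemLp g 2 ((volume.restrict Ω).prod (volume.restrict (Ioo 0 T))))
    (hgm : StronglyMeasurable g) :
    ∃ c, MemLp c 2 (volume.restrict Ω) ∧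
      f =ᵐ[(volume.restrict Ω).prod (volume.restrict (Ioo 0 T))]
        fun z => c z.1 + timePrim g z := by
  set μ := (volume : Measure (EuclideanSpace ℝ (Fin n))).restrict Ω with hμ
  set ν := (volume : Measure ℝ).restrict (Ioo 0 T) with hν
  have hF := memLp_timePrim hT hg hgm
  have hf1 : Integrable f (μ.prod ν) := hf.integrable one_le_two
  have hg1 : Integrable g (μ.prod ν) := hg.integrable one_le_two
  have hF1 : Integrable (timePrim g) (μ.prod ν) := hF.integrable one_le_two
  set r := f - timePrim g with hr
  have hr1 : Integrable r (μ.prod ν) := hf1.sub hF1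
  -- the difference `r` is orthogonal to derivatives of test functions of time
  have orth : ∀ χ, IsTest (Ioo 0 T) χ → ∀ᵐ x ∂μ, ∫ t, r (x, t) * deriv χ t ∂ν = 0 := by
    intro χ hχ
    have hχd : IsTest (Ioo 0 T) (deriv χ) := by simpa using hχ.fderiv_apply 1
    obtain ⟨C', hC'⟩ := hχd.exists_bound
    have e := h.time_slice hΩ (by rwa [IntegrableOn, restrict_cyl])
      (by rwa [IntegrableOn, restrict_cyl]) hχ
    filter_upwards [e, hg1.prod_right_ae, hf1.prod_right_ae, hF1.prod_right_ae]
      with x hx1 hx2 hx3 hx4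
    have e2 := integral_primitive_mul_deriv hT hx2 hχ
    have e3 : ∀ t, r (x, t) * deriv χ t
        = f (x, t) * deriv χ t - timePrim g (x, t) * deriv χ t := fun t => by
      simp only [hr, Pi.sub_apply]; ring
    simp_rw [e3]
    rw [integral_sub, hx1]
    · simp only [timePrim]
      rw [e2, sub_self]
    · exact hx3.mul_bdd (c := C') hχd.continuous.aestronglyMeasurable (ae_of_all _ hC')
    · exact hx4.mul_bdd (c := C') hχd.continuous.aestronglyMeasurable (ae_of_all _ hC')
  set c : EuclideanSpace ℝ (Fin n) → ℝ := fun x => T⁻¹ * ∫ t, r (x, t) ∂ν with hc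
  have hc1 : Integrable c μ := hr1.integral_prod_left.const_mul _
  have hc2 : Integrable (fun z : EuclideanSpace ℝ (Fin n) × ℝ => c z.1) (μ.prod ν) :=
    hc1.comp_fst ν
  have hd0 : (fun z => r z - c z.1) =ᵐ[μ.prod ν] 0 := by
    -- The null set in `orth` depends on `χ`. Integration over `A` removes it, so that the lemma of
    -- du Bois-Reymond applies without a countable dense family of test functions.
    refine ae_eq_zero_of_forall_integral_rectangle (hr1.sub hc2) fun A B hA hB => ?_
    have hrA : Integrable r ((μ.restrict A).prod ν) := by
      have : (μ.restrict A).prod ν = (μ.prod ν).restrict (A ×ˢ univ) := by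
        rw [← Measure.prod_restrict, Measure.restrict_univ]
      rw [this]
      exact hr1.integrableOn
    have hm : Integrable (fun t => ∫ x in A, r (x, t) ∂μ) ν := hrA.integral_prod_right
    obtain ⟨k, hk⟩ := ae_eq_const_of_integral_mul_deriv_eq_zero hT hm fun χ hχ => by
      have hχd : IsTest (Ioo 0 T) (deriv χ) := by simpa using hχ.fderiv_apply 1
      obtain ⟨C', hC'⟩ := hχd.exists_bound
      simp_rw [← integral_mul_const]
      rw [← integral_integral_swap (f := fun x t => r (x, t) * deriv χ t)]
      · refine integral_eq_zero_of_ae (ae_restrict_of_ae ?_)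
        filter_upwards [orth χ hχ] with x hx using hx
      · exact hrA.mul_bdd (c := C') (hχd.continuous.comp continuous_snd).aestronglyMeasurable
          (ae_of_all _ fun z => hC' z.2)
    have hkc : k = ∫ x in A, c x ∂μ := by
      have e1 : ∫ t, (∫ x in A, r (x, t) ∂μ) ∂ν = k * T := by
        rw [integral_congr_ae hk, integral_const, measureReal_restrict_apply_univ,
          Real.volume_real_Ioo_of_le hT.le]
        simp [mul_comm]
      rw [← integral_integral_swap (f := fun x t => r (x, t)) hrA] at e1
      simp only [hc]
      rw [integral_const_mul, e1]
      field_simp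
    rw [← Measure.prod_restrict, integral_prod_symm]
    · refine integral_eq_zero_of_ae (ae_restrict_of_ae ?_)
      filter_upwards [hk, hrA.prod_left_ae] with t ht ht2
      simp only [Pi.zero_apply]
      rw [integral_sub ht2 hc1.integrableOn, ht, hkc, sub_self]
    · rw [Measure.prod_restrict]
      exact (hr1.sub hc2).integrableOn
  refine ⟨c, memLp_of_comp_fst (restrict_Ioo_ne_zero hT) ((hf.sub hF).ae_eq ?_), ?_⟩
  · filter_upwards [hd0] with z hz
    have : r z = c z.1 := sub_eq_zero.1 hz
    simpa [hr] using this
  · filter_upwards [hd0] with z hz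
    have : r z = c z.1 := sub_eq_zero.1 hz
    rw [← this, hr]
    simp

/-- The value at time `τ` of the representative `c + timePrim g` is square integrable over `Ω`; this
is the trace at `τ`. -/
theorem memLp_add_timePrim [IsFiniteMeasure (volume.restrict Ω)]
    {c : EuclideanSpace ℝ (Fin n) → ℝ} (hc : MemLp c 2 (volume.restrict Ω))
    (hg : MemLp g 2 ((volume.restrict Ω).prod (volume.restrict (Ioo 0 T))))
    (hgm : StronglyMeasurable g) {τ : ℝ} (hτ : τ ∈ Icc 0 T) :
    MemLp (fun x => c x + timePrim g (x, τ)) 2 (volume.restrict Ω) := by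
  refine hc.add ?_
  have hm : AEStronglyMeasurable (fun x => timePrim g (x, τ)) (volume.restrict Ω) := by
    simp_rw [timePrim_eq hτ]
    exact ((stronglyMeasurable_timePrim hgm).comp_measurable
      (measurable_prodMk_right (y := τ))).aestronglyMeasurable
  rw [memLp_two_iff_integrable_sq hm]
  refine (hg.integrable_sq.integral_prod_left.const_mul T).mono' (hm.pow 2) ?_
  filter_upwards [(ae_memLp_slice hg)] with x h2
  rw [norm_pow, Real.norm_eq_abs, sq_abs]
  refine (sq_intervalIntegral_le h2 ⟨le_rfl, hτ.1.trans hτ.2⟩ hτ).trans ?_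
  refine mul_le_mul_of_nonneg_right ?_ (integral_nonneg fun _ => sq_nonneg _)
  rw [sub_zero, abs_of_nonneg hτ.1]
  exact hτ.2

theorem enorm_sq_eq_ofReal (a : ℝ) : ‖a‖ₑ ^ 2 = ENNReal.ofReal (a ^ 2) := by
  rw [Real.enorm_eq_ofReal_abs, ← ENNReal.ofReal_pow (abs_nonneg a), sq_abs]

theorem restrict_window (J : Set ℝ) :
    (volume : Measure (EuclideanSpace ℝ (Fin n) × ℝ)).restrict (Ω ×ˢ (Ioo 0 T ∩ J))
      = (volume.restrict Ω).prod (volume.restrict (Ioo 0 T ∩ J)) := by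
  rw [Measure.prod_restrict]; rfl

theorem ae_window {J : Set ℝ} {P : EuclideanSpace ℝ (Fin n) × ℝ → Prop}
    (h : ∀ᵐ z ∂(volume.restrict Ω).prod (volume.restrict (Ioo 0 T)), P z) :
    ∀ᵐ z ∂(volume : Measure (EuclideanSpace ℝ (Fin n) × ℝ)).restrict (Ω ×ˢ (Ioo 0 T ∩ J)), P z := by
  rw [← restrict_cyl] at h
  exact ae_restrict_of_ae_restrict_of_subset (prod_mono_right inter_subset_left) h

theorem hasTimeTrace_of_representation [IsFiniteMeasure (volume.restrict Ω)] (hΩ : IsOpen Ω)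
    {c : EuclideanSpace ℝ (Fin n) → ℝ} (hc : MemLp c 2 (volume.restrict Ω))
    (hg : MemLp g 2 ((volume.restrict Ω).prod (volume.restrict (Ioo 0 T))))
    (hgm : StronglyMeasurable g)
    (hf : f =ᵐ[(volume.restrict Ω).prod (volume.restrict (Ioo 0 T))]
      fun z => c z.1 + timePrim g z) {τ : ℝ} (hτ : τ ∈ Icc 0 T) :
    HasTimeTrace Ω T f τ (fun x => c x + timePrim g (x, τ)) := by
  refine ⟨memLp_add_timePrim hc hg hgm hτ, ?_⟩
  set G : EuclideanSpace ℝ (Fin n) → ℝ := fun x => ∫ s in Ioo 0 T, g (x, s) ^ 2 with hG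
  have hGi : Integrable G (volume.restrict Ω) := hg.integrable_sq.integral_prod_left
  have hKf : ∫⁻ x in Ω, ENNReal.ofReal (G x) ≠ ⊤ := hGi.lintegral_lt_top.ne
  have hlim : Tendsto (fun h : ℝ => (∫⁻ x in Ω, ENNReal.ofReal (G x)) * ENNReal.ofReal (2 * h))
      (𝓝[>] 0) (𝓝 0) := by
    have h1 : Tendsto (fun h : ℝ => ENNReal.ofReal (2 * h)) (𝓝[>] 0) (𝓝 0) := by
      have : Tendsto (fun h : ℝ => ENNReal.ofReal (2 * h)) (𝓝 0) (𝓝 (ENNReal.ofReal (2 * 0))) :=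
        (ENNReal.continuous_ofReal.comp (by fun_prop)).tendsto 0
      rw [mul_zero, ENNReal.ofReal_zero] at this
      exact this.mono_left nhdsWithin_le_nhds
    have h2 := ENNReal.Tendsto.const_mul h1 (Or.inr hKf)
    rwa [mul_zero] at h2
  refine tendsto_of_tendsto_of_tendsto_of_le_of_le' tendsto_const_nhds hlim
    (Eventually.of_forall fun _ => zero_le) ?_
  filter_upwards [self_mem_nhdsWithin] with h hh
  have hh : 0 < h := hh
  have hs : MeasurableSet (Ω ×ˢ (Ioo 0 T ∩ Ioo (τ - h) (τ + h))) :=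
    hΩ.measurableSet.prod (measurableSet_Ioo.inter measurableSet_Ioo)
  have hle : ∫⁻ z in Ω ×ˢ (Ioo 0 T ∩ Ioo (τ - h) (τ + h)),
        ‖f z - (c z.1 + timePrim g (z.1, τ))‖ₑ ^ 2
      ≤ ∫⁻ z in Ω ×ˢ (Ioo 0 T ∩ Ioo (τ - h) (τ + h)),
        (ENNReal.ofReal h * ENNReal.ofReal (G z.1)) * (fun _ => 1) z.2 := by
    refine lintegral_mono_ae ?_
    filter_upwards [ae_window hf, ae_window (Measure.quasiMeasurePreserving_fst.ae (ae_memLp_slice hg)),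
      ae_restrict_mem hs] with z h1 h2 h3
    have hz : z.2 ∈ Icc 0 T := Ioo_subset_Icc_self h3.2.1
    have hd : f z - (c z.1 + timePrim g (z.1, τ)) = ∫ s in τ..z.2, g (z.1, s) := by
      have hi : IntegrableOn (fun s => g (z.1, s)) (Icc 0 T) volume := by
        rw [integrableOn_Icc_iff_integrableOn_Ioo]
        exact h2.integrable one_le_two
      have hii : ∀ t ∈ Icc 0 T, IntervalIntegrable (fun s => g (z.1, s)) volume 0 t := by
        intro t ht
        rw [intervalIntegrable_iff_integrableOn_Icc_of_le ht.1]
        exact hi.mono_set (Icc_subset_Icc_right ht.2)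
      rw [h1, ← intervalIntegral.integral_interval_sub_left (hii _ hz) (hii _ hτ)]
      simp only [timePrim]
      ring
    rw [enorm_sq_eq_ofReal, hd, mul_one, ← ENNReal.ofReal_mul hh.le]
    refine ENNReal.ofReal_le_ofReal ((sq_intervalIntegral_le h2 hτ hz).trans ?_)
    refine mul_le_mul_of_nonneg_right ?_ (integral_nonneg fun _ => sq_nonneg _)
    have h4 := h3.2.2
    rw [abs_le]
    constructor <;> linarith [h4.1, h4.2]
  have hvol : volume (Ioo 0 T ∩ Ioo (τ - h) (τ + h)) ≤ ENNReal.ofReal (2 * h) := by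
    refine (measure_mono inter_subset_right).trans ?_
    rw [Real.volume_Ioo]
    exact ENNReal.ofReal_le_ofReal (by linarith)
  calc _ ≤ (ENNReal.ofReal h)⁻¹ * ∫⁻ z in Ω ×ˢ (Ioo 0 T ∩ Ioo (τ - h) (τ + h)),
        (ENNReal.ofReal h * ENNReal.ofReal (G z.1)) * (fun _ => 1) z.2 := by gcongr
    _ = (ENNReal.ofReal h)⁻¹ * (ENNReal.ofReal h * (∫⁻ x in Ω, ENNReal.ofReal (G x))
        * volume (Ioo 0 T ∩ Ioo (τ - h) (τ + h))) := by
      rw [restrict_window, lintegral_prod_mul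
        (f := fun x => ENNReal.ofReal h * ENNReal.ofReal (G x)) (g := fun _ => 1)
        (hGi.1.aemeasurable.ennreal_ofReal.const_mul _) aemeasurable_const,
        lintegral_const_mul'' _ hGi.1.aemeasurable.ennreal_ofReal]
      simp
    _ = (∫⁻ x in Ω, ENNReal.ofReal (G x)) * volume (Ioo 0 T ∩ Ioo (τ - h) (τ + h)) := by
      rw [mul_assoc, ← mul_assoc, ENNReal.inv_mul_cancel (by simpa using hh) (by simp), one_mul]
    _ ≤ _ := by gcongr

/-- The traces at the initial and at the final time are unique. -/
theorem HasTimeTrace.unique (hT : 0 < T) {τ : ℝ} (hτ : τ = 0 ∨ τ = T)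
    (hf : AEStronglyMeasurable f ((volume.restrict Ω).prod (volume.restrict (Ioo 0 T))))
    {a b : EuclideanSpace ℝ (Fin n) → ℝ} (ha : HasTimeTrace Ω T f τ a)
    (hb : HasTimeTrace Ω T f τ b) : a =ᵐ[volume.restrict Ω] b := by
  have hm : AEMeasurable (fun x => ‖a x - b x‖ₑ ^ 2) (volume.restrict Ω) :=
    ((ha.1.1.sub hb.1.1).enorm).pow_const 2
  have hlim := (ENNReal.Tendsto.const_mul (a := 4) (ha.2.add hb.2) (Or.inr (by simp)))
  rw [add_zero, mul_zero] at hlim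
  have hle : ∫⁻ x in Ω, ‖a x - b x‖ₑ ^ 2 ≤ 0 := by
    refine ge_of_tendsto hlim ?_
    have hev : ∀ᶠ h in 𝓝[>] (0 : ℝ), h < T := (gt_mem_nhds hT).filter_mono nhdsWithin_le_nhds
    filter_upwards [self_mem_nhdsWithin, hev] with h hh hhT
    have hh : 0 < h := hh
    have hvol : ENNReal.ofReal h ≤ volume (Ioo 0 T ∩ Ioo (τ - h) (τ + h)) := by
      rw [Ioo_inter_Ioo, Real.volume_Ioo]
      refine ENNReal.ofReal_le_ofReal ?_
      rcases hτ with rfl | rfl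
      · rw [max_eq_left (by linarith), min_eq_right (by linarith)]; linarith
      · rw [max_eq_right (by linarith), min_eq_left (by linarith)]; linarith
    have h0 : ENNReal.ofReal h ≠ 0 := by simpa using hh
    rw [← mul_add]
    calc ∫⁻ x in Ω, ‖a x - b x‖ₑ ^ 2
        = (ENNReal.ofReal h)⁻¹ * ((∫⁻ x in Ω, ‖a x - b x‖ₑ ^ 2) * ENNReal.ofReal h) := by
          rw [mul_comm, mul_assoc, ENNReal.mul_inv_cancel h0 (by simp), mul_one]
      _ ≤ (ENNReal.ofReal h)⁻¹ * ((∫⁻ x in Ω, ‖a x - b x‖ₑ ^ 2)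
          * volume (Ioo 0 T ∩ Ioo (τ - h) (τ + h))) := by gcongr
      _ = (ENNReal.ofReal h)⁻¹ * ∫⁻ z in Ω ×ˢ (Ioo 0 T ∩ Ioo (τ - h) (τ + h)),
          ‖a z.1 - b z.1‖ₑ ^ 2 * (fun _ => 1) z.2 := by
        rw [restrict_window, lintegral_prod_mul (f := fun x => ‖a x - b x‖ₑ ^ 2)
          (g := fun _ => 1) hm aemeasurable_const]
        simp
      _ ≤ (ENNReal.ofReal h)⁻¹ * ∫⁻ z in Ω ×ˢ (Ioo 0 T ∩ Ioo (τ - h) (τ + h)),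
          4 * (‖f z - a z.1‖ₑ ^ 2 + ‖f z - b z.1‖ₑ ^ 2) := by
        refine mul_le_mul_right (lintegral_mono fun z => ?_) _
        simp only [mul_one]
        rw [enorm_sq_eq_ofReal, enorm_sq_eq_ofReal, enorm_sq_eq_ofReal,
          ← ENNReal.ofReal_add (sq_nonneg _) (sq_nonneg _),
          show (4 : ℝ≥0∞) = ENNReal.ofReal 4 by simp, ← ENNReal.ofReal_mul (by norm_num)]
        refine ENNReal.ofReal_le_ofReal ?_
        nlinarith [sq_nonneg (f z - a z.1 + (f z - b z.1)), sq_nonneg (f z - a z.1),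
          sq_nonneg (f z - b z.1)]
      _ = _ := by
        have hma : AEMeasurable (fun z : EuclideanSpace ℝ (Fin n) × ℝ => ‖f z - a z.1‖ₑ ^ 2)
            (volume.restrict (Ω ×ˢ (Ioo 0 T ∩ Ioo (τ - h) (τ + h)))) := by
          rw [restrict_window]
          refine (((hf.mono_measure ?_).sub ha.1.1.comp_fst).enorm).pow_const 2
          exact Measure.prod_mono le_rfl (Measure.restrict_mono_set volume inter_subset_left)
        rw [lintegral_const_mul' _ _ (by simp), lintegral_add_left' hma]
        ring
  have h0 := (lintegral_eq_zero_iff' hm).1 (le_antisymm hle zero_le)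
  filter_upwards [h0] with x hx
  simpa [sub_eq_zero] using hx

end Representation

section Traces

variable {n : ℕ} {Ω : Set (EuclideanSpace ℝ (Fin n))} {T : ℝ}
  {f g : EuclideanSpace ℝ (Fin n) × ℝ → ℝ}

/-- A square integrable function with square integrable weak time derivative has traces at the
initial and at the final time, and these appear in the energy identity with a smooth weight. -/
theorem HasWeakDeriv.exists_traces (hΩ : IsOpen Ω) (hΩb : Bornology.IsBounded Ω) (hT : 0 < T)
    (h : HasWeakDeriv (cyl Ω T) (0, 1) f g)
    (hf : MemLp f 2 (volume.restrict (cyl Ω T))) (hg : MemLp g 2 (volume.restrict (cyl Ω T))) :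
    ∃ f₀ fT, HasTimeTrace Ω T f 0 f₀ ∧ HasTimeTrace Ω T f T fT ∧
      ∀ η : ℝ → ℝ, ContDiff ℝ ∞ η →
        ∫ z in cyl Ω T, (2 * η z.2 * (f z * g z) + deriv η z.2 * f z ^ 2)
          = η T * (∫ x in Ω, fT x ^ 2) - η 0 * ∫ x in Ω, f₀ x ^ 2 := by
  have hfin := isFiniteMeasure_restrict hΩb
  -- a strongly measurable representative of the derivative
  have hgg : g =ᵐ[volume.restrict (cyl Ω T)] hg.1.mk g := hg.1.ae_eq_mk
  have hgm : StronglyMeasurable (hg.1.mk g) := hg.1.stronglyMeasurable_mk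
  have h' : HasWeakDeriv (cyl Ω T) (0, 1) f (hg.1.mk g) :=
    h.congr (isOpen_cyl hΩ) (ae_eq_refl f) hgg
  have hg' : MemLp (hg.1.mk g) 2 (volume.restrict (cyl Ω T)) := hg.ae_eq hgg
  generalize hg.1.mk g = k at hgg hgm h' hg'
  rw [restrict_cyl] at hf hg hg' hgg
  obtain ⟨c, hc, hr⟩ := h'.exists_representation hΩ hT hf hg' hgm
  have m0 : (0 : ℝ) ∈ Icc 0 T := ⟨le_rfl, hT.le⟩
  have mT : T ∈ Icc 0 T := ⟨hT.le, le_rfl⟩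
  refine ⟨_, _, hasTimeTrace_of_representation hΩ hc hg' hgm hr m0,
    hasTimeTrace_of_representation hΩ hc hg' hgm hr mT, fun η hη => ?_⟩
  have hηd : Continuous (deriv η) := hη.continuous_deriv (by simp)
  obtain ⟨C, hC⟩ := isCompact_Icc.exists_bound_of_continuousOn (s := Icc 0 T)
    hη.continuous.continuousOn
  obtain ⟨C', hC'⟩ := isCompact_Icc.exists_bound_of_continuousOn (s := Icc 0 T) hηd.continuousOn
  have i1 : Integrable (fun z => 2 * η z.2 * (f z * g z))
      ((volume.restrict Ω).prod (volume.restrict (Ioo 0 T))) := by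
    refine (hf.integrable_mul hg).bdd_mul (c := 2 * C) (f := fun z => 2 * η z.2)
      ((continuous_const.mul (hη.continuous.comp continuous_snd)).aestronglyMeasurable) ?_
    filter_upwards [ae_snd_mem] with z hz
    rw [norm_mul, Real.norm_ofNat]
    exact mul_le_mul_of_nonneg_left (hC _ (Ioo_subset_Icc_self hz)) (by norm_num)
  have i2 : Integrable (fun z => deriv η z.2 * f z ^ 2)
      ((volume.restrict Ω).prod (volume.restrict (Ioo 0 T))) := by
    refine hf.integrable_sq.bdd_mul (c := C') (f := fun z => deriv η z.2)
      (hηd.comp continuous_snd).aestronglyMeasurable ?_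
    filter_upwards [ae_snd_mem] with z hz
    exact hC' _ (Ioo_subset_Icc_self hz)
  have i3 : Integrable (fun z => 2 * η z.2 * (f z * g z) + deriv η z.2 * f z ^ 2)
      ((volume.restrict Ω).prod (volume.restrict (Ioo 0 T))) := i1.add i2
  rw [restrict_cyl, integral_prod _ i3]
  have e : ∀ᵐ x ∂volume.restrict Ω,
      ∫ t in Ioo 0 T, (2 * η t * (f (x, t) * g (x, t)) + deriv η t * f (x, t) ^ 2)
        = η T * (c x + timePrim k (x, T)) ^ 2 - η 0 * (c x + timePrim k (x, 0)) ^ 2 := by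
    filter_upwards [Measure.ae_ae_of_ae_prod hr, Measure.ae_ae_of_ae_prod hgg,
      ae_memLp_slice hg'] with x h1 h2 h3
    refine Eq.trans ?_ (integral_deriv_sq_primitive hT (h3.integrable one_le_two) (c x) hη
      (φ := fun t => c x + timePrim k (x, t)) rfl)
    refine integral_congr_ae ?_
    filter_upwards [h1, h2] with t h4 h5
    rw [h4, h5]
  rw [integral_congr_ae e, integral_sub, integral_const_mul, integral_const_mul]
  · exact (memLp_add_timePrim hc hg' hgm mT).integrable_sq.const_mul _
  · exact (memLp_add_timePrim hc hg' hgm m0).integrable_sq.const_mul _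

/-- Averages over short time windows converge to the trace when tested against a bounded
function. -/
theorem HasTimeTrace.tendsto_integral_sub (hΩb : Bornology.IsBounded Ω) {τ : ℝ}
    (hf : MemLp f 2 (volume.restrict (cyl Ω T))) {a w : EuclideanSpace ℝ (Fin n) → ℝ}
    (ha : HasTimeTrace Ω T f τ a) {C : ℝ} (hw : Continuous w) (hC : ∀ x, ‖w x‖ ≤ C) :
    Tendsto (fun h : ℝ => h⁻¹ * ∫ z in Ω ×ˢ (Ioo 0 T ∩ Ioo (τ - h) (τ + h)),
      (f z - a z.1) * w z.1) (𝓝[>] 0) (𝓝 0) := by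
  have hfin := isFiniteMeasure_restrict hΩb
  have hC0 : 0 ≤ C := (norm_nonneg _).trans (hC 0)
  have h1 := (ENNReal.tendsto_toReal (by simp : (0 : ℝ≥0∞) ≠ ⊤)).comp ha.2
  have h2 : Tendsto (fun h : ℝ => √(2 * volume.real Ω * C ^ 2 *
      ((ENNReal.ofReal h)⁻¹ * ∫⁻ z in Ω ×ˢ (Ioo 0 T ∩ Ioo (τ - h) (τ + h)),
        ‖f z - a z.1‖ₑ ^ 2).toReal)) (𝓝[>] 0) (𝓝 0) := by
    have := (Real.continuous_sqrt.tendsto _).comp (h1.const_mul (2 * volume.real Ω * C ^ 2))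
    simpa [Function.comp_def] using this
  refine squeeze_zero_norm' ?_ h2
  filter_upwards [self_mem_nhdsWithin] with h hh
  have hh : 0 < h := hh
  set m := (volume : Measure (EuclideanSpace ℝ (Fin n) × ℝ)).restrict
    (Ω ×ˢ (Ioo 0 T ∩ Ioo (τ - h) (τ + h))) with hm
  have hmle : m ≤ volume.restrict (cyl Ω T) :=
    Measure.restrict_mono_set volume (prod_mono_right inter_subset_left)
  have hmfin : IsFiniteMeasure m := by
    have := isFiniteMeasure_restrict_cyl (T := T) hΩb
    exact isFiniteMeasure_of_le _ hmle
  have hd : MemLp (fun z => f z - a z.1) 2 m := by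
    have : MemLp (fun z : EuclideanSpace ℝ (Fin n) × ℝ => a z.1) 2 (volume.restrict (cyl Ω T)) := by
      rw [restrict_cyl]
      exact ha.1.comp_fst _
    exact (hf.sub this).mono_measure hmle
  have hdw : MemLp (fun z => (f z - a z.1) * w z.1) 2 m := by
    refine (hd.const_mul C).mono
      (hd.1.mul (hw.comp continuous_fst).aestronglyMeasurable) (ae_of_all _ fun z => ?_)
    rw [norm_mul, norm_mul, mul_comm, Real.norm_of_nonneg hC0]
    exact mul_le_mul_of_nonneg_right (hC _) (norm_nonneg _)
  have h3 := sq_integral_le hdw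
  have h4 : ∫ z, ((f z - a z.1) * w z.1) ^ 2 ∂m ≤ C ^ 2 * ∫ z, (f z - a z.1) ^ 2 ∂m := by
    rw [← integral_const_mul]
    refine integral_mono hdw.integrable_sq (hd.integrable_sq.const_mul _) fun z => ?_
    simp only
    rw [mul_pow, mul_comm]
    refine mul_le_mul_of_nonneg_right ?_ (sq_nonneg _)
    rw [← sq_abs, ← Real.norm_eq_abs]
    exact pow_le_pow_left₀ (norm_nonneg _) (hC _) 2
  have h5 : ∫ z, (f z - a z.1) ^ 2 ∂m = (∫⁻ z, ‖f z - a z.1‖ₑ ^ 2 ∂m).toReal := by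
    rw [integral_eq_lintegral_of_nonneg_ae (ae_of_all _ fun z => sq_nonneg _)
      hd.integrable_sq.1]
    simp_rw [enorm_sq_eq_ofReal]
  have h6 : m.real univ ≤ volume.real Ω * (2 * h) := by
    have : IsFiniteMeasure (volume.restrict (Ioo 0 T ∩ Ioo (τ - h) (τ + h))) :=
      isFiniteMeasure_of_le (volume.restrict (Ioo (τ - h) (τ + h)))
        (Measure.restrict_mono_set volume inter_subset_right)
    rw [hm, restrict_window, ← univ_prod_univ, measureReal_prod_prod,
      measureReal_restrict_apply_univ, measureReal_restrict_apply_univ]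
    refine mul_le_mul_of_nonneg_left ?_ measureReal_nonneg
    refine (measureReal_mono inter_subset_right (by simp)).trans ?_
    rw [Real.volume_real_Ioo_of_le (by linarith)]
    linarith
  rw [Real.norm_eq_abs, ENNReal.toReal_mul, ENNReal.toReal_inv, ENNReal.toReal_ofReal hh.le, ← h5]
  refine Real.abs_le_sqrt ?_
  have h7 : 0 ≤ ∫ z, (f z - a z.1) ^ 2 ∂m := integral_nonneg fun _ => sq_nonneg _
  calc (h⁻¹ * ∫ z, (f z - a z.1) * w z.1 ∂m) ^ 2
      = h⁻¹ ^ 2 * (∫ z, (f z - a z.1) * w z.1 ∂m) ^ 2 := by ring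
    _ ≤ h⁻¹ ^ 2 * ((volume.real Ω * (2 * h)) * (C ^ 2 * ∫ z, (f z - a z.1) ^ 2 ∂m)) := by
        refine mul_le_mul_of_nonneg_left (h3.trans ?_) (sq_nonneg _)
        exact mul_le_mul h6 h4 (integral_nonneg fun _ => sq_nonneg _) (by positivity)
    _ = _ := by field_simp

/-- The trace of a weak derivative in a spatial direction is the weak derivative of the trace. -/
theorem HasTimeTrace.hasWeakDeriv (hΩb : Bornology.IsBounded Ω) (hT : 0 < T)
    {τ : ℝ} (hτ : τ = 0 ∨ τ = T) {v : EuclideanSpace ℝ (Fin n)}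
    (h : HasWeakDeriv (cyl Ω T) (v, 0) f g)
    (hf : MemLp f 2 (volume.restrict (cyl Ω T))) (hg : MemLp g 2 (volume.restrict (cyl Ω T)))
    {a b : EuclideanSpace ℝ (Fin n) → ℝ} (ha : HasTimeTrace Ω T f τ a)
    (hb : HasTimeTrace Ω T g τ b) : HasWeakDeriv Ω v a b := by
  have hfin := isFiniteMeasure_restrict hΩb
  have hfinc := isFiniteMeasure_restrict_cyl (T := T) hΩb
  have la : LocallyIntegrableOn a Ω volume :=
    IntegrableOn.locallyIntegrableOn (ha.1.integrable one_le_two)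
  have lb : LocallyIntegrableOn b Ω volume :=
    IntegrableOn.locallyIntegrableOn (hb.1.integrable one_le_two)
  refine ⟨la, lb, fun ζ h1 h2 h3 => ?_⟩
  have hζ : IsTest Ω ζ := ⟨h1, h2, h3⟩
  have hζv := hζ.fderiv_apply v
  obtain ⟨C, hC⟩ := hζ.exists_bound
  obtain ⟨C', hC'⟩ := hζv.exists_bound
  have hlim := (ha.tendsto_integral_sub hΩb hf hζv.continuous hC').add
    (hb.tendsto_integral_sub hΩb hg hζ.continuous hC)
  rw [add_zero] at hlim
  have hs := h.space_slice (hf.integrable one_le_two) (hg.integrable one_le_two) hζ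
  have hev : ∀ᶠ h in 𝓝[>] (0 : ℝ), h < T := (gt_mem_nhds hT).filter_mono nhdsWithin_le_nhds
  have key : Tendsto (fun _ : ℝ => -((∫ x in Ω, a x * fderiv ℝ ζ x v) + ∫ x in Ω, b x * ζ x))
      (𝓝[>] 0) (𝓝 0) := by
    refine hlim.congr' ?_
    filter_upwards [self_mem_nhdsWithin, hev] with r hr hrT
    have hr : 0 < r := hr
    set J := Ioo 0 T ∩ Ioo (τ - r) (τ + r) with hJ
    -- one half of the window around an end of `(0, T)` lies inside, which has length `r`
    have hvol : volume.real J = r := by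
      rw [hJ, Ioo_inter_Ioo, measureReal_def, Real.volume_Ioo]
      rcases hτ with rfl | rfl
      · rw [max_eq_left (by linarith), min_eq_right (by linarith),
          ENNReal.toReal_ofReal (by linarith)]; linarith
      · rw [max_eq_right (by linarith), min_eq_left (by linarith),
          ENNReal.toReal_ofReal (by linarith)]; linarith
    have hJfin : IsFiniteMeasure (volume.restrict J) :=
      isFiniteMeasure_of_le (volume.restrict (Ioo 0 T))
        (Measure.restrict_mono_set volume inter_subset_left)
    have hle : (volume.restrict Ω).prod (volume.restrict J)
        ≤ (volume.restrict Ω).prod (volume.restrict (Ioo 0 T)) :=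
      Measure.prod_mono le_rfl (Measure.restrict_mono_set volume inter_subset_left)
    rw [restrict_cyl] at hf hg
    have jf : Integrable f ((volume.restrict Ω).prod (volume.restrict J)) :=
      (hf.mono_measure hle).integrable one_le_two
    have jg : Integrable g ((volume.restrict Ω).prod (volume.restrict J)) :=
      (hg.mono_measure hle).integrable one_le_two
    have bd : ∀ {F : EuclideanSpace ℝ (Fin n) × ℝ → ℝ} {w : EuclideanSpace ℝ (Fin n) → ℝ} {D : ℝ},
        Integrable F ((volume.restrict Ω).prod (volume.restrict J)) → Continuous w →
        (∀ x, ‖w x‖ ≤ D) →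
        Integrable (fun z => F z * w z.1) ((volume.restrict Ω).prod (volume.restrict J)) :=
      fun hF hw hD => hF.mul_bdd (hw.comp continuous_fst).aestronglyMeasurable
        (ae_of_all _ fun z => hD z.1)
    have split : ∀ {F : EuclideanSpace ℝ (Fin n) × ℝ → ℝ} {w c : EuclideanSpace ℝ (Fin n) → ℝ}
        {D : ℝ}, Integrable F ((volume.restrict Ω).prod (volume.restrict J)) →
        Integrable c (volume.restrict Ω) → Continuous w → (∀ x, ‖w x‖ ≤ D) →
        ∫ z, (F z - c z.1) * w z.1 ∂(volume.restrict Ω).prod (volume.restrict J)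
          = (∫ z, F z * w z.1 ∂(volume.restrict Ω).prod (volume.restrict J))
            - r * ∫ x in Ω, c x * w x := by
      intro F w c D hF hc hw hD
      simp_rw [sub_mul]
      rw [integral_sub (bd hF hw hD) (bd (hc.comp_fst _) hw hD)]
      congr 1
      have := integral_prod_mul (μ := volume.restrict Ω) (ν := volume.restrict J)
        (fun x => c x * w x) (fun _ => (1 : ℝ))
      simp only [mul_one, integral_const, smul_eq_mul, measureReal_restrict_apply_univ, hvol]
        at this
      rw [this, mul_comm]
    rw [restrict_window, split jf (ha.1.integrable one_le_two) hζv.continuous hC',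
      split jg (hb.1.integrable one_le_two) hζ.continuous hC,
      integral_prod_symm _ (bd jf hζv.continuous hC'), integral_prod_symm _ (bd jg hζ.continuous hC)]
    have e : ∫ t in J, ∫ x in Ω, f (x, t) * fderiv ℝ ζ x v
        = -∫ t in J, ∫ x in Ω, g (x, t) * ζ x := by
      rw [← integral_neg]
      exact integral_congr_ae
        (ae_restrict_of_ae_restrict_of_subset inter_subset_left hs)
    rw [e]
    field_simp
    ring
  have := tendsto_nhds_unique tendsto_const_nhds key
  linarith

end Traces

/-! ### Stability properties of the Sobolev spaces -/

section Sobolev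

variable {X : Type*} [NormedAddCommGroup X] [NormedSpace ℝ X] [MeasureSpace X] [BorelSpace X]
  [FiniteDimensional ℝ X] {U : Set X} {v w : X} {f g : X → ℝ}

theorem MemH1.hasWeakDeriv (h : MemH1 U f) (v : X) : HasWeakDeriv U v f (weakDeriv U v f) := by
  obtain ⟨g, hg, _⟩ := h.2 v
  exact hg.weakDeriv

theorem MemH1.memLp_weakDeriv (hU : IsOpen U) (h : MemH1 U f) (v : X) :
    MemLp (weakDeriv U v f) 2 (volume.restrict U) := by
  obtain ⟨g, hg, hg2⟩ := h.2 v
  exact hg2.ae_eq (hg.weakDeriv_ae_eq hU).symm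

theorem MemH1.congr (hU : IsOpen U) (h : MemH1 U f) (hfg : f =ᵐ[volume.restrict U] g) :
    MemH1 U g :=
  ⟨h.1.ae_eq hfg, fun v => by
    obtain ⟨k, hk, hk2⟩ := h.2 v
    exact ⟨k, hk.congr hU hfg (ae_eq_refl k), hk2⟩⟩

theorem MemH1.sub (hf : MemH1 U f) (hg : MemH1 U g) : MemH1 U (f - g) :=
  ⟨hf.1.sub hg.1, fun v => by
    obtain ⟨k, hk, hk2⟩ := hf.2 v
    obtain ⟨l, hl, hl2⟩ := hg.2 v
    exact ⟨k - l, hk.sub hl, hk2.sub hl2⟩⟩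

theorem MemH2.sub (hf : MemH2 U f) (hg : MemH2 U g) : MemH2 U (f - g) :=
  ⟨hf.1.sub hg.1, fun v => by
    obtain ⟨k, hk, hk2⟩ := hf.2 v
    obtain ⟨l, hl, hl2⟩ := hg.2 v
    exact ⟨k - l, hk.sub hl, hk2.sub hl2⟩⟩

theorem MemH2.memH1 (h : MemH2 U f) : MemH1 U f :=
  ⟨h.1, fun v => by
    obtain ⟨k, hk, hk2⟩ := h.2 v
    exact ⟨k, hk, hk2.1⟩⟩

theorem MemH2.memH1_weakDeriv (hU : IsOpen U) (h : MemH2 U f) (v : X) :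
    MemH1 U (weakDeriv U v f) := by
  obtain ⟨k, hk, hk2⟩ := h.2 v
  exact hk2.congr hU (hk.weakDeriv_ae_eq hU).symm

theorem weakDeriv_sub (hU : IsOpen U) (hf : MemH1 U f) (hg : MemH1 U g) (v : X) :
    weakDeriv U v (f - g) =ᵐ[volume.restrict U] weakDeriv U v f - weakDeriv U v g :=
  ((hf.hasWeakDeriv v).sub (hg.hasWeakDeriv v)).weakDeriv_ae_eq hU

theorem weakDeriv_congr (hU : IsOpen U) (hf : MemH1 U f) (hfg : f =ᵐ[volume.restrict U] g)
    (v : X) : weakDeriv U v g =ᵐ[volume.restrict U] weakDeriv U v f :=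
  ((hf.hasWeakDeriv v).congr hU hfg (ae_eq_refl _)).weakDeriv_ae_eq hU

theorem memLp_continuous_mul (hUb : Bornology.IsBounded U) (hU : IsOpen U) {a : X → ℝ}
    (ha : Continuous a) (hf : MemLp f 2 (volume.restrict U)) :
    MemLp (fun x => a x * f x) 2 (volume.restrict U) := by
  have : ProperSpace X := FiniteDimensional.proper_real X
  obtain ⟨C, hC⟩ := hUb.isCompact_closure.exists_bound_of_continuousOn ha.continuousOn
  refine (hf.const_mul C).mono (ha.aestronglyMeasurable.mul hf.1) ?_
  filter_upwards [ae_restrict_mem hU.measurableSet] with x hx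
  rw [norm_mul, norm_mul]
  refine mul_le_mul_of_nonneg_right ?_ (norm_nonneg _)
  exact (hC x (subset_closure hx)).trans (le_abs_self C)

theorem integrable_continuous_mul (hUb : Bornology.IsBounded U) (hU : IsOpen U) {a : X → ℝ}
    (ha : Continuous a) (hf : IntegrableOn f U volume) :
    IntegrableOn (fun x => a x * f x) U volume := by
  have : ProperSpace X := FiniteDimensional.proper_real X
  obtain ⟨C, hC⟩ := hUb.isCompact_closure.exists_bound_of_continuousOn ha.continuousOn
  refine Integrable.bdd_mul (c := C) hf ha.aestronglyMeasurable ?_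
  filter_upwards [ae_restrict_mem hU.measurableSet] with x hx
  exact hC x (subset_closure hx)

theorem MemH1.smooth_mul (hUb : Bornology.IsBounded U) (hU : IsOpen U) {a : X → ℝ}
    (ha : ContDiff ℝ ∞ a) (hf : MemH1 U f) : MemH1 U (fun x => a x * f x) := by
  refine ⟨memLp_continuous_mul hUb hU ha.continuous hf.1, fun v => ?_⟩
  refine ⟨_, (hf.hasWeakDeriv v).smooth_mul ha hU, ?_⟩
  refine (memLp_continuous_mul hUb hU ha.continuous (hf.memLp_weakDeriv hU v)).add
    (memLp_continuous_mul hUb hU ?_ hf.1)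
  exact ((ha.fderiv_right (m := ∞) (by simp)).clm_apply contDiff_const).continuous

variable [(volume : Measure X).IsAddHaarMeasure]

theorem memLp_mul_of_bounded {M : ℝ} (hf : AEStronglyMeasurable f (volume.restrict U))
    (hfM : ∀ᵐ x ∂volume.restrict U, |f x| ≤ M) (hg : MemLp g 2 (volume.restrict U)) :
    MemLp (fun x => f x * g x) 2 (volume.restrict U) := by
  refine (hg.const_mul M).mono (hf.mul hg.1) ?_
  filter_upwards [hfM] with x hx
  rw [norm_mul, norm_mul]
  exact mul_le_mul_of_nonneg_right (hx.trans (le_abs_self M)) (norm_nonneg _)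

theorem HasWeakDeriv.mul_of_bounded_memH1 (hU : IsOpen U) [IsFiniteMeasure (volume.restrict U)]
    {M : ℝ} (hf : MemH1 U f) (hg : MemH1 U g) (hfM : ∀ᵐ x ∂volume.restrict U, |f x| ≤ M)
    (hgM : ∀ᵐ x ∂volume.restrict U, |g x| ≤ M) (v : X) :
    HasWeakDeriv U v (fun x => f x * g x)
      (fun x => MFG.weakDeriv U v f x * g x + f x * MFG.weakDeriv U v g x) :=
  (hf.hasWeakDeriv v).mul_of_bounded hU (hg.hasWeakDeriv v)
    (hf.1.integrable one_le_two) ((hf.memLp_weakDeriv hU v).integrable one_le_two)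
    (hg.1.integrable one_le_two) ((hg.memLp_weakDeriv hU v).integrable one_le_two) hfM hgM

/-- The bounded functions of `H¹` form an algebra. -/
theorem MemH1.mul_of_bounded (hU : IsOpen U) [IsFiniteMeasure (volume.restrict U)]
    {M : ℝ} (hf : MemH1 U f) (hg : MemH1 U g) (hfM : ∀ᵐ x ∂volume.restrict U, |f x| ≤ M)
    (hgM : ∀ᵐ x ∂volume.restrict U, |g x| ≤ M) : MemH1 U (fun x => f x * g x) := by
  refine ⟨memLp_mul_of_bounded hf.1.1 hfM hg.1, fun v =>
    ⟨_, HasWeakDeriv.mul_of_bounded_memH1 hU hf hg hfM hgM v, ?_⟩⟩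
  refine MemLp.add ?_ (memLp_mul_of_bounded hf.1.1 hfM (hg.memLp_weakDeriv hU v))
  exact (memLp_mul_of_bounded hg.1.1 hgM (hf.memLp_weakDeriv hU v)).ae_eq
    (ae_of_all _ fun x => mul_comm _ _)

end Sobolev

section Cylinder

variable {n : ℕ} {Ω : Set (EuclideanSpace ℝ (Fin n))} {T : ℝ}
  {u p φ : EuclideanSpace ℝ (Fin n) × ℝ → ℝ}

theorem isBounded_cyl (hΩb : Bornology.IsBounded Ω) : Bornology.IsBounded (cyl Ω T) :=
  hΩb.prod (Metric.isBounded_Ioo 0 T)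

theorem dx_sub (hΩ : IsOpen Ω) (hu : MemH1 (cyl Ω T) u) (hp : MemH1 (cyl Ω T) p) (i : Fin n) :
    dx Ω T i (u - p) =ᵐ[volume.restrict (cyl Ω T)] dx Ω T i u - dx Ω T i p :=
  weakDeriv_sub (isOpen_cyl hΩ) hu hp _

theorem dt_sub (hΩ : IsOpen Ω) (hu : MemH1 (cyl Ω T) u) (hp : MemH1 (cyl Ω T) p) :
    dt Ω T (u - p) =ᵐ[volume.restrict (cyl Ω T)] dt Ω T u - dt Ω T p :=
  weakDeriv_sub (isOpen_cyl hΩ) hu hp _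

theorem lap_sub (hΩ : IsOpen Ω) (hu : MemH2 (cyl Ω T) u) (hp : MemH2 (cyl Ω T) p) :
    lap Ω T (u - p) =ᵐ[volume.restrict (cyl Ω T)] lap Ω T u - lap Ω T p := by
  have hQ := isOpen_cyl (T := T) hΩ
  have h : ∀ i, dx Ω T i (dx Ω T i (u - p)) =ᵐ[volume.restrict (cyl Ω T)]
      dx Ω T i (dx Ω T i u) - dx Ω T i (dx Ω T i p) := fun i =>
    (weakDeriv_congr hQ ((hu.memH1_weakDeriv hQ _).sub (hp.memH1_weakDeriv hQ _))
      (dx_sub hΩ hu.memH1 hp.memH1 i).symm _).trans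
      (weakDeriv_sub hQ (hu.memH1_weakDeriv hQ _) (hp.memH1_weakDeriv hQ _) _)
  filter_upwards [ae_all_iff.2 h] with z hz
  simp only [lap, Pi.sub_apply]
  rw [← Finset.sum_sub_distrib]
  exact Finset.sum_congr rfl fun i _ => hz i

theorem MemH2.memLp_lap (hΩ : IsOpen Ω) (hu : MemH2 (cyl Ω T) u) :
    MemLp (lap Ω T u) 2 (volume.restrict (cyl Ω T)) := by
  have hQ := isOpen_cyl (T := T) hΩ
  exact memLp_finsetSum _ fun i _ => (hu.memH1_weakDeriv hQ _).memLp_weakDeriv hQ _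

theorem MemH1.memLp_dx (hΩ : IsOpen Ω) (hu : MemH1 (cyl Ω T) u) (i : Fin n) :
    MemLp (dx Ω T i u) 2 (volume.restrict (cyl Ω T)) :=
  hu.memLp_weakDeriv (isOpen_cyl hΩ) _

theorem MemH1.memLp_dt (hΩ : IsOpen Ω) (hu : MemH1 (cyl Ω T) u) :
    MemLp (dt Ω T u) 2 (volume.restrict (cyl Ω T)) :=
  hu.memLp_weakDeriv (isOpen_cyl hΩ) _

theorem MemH1.integrable_gradSq (hΩ : IsOpen Ω) (hu : MemH1 (cyl Ω T) u) :
    IntegrableOn (gradSq Ω T u) (cyl Ω T) volume :=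
  integrable_finsetSum _ fun i _ => (hu.memLp_dx hΩ i).integrable_sq

theorem integrable_normalDeriv (hΩ : IsOpen Ω) (hu : MemH2 (cyl Ω T) u)
    (hφ : MemH1 (cyl Ω T) φ) :
    IntegrableOn (fun z => φ z * lap Ω T u z + ∑ i, dx Ω T i u z * dx Ω T i φ z) (cyl Ω T)
      volume :=
  (hφ.1.integrable_mul (hu.memLp_lap hΩ)).add
    (integrable_finsetSum _ fun i _ => (hu.memH1.memLp_dx hΩ i).integrable_mul (hφ.memLp_dx hΩ i))

theorem MemH20.sub (hΩ : IsOpen Ω) (hu : MemH20 Ω T u) (hp : MemH20 Ω T p) :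
    MemH20 Ω T (u - p) := by
  refine ⟨hu.1.sub hp.1, fun φ hφ => ?_⟩
  have e : normalDeriv Ω T (u - p) φ = normalDeriv Ω T u φ - normalDeriv Ω T p φ := by
    rw [normalDeriv, normalDeriv, normalDeriv, ← integral_sub (integrable_normalDeriv hΩ hu.1 hφ)
      (integrable_normalDeriv hΩ hp.1 hφ)]
    refine integral_congr_ae ?_
    filter_upwards [lap_sub hΩ hu.1 hp.1,
      ae_all_iff.2 fun i => dx_sub hΩ hu.1.memH1 hp.1.memH1 i] with z h1 h2
    simp only [h1, h2, Pi.sub_apply, sub_mul, Finset.sum_sub_distrib]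
    ring
  rw [e, hu.2 φ hφ, hp.2 φ hφ, sub_self]

/-- Multiplication by a smooth function of time commutes with differentiation in space. -/
theorem dx_time_mul (hΩ : IsOpen Ω) (hφ : MemH1 (cyl Ω T) φ) {η : ℝ → ℝ} (hη : ContDiff ℝ ∞ η)
    (i : Fin n) : dx Ω T i (fun z => η z.2 * φ z)
      =ᵐ[volume.restrict (cyl Ω T)] fun z => η z.2 * dx Ω T i φ z := by
  have ha : ContDiff ℝ ∞ (fun z : EuclideanSpace ℝ (Fin n) × ℝ => η z.2) := hη.comp contDiff_snd
  refine (((hφ.hasWeakDeriv _).smooth_mul ha (isOpen_cyl hΩ)).weakDeriv_ae_eq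
    (isOpen_cyl hΩ)).trans (ae_of_all _ fun z => ?_)
  have h2 : HasFDerivAt (fun z : EuclideanSpace ℝ (Fin n) × ℝ => η z.2) _ z :=
    ((hη.differentiable (by simp)) z.2).hasDerivAt.hasFDerivAt.comp z hasFDerivAt_snd
  simp only [h2.fderiv]
  simp [dx]

theorem MemH1.time_mul (hΩ : IsOpen Ω) (hΩb : Bornology.IsBounded Ω) (hφ : MemH1 (cyl Ω T) φ)
    {η : ℝ → ℝ} (hη : ContDiff ℝ ∞ η) : MemH1 (cyl Ω T) (fun z => η z.2 * φ z) :=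
  hφ.smooth_mul (isBounded_cyl hΩb) (isOpen_cyl hΩ) (hη.comp contDiff_snd)

/-- Green's formula for functions with zero Neumann data, with a weight depending on time. -/
theorem MemH20.integral_weight (hΩ : IsOpen Ω) (hΩb : Bornology.IsBounded Ω)
    (hu : MemH20 Ω T u) (hφ : MemH1 (cyl Ω T) φ) {η : ℝ → ℝ} (hη : ContDiff ℝ ∞ η) :
    ∫ z in cyl Ω T, η z.2 * (φ z * lap Ω T u z + ∑ i, dx Ω T i u z * dx Ω T i φ z) = 0 := by
  rw [← hu.2 _ (hφ.time_mul hΩ hΩb hη), normalDeriv]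
  refine integral_congr_ae ?_
  filter_upwards [ae_all_iff.2 fun i => dx_time_mul hΩ hφ hη i] with z hz
  simp only [hz, mul_add, Finset.mul_sum]
  congr 1
  · ring
  · exact Finset.sum_congr rfl fun i _ => by ring

theorem integrable_time_mul (hΩ : IsOpen Ω) (hΩb : Bornology.IsBounded Ω) {η : ℝ → ℝ}
    (hη : Continuous η) {f : EuclideanSpace ℝ (Fin n) × ℝ → ℝ}
    (hf : IntegrableOn f (cyl Ω T) volume) :
    IntegrableOn (fun z => η z.2 * f z) (cyl Ω T) volume :=
  integrable_continuous_mul (isBounded_cyl hΩb) (isOpen_cyl hΩ) (hη.comp continuous_snd) hf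

end Cylinder

/-! ### Weighted energy estimates -/

section Weights

/-- The rate `σ(t) = Λ μ e^{-μ t}`, minus the logarithmic derivative of the square root of the
weight. -/
def rate (Λ μ t : ℝ) : ℝ := Λ * μ * Real.exp (-μ * t)

/-- The Carleman weight `E(t) = exp (2 Λ e^{-μ t})`. -/
def weight (Λ μ t : ℝ) : ℝ := Real.exp (2 * Λ * Real.exp (-μ * t))

variable (Λ μ : ℝ)

theorem contDiff_rate : ContDiff ℝ ∞ (rate Λ μ) := by unfold rate; fun_prop

theorem contDiff_weight : ContDiff ℝ ∞ (weight Λ μ) := by unfold weight; fun_prop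

theorem hasDerivAt_rate (t : ℝ) : HasDerivAt (rate Λ μ) (-μ * rate Λ μ t) t := by
  have h := (((hasDerivAt_id t).const_mul (-μ)).exp).const_mul (Λ * μ)
  refine h.congr_deriv ?_
  simp only [rate, id]; ring

theorem hasDerivAt_weight (t : ℝ) : HasDerivAt (weight Λ μ) (-2 * rate Λ μ t * weight Λ μ t) t := by
  have h := ((((hasDerivAt_id t).const_mul (-μ)).exp).const_mul (2 * Λ)).exp
  refine h.congr_deriv ?_
  simp only [rate, weight, id]; ring

theorem weight_pos (t : ℝ) : 0 < weight Λ μ t := Real.exp_pos _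

end Weights

section Energy

variable {n : ℕ} {Ω : Set (EuclideanSpace ℝ (Fin n))} {T : ℝ}
  {u : EuclideanSpace ℝ (Fin n) × ℝ → ℝ} {Λ μ β : ℝ}

theorem integral_linear_combination {α : Type*} [MeasurableSpace α] {m : Measure α}
    {a b c d : α → ℝ} (ha : Integrable a m) (hb : Integrable b m) (hc : Integrable c m)
    (hd : Integrable d m) (r s t w : ℝ) :
    ∫ x, (r * a x + s * b x + t * c x + w * d x) ∂m
      = r * (∫ x, a x ∂m) + s * (∫ x, b x ∂m) + t * (∫ x, c x ∂m) + w * ∫ x, d x ∂m := by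
  have h1 : Integrable (fun x => r * a x + s * b x) m := (ha.const_mul r).add (hb.const_mul s)
  have h2 : Integrable (fun x => r * a x + s * b x + t * c x) m := h1.add (hc.const_mul t)
  rw [integral_add h2 (hd.const_mul w), integral_add h1 (hc.const_mul t),
    integral_add (ha.const_mul r) (hb.const_mul s)]
  simp only [integral_const_mul]

/-- Existence of time traces, and the energy identity in time. -/
theorem MemH1.integral_time (hΩ : IsOpen Ω) (hΩb : Bornology.IsBounded Ω) (hT : 0 < T)
    (hu : MemH1 (cyl Ω T) u) :
    ∃ u₀ uT, HasTimeTrace Ω T u 0 u₀ ∧ HasTimeTrace Ω T u T uT ∧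
      ∀ η : ℝ → ℝ, ContDiff ℝ ∞ η →
        ∫ z in cyl Ω T, (2 * η z.2 * (u z * dt Ω T u z) + deriv η z.2 * u z ^ 2)
          = η T * (∫ x in Ω, uT x ^ 2) - η 0 * ∫ x in Ω, u₀ x ^ 2 :=
  (hu.hasWeakDeriv (0, 1)).exists_traces hΩ hΩb hT hu.1 (hu.memLp_dt hΩ)

theorem HasTimeTrace.integral_sq_eq (hT : 0 < T) {τ : ℝ} (hτ : τ = 0 ∨ τ = T)
    (hu : MemH1 (cyl Ω T) u) {a b : EuclideanSpace ℝ (Fin n) → ℝ} (ha : HasTimeTrace Ω T u τ a)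
    (hb : HasTimeTrace Ω T u τ b) : ∫ x in Ω, a x ^ 2 = ∫ x in Ω, b x ^ 2 := by
  have hm := hu.1.1
  rw [restrict_cyl] at hm
  refine integral_congr_ae ?_
  filter_upwards [ha.unique hT hτ hm hb] with x hx
  rw [hx]

theorem dx_dt_comm (hΩ : IsOpen Ω) (hu : MemH2 (cyl Ω T) u) (i : Fin n) :
    dx Ω T i (dt Ω T u) =ᵐ[volume.restrict (cyl Ω T)] dt Ω T (dx Ω T i u) := by
  have hQ := isOpen_cyl (T := T) hΩ
  exact HasWeakDeriv.comm hQ (hu.memH1.hasWeakDeriv _) (hu.memH1.hasWeakDeriv _)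
    ((hu.memH1_weakDeriv hQ _).hasWeakDeriv _) ((hu.memH1_weakDeriv hQ _).hasWeakDeriv _)

theorem MemH2.memH1_dx (hΩ : IsOpen Ω) (hu : MemH2 (cyl Ω T) u) (i : Fin n) :
    MemH1 (cyl Ω T) (dx Ω T i u) := hu.memH1_weakDeriv (isOpen_cyl hΩ) _

theorem MemH2.memH1_dt (hΩ : IsOpen Ω) (hu : MemH2 (cyl Ω T) u) :
    MemH1 (cyl Ω T) (dt Ω T u) := hu.memH1_weakDeriv (isOpen_cyl hΩ) _

theorem MemH20.integral_mul_lap (hΩ : IsOpen Ω) (hΩb : Bornology.IsBounded Ω)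
    (hu : MemH20 Ω T u) {η : ℝ → ℝ} (hη : ContDiff ℝ ∞ η) :
    ∫ z in cyl Ω T, η z.2 * (u z * lap Ω T u z + gradSq Ω T u z) = 0 := by
  rw [← hu.integral_weight hΩ hΩb hu.1.memH1 hη]
  simp only [gradSq, sq]

/-- The trace at the final time of a function in `H²(Q_T)` lies in `H¹(Ω)`. -/
theorem MemH2.memH1_trace (hΩ : IsOpen Ω) (hΩb : Bornology.IsBounded Ω) (hT : 0 < T)
    (hu : MemH2 (cyl Ω T) u) {uT : EuclideanSpace ℝ (Fin n) → ℝ}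
    (huT : HasTimeTrace Ω T u T uT) : MemH1 Ω uT := by
  have hQ := isOpen_cyl (T := T) hΩ
  refine ⟨huT.1, fun v => ?_⟩
  have h1 := hu.memH1_weakDeriv hQ (v, 0)
  obtain ⟨_, a, -, ha, -⟩ := h1.integral_time hΩ hΩb hT
  exact ⟨a, huT.hasWeakDeriv hΩb hT (Or.inr rfl) (hu.memH1.hasWeakDeriv (v, 0)) hu.1 h1.1 ha, ha.1⟩

/-- The pairing of the time derivative and the Laplacian; the Neumann condition turns it into the
time derivative of the squared gradient, and the final boundary term is expressed by the gradient
of the trace of `u`. -/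
theorem MemH20.integral_dt_mul_lap (hΩ : IsOpen Ω) (hΩb : Bornology.IsBounded Ω) (hT : 0 < T)
    (hu : MemH20 Ω T u) {uT : EuclideanSpace ℝ (Fin n) → ℝ} (huT : HasTimeTrace Ω T u T uT) :
    ∃ G₀ : ℝ, 0 ≤ G₀ ∧ ∀ η : ℝ → ℝ, ContDiff ℝ ∞ η →
      ∫ z in cyl Ω T, (2 * η z.2 * (dt Ω T u z * lap Ω T u z) - deriv η z.2 * gradSq Ω T u z)
        = η 0 * G₀
          - η T * ∑ i, ∫ x in Ω, weakDeriv Ω (EuclideanSpace.single i 1) uT x ^ 2 := by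
  have hQ := isOpen_cyl (T := T) hΩ
  choose a₀ aT h0 hT' he using fun i => (hu.1.memH1_dx hΩ i).integral_time hΩ hΩb hT
  have hw : ∀ i, ∫ x in Ω, weakDeriv Ω (EuclideanSpace.single i 1) uT x ^ 2
      = ∫ x in Ω, aT i x ^ 2 := fun i => by
    have h1 := huT.hasWeakDeriv hΩb hT (Or.inr rfl) (hu.1.memH1.hasWeakDeriv _) hu.1.1
      (hu.1.memH1_dx hΩ i).1 (hT' i)
    refine integral_congr_ae ?_
    filter_upwards [h1.weakDeriv_ae_eq hΩ] with x hx
    rw [hx]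
  refine ⟨∑ i, ∫ x in Ω, a₀ i x ^ 2, Finset.sum_nonneg fun i _ =>
    integral_nonneg fun _ => sq_nonneg _, fun η hη => ?_⟩
  have hηd : Continuous (deriv η) := hη.continuous_deriv (by simp)
  have e1 := hu.integral_weight hΩ hΩb (hu.1.memH1_dt hΩ) hη
  have i1 : IntegrableOn (fun z => η z.2 * (dt Ω T u z * lap Ω T u z
      + ∑ i, dx Ω T i u z * dx Ω T i (dt Ω T u) z)) (cyl Ω T) volume :=
    integrable_time_mul hΩ hΩb hη.continuous (integrable_normalDeriv hΩ hu.1 (hu.1.memH1_dt hΩ))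
  have i2 : ∀ i, IntegrableOn (fun z => 2 * η z.2 * (dx Ω T i u z * dt Ω T (dx Ω T i u) z)
      + deriv η z.2 * dx Ω T i u z ^ 2) (cyl Ω T) volume := fun i =>
    (integrable_time_mul hΩ hΩb (continuous_const.mul hη.continuous)
      ((hu.1.memH1_dx hΩ i).1.integrable_mul ((hu.1.memH1_dx hΩ i).memLp_dt hΩ))).add
      (integrable_time_mul hΩ hΩb hηd (hu.1.memH1_dx hΩ i).1.integrable_sq)
  have e2 : ∫ z in cyl Ω T, ∑ i, (2 * η z.2 * (dx Ω T i u z * dt Ω T (dx Ω T i u) z)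
      + deriv η z.2 * dx Ω T i u z ^ 2)
      = η T * (∑ i, ∫ x in Ω, aT i x ^ 2) - η 0 * ∑ i, ∫ x in Ω, a₀ i x ^ 2 := by
    rw [integral_finsetSum _ fun i _ => i2 i, Finset.mul_sum, Finset.mul_sum,
      ← Finset.sum_sub_distrib]
    exact Finset.sum_congr rfl fun i _ => he i η hη
  simp_rw [hw]
  have e3 : ∫ z in cyl Ω T, (2 * η z.2 * (dt Ω T u z * lap Ω T u z) - deriv η z.2 * gradSq Ω T u z)
      = ∫ z in cyl Ω T, (2 * (η z.2 * (dt Ω T u z * lap Ω T u z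
          + ∑ i, dx Ω T i u z * dx Ω T i (dt Ω T u) z))
        - ∑ i, (2 * η z.2 * (dx Ω T i u z * dt Ω T (dx Ω T i u) z)
          + deriv η z.2 * dx Ω T i u z ^ 2)) := by
    refine integral_congr_ae ?_
    filter_upwards [ae_all_iff.2 fun i => dx_dt_comm hΩ hu.1 i] with z hz
    simp only [hz, gradSq, Finset.sum_add_distrib, ← Finset.mul_sum]
    ring
  rw [e3, integral_sub (i1.const_mul 2) (integrable_finsetSum _ fun i _ => i2 i),
    integral_const_mul, e1, e2]
  ring

/-- The Carleman estimate for the backward heat operator `∂ₜ + βΔ` with Neumann condition. After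
conjugation with the square root of the weight the operator splits into an antisymmetric and a
symmetric part, whose commutator is positive since the exponent of the weight is convex. -/
theorem MemH20.carleman_estimate (hΩ : IsOpen Ω) (hΩb : Bornology.IsBounded Ω) (hT : 0 < T)
    (hΛ : 0 ≤ Λ) (hμ : 0 ≤ μ) (hβ : 0 ≤ β)
    (hu : MemH20 Ω T u) {uT u₀ : EuclideanSpace ℝ (Fin n) → ℝ} (huT : HasTimeTrace Ω T u T uT)
    (hu₀ : HasTimeTrace Ω T u 0 u₀) :
    μ * (∫ z in cyl Ω T, rate Λ μ z.2 * weight Λ μ z.2 * u z ^ 2)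
      ≤ (∫ z in cyl Ω T, weight Λ μ z.2 * (dt Ω T u z + β * lap Ω T u z) ^ 2)
        + β * weight Λ μ T * (∑ i, ∫ x in Ω, weakDeriv Ω (EuclideanSpace.single i 1) uT x ^ 2)
        + rate Λ μ 0 * weight Λ μ 0 * ∫ x in Ω, u₀ x ^ 2 := by
  set σ := rate Λ μ with hσ
  set E := weight Λ μ with hE
  have cσ : ContDiff ℝ ∞ σ := contDiff_rate Λ μ
  have cE : ContDiff ℝ ∞ E := contDiff_weight Λ μ
  have dE : ∀ t, deriv E t = -2 * σ t * E t := fun t => (hasDerivAt_weight Λ μ t).deriv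
  have dEσ : ∀ t, deriv (fun t => E t * σ t) t = -2 * σ t ^ 2 * E t - μ * σ t * E t := fun t => by
    rw [((hasDerivAt_weight Λ μ t).fun_mul (hasDerivAt_rate Λ μ t)).deriv]
    simp only [← hσ, ← hE]; ring
  have cEσ : ContDiff ℝ ∞ (fun t => E t * σ t) := cE.mul cσ
  have hH1 := hu.1.memH1
  have hut := hH1.memLp_dt hΩ
  have hL := hu.1.memLp_lap hΩ
  obtain ⟨G₀, hG₀, hG⟩ := hu.integral_dt_mul_lap hΩ hΩb hT huT
  obtain ⟨a₀, aT, ha₀, haT, ha⟩ := hH1.integral_time hΩ hΩb hT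
  have e1 := hG E cE
  have e2 := hu.integral_mul_lap hΩ hΩb cEσ
  have e3 := ha _ cEσ
  rw [ha₀.integral_sq_eq hT (Or.inl rfl) hH1 hu₀, haT.integral_sq_eq hT (Or.inr rfl) hH1 huT] at e3
  simp only [dE] at e1
  simp only [dEσ] at e3
  have tm := @integrable_time_mul n Ω T hΩ hΩb
  have j1 : IntegrableOn (fun z => 2 * E z.2 * (dt Ω T u z * lap Ω T u z)
      - -2 * σ z.2 * E z.2 * gradSq Ω T u z) (cyl Ω T) volume :=
    (tm (η := fun t => 2 * E t) (by fun_prop) (hut.integrable_mul hL)).sub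
      (tm (η := fun t => -2 * σ t * E t) (by fun_prop) (hH1.integrable_gradSq hΩ))
  have j2 : IntegrableOn (fun z => E z.2 * σ z.2 * (u z * lap Ω T u z + gradSq Ω T u z))
      (cyl Ω T) volume :=
    tm (η := fun t => E t * σ t) (by fun_prop)
      ((hH1.1.integrable_mul hL).add (hH1.integrable_gradSq hΩ))
  have j3 : IntegrableOn (fun z => 2 * (E z.2 * σ z.2) * (u z * dt Ω T u z)
      + (-2 * σ z.2 ^ 2 * E z.2 - μ * σ z.2 * E z.2) * u z ^ 2) (cyl Ω T) volume :=
    (tm (η := fun t => 2 * (E t * σ t)) (by fun_prop) (hH1.1.integrable_mul hut)).add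
      (tm (η := fun t => -2 * σ t ^ 2 * E t - μ * σ t * E t) (by fun_prop) hH1.1.integrable_sq)
  have j4 : IntegrableOn (fun z => σ z.2 * E z.2 * u z ^ 2) (cyl Ω T) volume :=
    tm (η := fun t => σ t * E t) (by fun_prop) hH1.1.integrable_sq
  have j5 : IntegrableOn (fun z => E z.2 * (dt Ω T u z + β * lap Ω T u z) ^ 2) (cyl Ω T) volume :=
    tm (η := E) (by fun_prop) (hut.add (hL.const_mul β)).integrable_sq
  have key := integral_linear_combination j1 j2 j3 j4 β (-2 * β) 1 μ
  rw [e1, e2, e3] at key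
  have le : _ ≤ ∫ z in cyl Ω T, E z.2 * (dt Ω T u z + β * lap Ω T u z) ^ 2 :=
    integral_mono ((((j1.const_mul β).add (j2.const_mul (-2 * β))).add (j3.const_mul 1)).add
      (j4.const_mul μ)) j5 fun z => by
    have hEz : 0 ≤ E z.2 := (weight_pos Λ μ z.2).le
    -- with `a = u_t - σ u` and `b = β Δu + σ u` the two integrands differ by `E (a² + b²)`
    have h := mul_nonneg hEz (add_nonneg (sq_nonneg (dt Ω T u z - σ z.2 * u z))
      (sq_nonneg (β * lap Ω T u z + σ z.2 * u z)))
    simp only [Pi.add_apply]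
    linarith
  have le := key.symm.trans_le le
  have p1 : 0 ≤ β * (E 0 * G₀) := mul_nonneg hβ (mul_nonneg (weight_pos Λ μ 0).le hG₀)
  have p2 : 0 ≤ E T * σ T * ∫ x in Ω, uT x ^ 2 := by
    have : 0 ≤ σ T := by simp only [hσ, rate]; positivity
    exact mul_nonneg (mul_nonneg (weight_pos Λ μ T).le this)
      (integral_nonneg fun _ => sq_nonneg _)
  linarith

/-- The weighted energy identity for the operators `∂ₜ + bΔ` with Neumann condition. -/
theorem MemH20.weighted_energy (hΩ : IsOpen Ω) (hΩb : Bornology.IsBounded Ω) (hT : 0 < T)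
    (hu : MemH20 Ω T u) (b : ℝ) :
    ∃ u₀ uT, HasTimeTrace Ω T u 0 u₀ ∧ HasTimeTrace Ω T u T uT ∧
      ∫ z in cyl Ω T, weight Λ μ z.2 * (u z * (dt Ω T u z + b * lap Ω T u z))
        = weight Λ μ T / 2 * (∫ x in Ω, uT x ^ 2) - weight Λ μ 0 / 2 * (∫ x in Ω, u₀ x ^ 2)
          + (∫ z in cyl Ω T, rate Λ μ z.2 * weight Λ μ z.2 * u z ^ 2)
          - b * ∫ z in cyl Ω T, weight Λ μ z.2 * gradSq Ω T u z := by
  set σ := rate Λ μ with hσ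
  set E := weight Λ μ with hE
  have cσ : ContDiff ℝ ∞ σ := contDiff_rate Λ μ
  have cE : ContDiff ℝ ∞ E := contDiff_weight Λ μ
  have dE : ∀ t, deriv E t = -2 * σ t * E t := fun t => (hasDerivAt_weight Λ μ t).deriv
  have hH1 := hu.1.memH1
  have hut := hH1.memLp_dt hΩ
  have hL := hu.1.memLp_lap hΩ
  obtain ⟨a₀, aT, ha₀, haT, ha⟩ := hH1.integral_time hΩ hΩb hT
  refine ⟨a₀, aT, ha₀, haT, ?_⟩
  have e2 := hu.integral_mul_lap hΩ hΩb cE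
  have e3 := ha _ cE
  simp only [dE] at e3
  have tm := @integrable_time_mul n Ω T hΩ hΩb
  have j1 : IntegrableOn (fun z => E z.2 * gradSq Ω T u z) (cyl Ω T) volume :=
    tm (η := E) (by fun_prop) (hH1.integrable_gradSq hΩ)
  have j2 : IntegrableOn (fun z => E z.2 * (u z * lap Ω T u z + gradSq Ω T u z))
      (cyl Ω T) volume :=
    tm (η := E) (by fun_prop) ((hH1.1.integrable_mul hL).add (hH1.integrable_gradSq hΩ))
  have j3 : IntegrableOn (fun z => 2 * E z.2 * (u z * dt Ω T u z)
      + -2 * σ z.2 * E z.2 * u z ^ 2) (cyl Ω T) volume :=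
    (tm (η := fun t => 2 * E t) (by fun_prop) (hH1.1.integrable_mul hut)).add
      (tm (η := fun t => -2 * σ t * E t) (by fun_prop) hH1.1.integrable_sq)
  have j4 : IntegrableOn (fun z => σ z.2 * E z.2 * u z ^ 2) (cyl Ω T) volume :=
    tm (η := fun t => σ t * E t) (by fun_prop) hH1.1.integrable_sq
  have key := integral_linear_combination j3 j4 j2 j1 (1 / 2) 1 b (-b)
  rw [e2, e3] at key
  refine Eq.trans (integral_congr_ae (ae_of_all _ fun z => ?_)) (key.trans (by ring))
  simp only
  ring

/-- The weighted energy estimate for the backward heat operator. -/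
theorem MemH20.backward_energy (hΩ : IsOpen Ω) (hΩb : Bornology.IsBounded Ω) (hT : 0 < T)
    (hu : MemH20 Ω T u) {uT : EuclideanSpace ℝ (Fin n) → ℝ} (huT : HasTimeTrace Ω T u T uT) :
    β * (∫ z in cyl Ω T, weight Λ μ z.2 * gradSq Ω T u z)
      ≤ weight Λ μ T / 2 * (∫ x in Ω, uT x ^ 2)
        + (∫ z in cyl Ω T, rate Λ μ z.2 * weight Λ μ z.2 * u z ^ 2)
        - ∫ z in cyl Ω T, weight Λ μ z.2 * (u z * (dt Ω T u z + β * lap Ω T u z)) := by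
  obtain ⟨a₀, aT, -, haT, e⟩ := hu.weighted_energy (Λ := Λ) (μ := μ) hΩ hΩb hT β
  rw [haT.integral_sq_eq hT (Or.inr rfl) hu.1.memH1 huT] at e
  have p1 : 0 ≤ weight Λ μ 0 / 2 * ∫ x in Ω, a₀ x ^ 2 :=
    mul_nonneg (half_pos (weight_pos Λ μ 0)).le (integral_nonneg fun _ => sq_nonneg _)
  linarith

/-- The weighted energy estimate for the forward heat operator `∂ₜ - βΔ`. -/
theorem MemH20.forward_energy (hΩ : IsOpen Ω) (hΩb : Bornology.IsBounded Ω) (hT : 0 < T)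
    (hu : MemH20 Ω T u) {u₀ : EuclideanSpace ℝ (Fin n) → ℝ} (hu₀ : HasTimeTrace Ω T u 0 u₀) :
    (∫ z in cyl Ω T, rate Λ μ z.2 * weight Λ μ z.2 * u z ^ 2)
        + β * (∫ z in cyl Ω T, weight Λ μ z.2 * gradSq Ω T u z)
      ≤ weight Λ μ 0 / 2 * (∫ x in Ω, u₀ x ^ 2)
        + ∫ z in cyl Ω T, weight Λ μ z.2 * (u z * (dt Ω T u z - β * lap Ω T u z)) := by
  obtain ⟨a₀, aT, ha₀, -, e⟩ := hu.weighted_energy (Λ := Λ) (μ := μ) hΩ hΩb hT (-β)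
  rw [ha₀.integral_sq_eq hT (Or.inl rfl) hu.1.memH1 hu₀] at e
  have p1 : 0 ≤ weight Λ μ T / 2 * ∫ x in Ω, aT x ^ 2 :=
    mul_nonneg (half_pos (weight_pos Λ μ T)).le (integral_nonneg fun _ => sq_nonneg _)
  simp only [neg_mul, ← sub_eq_add_neg, sub_neg_eq_add] at e
  linarith

end Energy

/-! ### The coupling terms -/

/-- The product instance, for the measure that `MeasureSpace` provides on the product. -/
instance isAddHaarMeasure_spaceTime {n : ℕ} :
    (volume : Measure (EuclideanSpace ℝ (Fin n) × ℝ)).IsAddHaarMeasure :=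
  Measure.prod.instIsAddHaarMeasure volume volume

section Coupling

variable {n : ℕ} {Ω : Set (EuclideanSpace ℝ (Fin n))} {T : ℝ}
  {u p q φ : EuclideanSpace ℝ (Fin n) × ℝ → ℝ}

theorem memLp_of_continuousOn_of_bound {X : Type*} [NormedAddCommGroup X] [MeasureSpace X]
    [BorelSpace X] {U : Set X} (hU : IsOpen U) [IsFiniteMeasure (volume.restrict U)]
    {f : X → ℝ} (hf : ContinuousOn f U) {C : ℝ} (hC : ∀ x ∈ U, ‖f x‖ ≤ C) :
    MemLp f 2 (volume.restrict U) := by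
  have hm : AEStronglyMeasurable f (volume.restrict U) := hf.aestronglyMeasurable hU.measurableSet
  exact MemLp.of_bound hm C ((ae_restrict_iff' hU.measurableSet).2 (ae_of_all _ hC))

theorem C1Bounded.memH1_sq (hΩ : IsOpen Ω) (hΩb : Bornology.IsBounded Ω) {M : ℝ}
    {κ : EuclideanSpace ℝ (Fin n) → ℝ} (hκ : C1Bounded Ω M κ) :
    MemH1 (cyl Ω T) (fun z => κ z.1 ^ 2) := by
  have hfin := isFiniteMeasure_restrict_cyl (T := T) hΩb
  have hQ := isOpen_cyl (T := T) hΩ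
  obtain ⟨hc, ⟨D, hD, hκD⟩, hM, -⟩ := hκ
  obtain ⟨C, hC⟩ := hΩb.isCompact_closure.exists_bound_of_continuousOn hD
  have hc' : ContinuousOn (fun z : EuclideanSpace ℝ (Fin n) × ℝ => κ z.1) (cyl Ω T) :=
    hc.comp continuousOn_fst fun z hz => subset_closure hz.1
  have hD' : ContinuousOn (fun z : EuclideanSpace ℝ (Fin n) × ℝ => D z.1) (cyl Ω T) :=
    hD.comp continuousOn_fst fun z hz => subset_closure hz.1
  have hder : ∀ z ∈ cyl Ω T, HasFDerivAt (fun z : EuclideanSpace ℝ (Fin n) × ℝ => κ z.1 ^ 2)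
      ((2 * κ z.1) • (D z.1).comp (ContinuousLinearMap.fst ℝ _ ℝ)) z := fun z hz => by
    have h1 : HasFDerivAt (fun z : EuclideanSpace ℝ (Fin n) × ℝ => κ z.1) _ z :=
      (hκD z.1 hz.1).comp z hasFDerivAt_fst
    simpa using h1.pow 2
  have hcont : ContinuousOn (fun z : EuclideanSpace ℝ (Fin n) × ℝ =>
      (2 * κ z.1) • (D z.1).comp (ContinuousLinearMap.fst ℝ _ ℝ)) (cyl Ω T) :=
    (continuousOn_const.mul hc').smul (hD'.clm_comp continuousOn_const)
  refine ⟨memLp_of_continuousOn_of_bound hQ (hc'.pow 2) (C := M ^ 2) fun z hz => ?_, fun v =>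
    ⟨_, hasWeakDeriv_of_hasFDerivAt hQ hder hcont,
      memLp_of_continuousOn_of_bound hQ (hcont.clm_apply continuousOn_const)
        (C := 2 * M * (C * ‖v.1‖)) fun z hz => ?_⟩⟩
  · rw [norm_pow, Real.norm_eq_abs]
    exact pow_le_pow_left₀ (abs_nonneg _) (hM _ hz.1) 2
  · have h1 : |κ z.1| ≤ M := hM _ hz.1
    have h2 : ‖D z.1 v.1‖ ≤ C * ‖v.1‖ := ((D z.1).le_opNorm _).trans
      (mul_le_mul_of_nonneg_right (hC _ (subset_closure hz.1)) (norm_nonneg _))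
    simp only [smul_apply, ContinuousLinearMap.comp_apply, ContinuousLinearMap.coe_fst',
      smul_eq_mul, norm_mul, Real.norm_ofNat]
    rw [Real.norm_eq_abs (κ z.1)]
    have h3 : 0 ≤ M := (abs_nonneg _).trans h1
    gcongr

/-- Integration by parts in the divergence of the bounded flux `q ∇u`. -/
theorem MemH20.integral_divergence (hΩ : IsOpen Ω) (hΩb : Bornology.IsBounded Ω)
    (hu : MemH20 Ω T u) (hq : MemH1 (cyl Ω T) q) (hφ : MemH1 (cyl Ω T) φ) {M : ℝ}
    (huM : ∀ i, ∀ᵐ z ∂volume.restrict (cyl Ω T), |dx Ω T i u z| ≤ M)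
    (hqM : ∀ᵐ z ∂volume.restrict (cyl Ω T), |q z| ≤ M)
    (hφM : ∀ᵐ z ∂volume.restrict (cyl Ω T), |φ z| ≤ M) :
    IntegrableOn (fun z => φ z * ∑ i, dx Ω T i (fun w => q w * dx Ω T i u w) z) (cyl Ω T) volume ∧
    IntegrableOn (fun z => ∑ i, q z * dx Ω T i u z * dx Ω T i φ z) (cyl Ω T) volume ∧
    ∫ z in cyl Ω T, φ z * ∑ i, dx Ω T i (fun w => q w * dx Ω T i u w) z
      = -∫ z in cyl Ω T, ∑ i, q z * dx Ω T i u z * dx Ω T i φ z := by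
  have hfin := isFiniteMeasure_restrict_cyl (T := T) hΩb
  have hQ := isOpen_cyl (T := T) hΩ
  have hflux : ∀ i, MemH1 (cyl Ω T) (fun w => q w * dx Ω T i u w) := fun i =>
    hq.mul_of_bounded hQ (hu.1.memH1_dx hΩ i) hqM (huM i)
  have i1 : IntegrableOn (fun z => φ z * ∑ i, dx Ω T i (fun w => q w * dx Ω T i u w) z)
      (cyl Ω T) volume :=
    hφ.1.integrable_mul (memLp_finsetSum _ fun i _ => (hflux i).memLp_dx hΩ i)
  have i2 : IntegrableOn (fun z => ∑ i, q z * dx Ω T i u z * dx Ω T i φ z) (cyl Ω T) volume :=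
    integrable_finsetSum _ fun i _ => (hflux i).1.integrable_mul (hφ.memLp_dx hΩ i)
  refine ⟨i1, i2, ?_⟩
  have hqφ : MemH1 (cyl Ω T) (fun z => q z * φ z) := hq.mul_of_bounded hQ hφ hqM hφM
  have d1 : ∀ i, dx Ω T i (fun w => q w * dx Ω T i u w) =ᵐ[volume.restrict (cyl Ω T)]
      fun z => dx Ω T i q z * dx Ω T i u z + q z * dx Ω T i (dx Ω T i u) z := fun i =>
    (HasWeakDeriv.mul_of_bounded_memH1 hQ hq (hu.1.memH1_dx hΩ i) hqM (huM i) _).weakDeriv_ae_eq hQ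
  have d2 : ∀ i, dx Ω T i (fun w => q w * φ w) =ᵐ[volume.restrict (cyl Ω T)]
      fun z => dx Ω T i q z * φ z + q z * dx Ω T i φ z := fun i =>
    (HasWeakDeriv.mul_of_bounded_memH1 hQ hq hφ hqM hφM _).weakDeriv_ae_eq hQ
  have e : ∫ z in cyl Ω T, (φ z * ∑ i, dx Ω T i (fun w => q w * dx Ω T i u w) z
      + ∑ i, q z * dx Ω T i u z * dx Ω T i φ z) = 0 := by
    rw [← hu.2 _ hqφ, normalDeriv]
    refine integral_congr_ae ?_
    filter_upwards [ae_all_iff.2 d1, ae_all_iff.2 d2] with z h1 h2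
    simp only [h1, h2, lap, Finset.mul_sum, ← Finset.sum_add_distrib]
    exact Finset.sum_congr rfl fun i _ => by ring
  rw [integral_add i1 i2] at e
  linarith

theorem IsInteraction.abs_sub_le {M : ℝ} {G : EuclideanSpace ℝ (Fin n) × ℝ → ℝ → ℝ → ℝ}
    (hG : IsInteraction Ω T M G) {w : EuclideanSpace ℝ (Fin n) × ℝ} (hw : w ∈ cyl Ω T)
    (y y' z z' : ℝ) : |G w y z - G w y' z'| ≤ M * (|y - y'| + |z - z'|) := by
  have hw' := subset_closure hw
  have h1 := Convex.norm_image_sub_le_of_norm_deriv_le (f := fun s => G w s z) (s := univ)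
    (fun s _ => hG.diff_y w hw' s z) (fun s _ => hG.bound_y w hw s z) convex_univ
    (mem_univ y') (mem_univ y)
  have h2 := Convex.norm_image_sub_le_of_norm_deriv_le (f := fun s => G w y' s) (s := univ)
    (fun s _ => hG.diff_z w hw' y' s) (fun s _ => hG.bound_z w hw y' s) convex_univ
    (mem_univ z') (mem_univ z)
  simp only [Real.norm_eq_abs] at h1 h2
  calc |G w y z - G w y' z'| ≤ |G w y z - G w y' z| + |G w y' z - G w y' z'| := _root_.abs_sub_le _ _ _
    _ ≤ _ := by linarith

/-- The nonlocal term is Lipschitz continuous from `L²(Ω)`, for almost every position and time. -/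
theorem IsKernel.sq_integral_sub_le (hΩ : IsOpen Ω) (hΩb : Bornology.IsBounded Ω) {M : ℝ}
    {K : EuclideanSpace ℝ (Fin n) → EuclideanSpace ℝ (Fin n) → ℝ} (hK : IsKernel Ω M K)
    {p₁ p₂ : EuclideanSpace ℝ (Fin n) × ℝ → ℝ} (h₁ : MemLp p₁ 2 (volume.restrict (cyl Ω T)))
    (h₂ : MemLp p₂ 2 (volume.restrict (cyl Ω T))) :
    ∀ᵐ z ∂volume.restrict (cyl Ω T),
      ((∫ y in Ω, K z.1 y * p₁ (y, z.2)) - ∫ y in Ω, K z.1 y * p₂ (y, z.2)) ^ 2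
        ≤ volume.real Ω * M ^ 2 * ∫ y in Ω, (p₁ - p₂) (y, z.2) ^ 2 := by
  have hfin := isFiniteMeasure_restrict hΩb
  rw [restrict_cyl] at *
  filter_upwards [Measure.quasiMeasurePreserving_fst.ae hK.meas,
    Measure.quasiMeasurePreserving_fst.ae (ae_restrict_mem hΩ.measurableSet),
    Measure.quasiMeasurePreserving_snd.ae (ae_memLp_slice_left h₁),
    Measure.quasiMeasurePreserving_snd.ae (ae_memLp_slice_left h₂)] with z hz1 hz2 hz3 hz4
  have hb : ∀ᵐ y ∂volume.restrict Ω, |K z.1 y| ≤ M :=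
    (ae_restrict_iff' hΩ.measurableSet).2 (ae_of_all _ fun y hy => hK.bound _ hz2 y hy)
  have k1 := memLp_mul_of_bounded hz1 hb hz3
  have k2 := memLp_mul_of_bounded hz1 hb hz4
  rw [← integral_sub (k1.integrable one_le_two) (k2.integrable one_le_two)]
  refine (sq_integral_le (k1.sub k2)).trans ?_
  rw [measureReal_restrict_apply_univ, mul_assoc]
  refine mul_le_mul_of_nonneg_left ?_ measureReal_nonneg
  rw [← integral_const_mul]
  refine integral_mono_ae (k1.sub k2).integrable_sq ((hz3.sub hz4).integrable_sq.const_mul _) ?_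
  filter_upwards [hb] with y hy
  simp only [Pi.sub_apply]
  rw [← mul_sub, mul_pow]
  refine mul_le_mul_of_nonneg_right ?_ (sq_nonneg _)
  rw [← sq_abs]
  exact pow_le_pow_left₀ (abs_nonneg _) hy 2

/-- The time-weighted integral of the squared `L²(Ω)` norm, spread over the domain. -/
theorem integral_weight_slice (hΩ : IsOpen Ω) (hΩb : Bornology.IsBounded Ω)
    (hp : MemLp p 2 (volume.restrict (cyl Ω T))) {η : ℝ → ℝ} (hη : Continuous η) :
    IntegrableOn (fun z => η z.2 * ∫ y in Ω, p (y, z.2) ^ 2) (cyl Ω T) volume ∧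
    ∫ z in cyl Ω T, η z.2 * ∫ y in Ω, p (y, z.2) ^ 2
      = volume.real Ω * ∫ z in cyl Ω T, η z.2 * p z ^ 2 := by
  have hfin := isFiniteMeasure_restrict hΩb
  have i0 : IntegrableOn (fun z => η z.2 * p z ^ 2) (cyl Ω T) volume :=
    integrable_time_mul hΩ hΩb hη hp.integrable_sq
  rw [IntegrableOn, restrict_cyl] at *
  have e : ∀ t, ∫ y in Ω, η t * p (y, t) ^ 2 = η t * ∫ y in Ω, p (y, t) ^ 2 := fun t =>
    integral_const_mul _ _
  have i1 : Integrable (fun t => η t * ∫ y in Ω, p (y, t) ^ 2) (volume.restrict (Ioo 0 T)) := by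
    simpa only [e] using i0.integral_prod_right
  refine ⟨i1.comp_snd _, ?_⟩
  have h1 := integral_prod_mul (μ := volume.restrict Ω) (ν := volume.restrict (Ioo 0 T))
    (fun _ => (1 : ℝ)) (fun t => η t * ∫ y in Ω, p (y, t) ^ 2)
  simp only [one_mul, integral_const, smul_eq_mul, mul_one, measureReal_restrict_apply_univ] at h1
  rw [h1, integral_prod_symm _ i0]
  simp only [e]

end Coupling

section Differences

variable {n : ℕ} {Ω : Set (EuclideanSpace ℝ (Fin n))} {T : ℝ}

theorem gradSq_nonneg (u : EuclideanSpace ℝ (Fin n) × ℝ → ℝ) (z : EuclideanSpace ℝ (Fin n) × ℝ) :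
    0 ≤ gradSq Ω T u z :=
  Finset.sum_nonneg fun _ _ => sq_nonneg _

theorem gradSq_le_of_sqrt_le {u : EuclideanSpace ℝ (Fin n) × ℝ → ℝ}
    {z : EuclideanSpace ℝ (Fin n) × ℝ} {M N : ℝ} (h : √(gradSq Ω T u z) ≤ M) (hM : M ≤ N) :
    gradSq Ω T u z ≤ N ^ 2 := by
  rw [← Real.sq_sqrt (gradSq_nonneg u z)]
  exact pow_le_pow_left₀ (Real.sqrt_nonneg _) (h.trans hM) 2

theorem abs_dx_le_of_gradSq_le {u : EuclideanSpace ℝ (Fin n) × ℝ → ℝ}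
    {z : EuclideanSpace ℝ (Fin n) × ℝ} {N : ℝ} (hN : 0 ≤ N) (h : gradSq Ω T u z ≤ N ^ 2)
    (i : Fin n) : |dx Ω T i u z| ≤ N := by
  refine abs_le_of_sq_le_sq (le_trans ?_ h) hN
  exact Finset.single_le_sum (f := fun i => dx Ω T i u z ^ 2) (fun _ _ => sq_nonneg _)
    (Finset.mem_univ i)

/-- The squared length is Lipschitz continuous on a ball. -/
theorem sq_sum_sq_sub_le {ι : Type*} [Fintype ι] {N : ℝ} (a b : ι → ℝ)
    (ha : ∑ i, a i ^ 2 ≤ N ^ 2) (hb : ∑ i, b i ^ 2 ≤ N ^ 2) :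
    (∑ i, a i ^ 2 - ∑ i, b i ^ 2) ^ 2 ≤ 4 * N ^ 2 * ∑ i, (a i - b i) ^ 2 := by
  have e : ∑ i, a i ^ 2 - ∑ i, b i ^ 2 = ∑ i, (a i - b i) * (a i + b i) := by
    rw [← Finset.sum_sub_distrib]
    exact Finset.sum_congr rfl fun i _ => by ring
  have h : ∑ i, (a i + b i) ^ 2 ≤ 4 * N ^ 2 := by
    calc ∑ i, (a i + b i) ^ 2 ≤ ∑ i, (2 * a i ^ 2 + 2 * b i ^ 2) :=
          Finset.sum_le_sum fun i _ => by nlinarith [sq_nonneg (a i - b i)]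
      _ = 2 * ∑ i, a i ^ 2 + 2 * ∑ i, b i ^ 2 := by
          rw [Finset.sum_add_distrib, Finset.mul_sum, Finset.mul_sum]
      _ ≤ 4 * N ^ 2 := by linarith
  rw [e]
  refine (Finset.sum_mul_sq_le_sq_mul_sq _ _ _).trans ?_
  rw [mul_comm (4 * N ^ 2)]
  exact mul_le_mul_of_nonneg_left h (Finset.sum_nonneg fun _ _ => sq_nonneg _)

/-- The right-hand side of the difference of the Bellman equations at a point: `k` stands for `κ²`,
`D` for the difference of the squared gradients, `b` for the difference of the interaction terms,
`y` and `s` for the differences of the nonlocal term and of the densities. -/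
theorem sq_coupling_le {N k D g y s P V b : ℝ} (hk0 : 0 ≤ k) (hk : k ≤ N ^ 2)
    (hD : D ^ 2 ≤ 4 * N ^ 2 * g) (hb : |b| ≤ N * (|y| + |s|)) (hy : y ^ 2 ≤ V * N ^ 2 * P) :
    (k / 2 * D + b) ^ 2 ≤ 2 * N ^ 6 * g + 4 * N ^ 2 * s ^ 2 + 4 * N ^ 4 * V * P := by
  have hk4 : k ^ 2 ≤ (N ^ 2) ^ 2 := pow_le_pow_left₀ hk0 hk 2
  have ha2 : (k / 2 * D) ^ 2 ≤ N ^ 6 * g :=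
    calc (k / 2 * D) ^ 2 = k ^ 2 / 4 * D ^ 2 := by ring
      _ ≤ (N ^ 2) ^ 2 / 4 * (4 * N ^ 2 * g) :=
          mul_le_mul (by linarith) hD (sq_nonneg _) (by positivity)
      _ = _ := by ring
  have hb2 : b ^ 2 ≤ 2 * N ^ 2 * (y ^ 2 + s ^ 2) :=
    calc b ^ 2 = |b| ^ 2 := (sq_abs b).symm
      _ ≤ (N * (|y| + |s|)) ^ 2 := pow_le_pow_left₀ (abs_nonneg _) hb 2
      _ = N ^ 2 * (|y| + |s|) ^ 2 := by ring
      _ ≤ N ^ 2 * (2 * (|y| ^ 2 + |s| ^ 2)) :=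
          mul_le_mul_of_nonneg_left (add_sq_le) (sq_nonneg _)
      _ = _ := by rw [sq_abs, sq_abs]; ring
  have hy3 : 4 * N ^ 2 * y ^ 2 ≤ 4 * N ^ 2 * (V * N ^ 2 * P) :=
    mul_le_mul_of_nonneg_left hy (by positivity)
  have h := add_sq_le (a := k / 2 * D) (b := b)
  linarith

variable {β Λ μ N N₁ N₂ N₃ N₄ : ℝ} {κ : EuclideanSpace ℝ (Fin n) → ℝ}
  {K : EuclideanSpace ℝ (Fin n) → EuclideanSpace ℝ (Fin n) → ℝ}
  {G : EuclideanSpace ℝ (Fin n) × ℝ → ℝ → ℝ → ℝ}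
  {u₁ p₁ u₂ p₂ : EuclideanSpace ℝ (Fin n) × ℝ → ℝ}

/-- In the difference of the Bellman equations the right-hand side is controlled by the gradient of
the difference of the value functions and the difference of the densities. -/
theorem bellman_difference (hΩ : IsOpen Ω) (hΩb : Bornology.IsBounded Ω)
    (h1 : N₁ ≤ N) (h2' : 0 ≤ N₂) (h2 : N₂ ≤ N) (h3 : N₃ ≤ N)
    (hG : IsInteraction Ω T N₁ G) (hK : IsKernel Ω N₂ K) (hκ : C1Bounded Ω N₂ κ)
    (hu₁ : MemD3 Ω T N₃ u₁) (hu₂ : MemD3 Ω T N₃ u₂) (hp₁ : MemD4 Ω T N₄ p₁)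
    (hp₂ : MemD4 Ω T N₄ p₂) (hs₁ : SolvesMFG Ω T β κ K G u₁ p₁)
    (hs₂ : SolvesMFG Ω T β κ K G u₂ p₂) :
    ∫ z in cyl Ω T, weight Λ μ z.2 * (dt Ω T (u₁ - u₂) z + β * lap Ω T (u₁ - u₂) z) ^ 2
      ≤ (2 * N ^ 6 + 4 * N ^ 2 + 4 * N ^ 4 * volume.real Ω ^ 2)
        * ((∫ z in cyl Ω T, weight Λ μ z.2 * gradSq Ω T (u₁ - u₂) z)
          + ∫ z in cyl Ω T, weight Λ μ z.2 * (p₁ - p₂) z ^ 2) := by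
  have cE : Continuous (weight Λ μ) := (contDiff_weight Λ μ).continuous
  have hu := hu₁.memH20.sub hΩ hu₂.memH20
  have hp := hp₁.memH20.sub hΩ hp₂.memH20
  have H₁ := hu₁.memH20.1.memH1
  have H₂ := hu₂.memH20.1.memH1
  have hut := hu.1.memH1.memLp_dt hΩ
  have hL := hu.1.memLp_lap hΩ
  have tm := @integrable_time_mul n Ω T hΩ hΩb (weight Λ μ) cE
  have j0 : IntegrableOn (fun z => weight Λ μ z.2
      * (dt Ω T (u₁ - u₂) z + β * lap Ω T (u₁ - u₂) z) ^ 2) (cyl Ω T) volume :=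
    tm (hut.add (hL.const_mul β)).integrable_sq
  have j1 : IntegrableOn (fun z => weight Λ μ z.2 * gradSq Ω T (u₁ - u₂) z) (cyl Ω T) volume :=
    tm (hu.1.memH1.integrable_gradSq hΩ)
  have j2 : IntegrableOn (fun z => weight Λ μ z.2 * (p₁ - p₂) z ^ 2) (cyl Ω T) volume :=
    tm hp.1.1.integrable_sq
  obtain ⟨j3, e3⟩ := integral_weight_slice hΩ hΩb hp.1.1 cE
  have key := integral_linear_combination j1 j2 j3 j3 (2 * N ^ 6) (4 * N ^ 2)
    (4 * N ^ 4 * volume.real Ω) 0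
  have le : _ ≤ _ := integral_mono_ae j0 ((((j1.const_mul (2 * N ^ 6)).add
    (j2.const_mul (4 * N ^ 2))).add (j3.const_mul (4 * N ^ 4 * volume.real Ω))).add
      (j3.const_mul 0)) ?_
  · refine le.trans (key.trans_le ?_)
    rw [e3]
    have hA : 0 ≤ ∫ z in cyl Ω T, weight Λ μ z.2 * gradSq Ω T (u₁ - u₂) z :=
      integral_nonneg fun z => mul_nonneg (weight_pos Λ μ z.2).le (gradSq_nonneg _ z)
    have hS : 0 ≤ ∫ z in cyl Ω T, weight Λ μ z.2 * (p₁ - p₂) z ^ 2 :=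
      integral_nonneg fun z => mul_nonneg (weight_pos Λ μ z.2).le (sq_nonneg _)
    have c1 : 0 ≤ (4 * N ^ 2 + 4 * N ^ 4 * volume.real Ω ^ 2)
        * ∫ z in cyl Ω T, weight Λ μ z.2 * gradSq Ω T (u₁ - u₂) z := mul_nonneg (by positivity) hA
    have c2 : 0 ≤ 2 * N ^ 6 * ∫ z in cyl Ω T, weight Λ μ z.2 * (p₁ - p₂) z ^ 2 :=
      mul_nonneg (by positivity) hS
    linarith
  filter_upwards [dt_sub hΩ H₁ H₂, lap_sub hΩ hu₁.memH20.1 hu₂.memH20.1,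
    ae_all_iff.2 fun i => dx_sub hΩ H₁ H₂ i, hs₁.bellman, hs₂.bellman, hu₁.bound_grad,
    hu₂.bound_grad, hK.sq_integral_sub_le hΩ hΩb hp₁.memH20.1.1 hp₂.memH20.1.1,
    ae_restrict_mem (isOpen_cyl hΩ).measurableSet] with z z1 z2 z3 z4 z5 z6 z7 z8 z9
  have hP0 : 0 ≤ ∫ y in Ω, (p₁ - p₂) (y, z.2) ^ 2 := integral_nonneg fun _ => sq_nonneg _
  have hg : gradSq Ω T (u₁ - u₂) z = ∑ i, (dx Ω T i u₁ z - dx Ω T i u₂ z) ^ 2 := by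
    simp only [gradSq, z3, Pi.sub_apply]
  have hq := sq_sum_sq_sub_le _ _ (gradSq_le_of_sqrt_le z6 h3) (gradSq_le_of_sqrt_le z7 h3)
  rw [← hg] at hq
  have hl := (hG.abs_sub_le z9 (∫ y in Ω, K z.1 y * p₁ (y, z.2))
    (∫ y in Ω, K z.1 y * p₂ (y, z.2)) (p₁ z) (p₂ z)).trans
      (mul_le_mul_of_nonneg_right h1 (by positivity))
  have hk : κ z.1 ^ 2 ≤ N ^ 2 := by
    rw [← sq_abs]
    exact pow_le_pow_left₀ (abs_nonneg _) ((hκ.2.2.1 _ z9.1).trans h2) 2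
  have hfin := sq_coupling_le (sq_nonneg _) hk hq hl (z8.trans (mul_le_mul_of_nonneg_right
    (mul_le_mul_of_nonneg_left (pow_le_pow_left₀ h2' h2 2) measureReal_nonneg) hP0))
  have hF : (dt Ω T (u₁ - u₂) z + β * lap Ω T (u₁ - u₂) z) ^ 2
      = (κ z.1 ^ 2 / 2 * (gradSq Ω T u₁ z - gradSq Ω T u₂ z)
        + (G z (∫ y in Ω, K z.1 y * p₁ (y, z.2)) (p₁ z)
          - G z (∫ y in Ω, K z.1 y * p₂ (y, z.2)) (p₂ z))) ^ 2 := by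
    rw [z1, z2, sq_eq_sq_iff_eq_or_eq_neg]
    right
    simp only [Pi.sub_apply]
    linarith
  refine (mul_le_mul_of_nonneg_left (hF.trans_le hfin) (weight_pos Λ μ z.2).le).trans_eq ?_
  simp only [Pi.add_apply, Pi.sub_apply]
  ring

/-- In the difference of the Fokker-Planck equations, tested with the difference of the densities,
the divergence term is absorbed by the diffusion up to lower order terms and the gradient of the
difference of the value functions. -/
theorem fokkerPlanck_difference (hΩ : IsOpen Ω) (hΩb : Bornology.IsBounded Ω) (hβ : 0 < β)
    (h0 : 0 ≤ N) (h2 : N₂ ≤ N) (h3 : N₃ ≤ N) (h4 : N₄ ≤ N) (hκ : C1Bounded Ω N₂ κ)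
    (hu₁ : MemD3 Ω T N₃ u₁) (hu₂ : MemD3 Ω T N₃ u₂) (hp₁ : MemD4 Ω T N₄ p₁)
    (hp₂ : MemD4 Ω T N₄ p₂) (hs₁ : SolvesMFG Ω T β κ K G u₁ p₁)
    (hs₂ : SolvesMFG Ω T β κ K G u₂ p₂) :
    ∫ z in cyl Ω T, weight Λ μ z.2
        * ((p₁ - p₂) z * (dt Ω T (p₁ - p₂) z - β * lap Ω T (p₁ - p₂) z))
      ≤ β / 2 * (∫ z in cyl Ω T, weight Λ μ z.2 * gradSq Ω T (p₁ - p₂) z)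
        + N ^ 6 / β * ((∫ z in cyl Ω T, weight Λ μ z.2 * (p₁ - p₂) z ^ 2)
          + ∫ z in cyl Ω T, weight Λ μ z.2 * gradSq Ω T (u₁ - u₂) z) := by
  have hfin := isFiniteMeasure_restrict_cyl (T := T) hΩb
  have hQ := isOpen_cyl (T := T) hΩ
  have cE : ContDiff ℝ ∞ (weight Λ μ) := contDiff_weight Λ μ
  have hu := hu₁.memH20.sub hΩ hu₂.memH20
  have hp := hp₁.memH20.sub hΩ hp₂.memH20
  have tm := @integrable_time_mul n Ω T hΩ hΩb (weight Λ μ) cE.continuous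
  have j1 : IntegrableOn (fun z => weight Λ μ z.2 * gradSq Ω T (p₁ - p₂) z) (cyl Ω T) volume :=
    tm (hp.1.memH1.integrable_gradSq hΩ)
  have j2 : IntegrableOn (fun z => weight Λ μ z.2 * (p₁ - p₂) z ^ 2) (cyl Ω T) volume :=
    tm hp.1.1.integrable_sq
  have j3 : IntegrableOn (fun z => weight Λ μ z.2 * gradSq Ω T (u₁ - u₂) z) (cyl Ω T) volume :=
    tm (hu.1.memH1.integrable_gradSq hΩ)
  -- the factors below are bounded by a common constant `M`, so their products stay in `H¹(Q_T)`
  obtain ⟨C, hC⟩ := isCompact_Icc.exists_bound_of_continuousOn (s := Icc 0 T)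
    cE.continuous.continuousOn
  have bκ : ∀ᵐ z ∂volume.restrict (cyl Ω T), |κ z.1 ^ 2| ≤ N ^ 2 := by
    filter_upwards [ae_restrict_mem hQ.measurableSet] with z hz
    rw [abs_of_nonneg (sq_nonneg _), ← sq_abs]
    exact pow_le_pow_left₀ (abs_nonneg _) ((hκ.2.2.1 _ hz.1).trans h2) 2
  have bp : ∀ {p}, MemD4 Ω T N₄ p → ∀ᵐ z ∂volume.restrict (cyl Ω T), |p z| ≤ N := fun hp =>
    hp.bound.mono fun z hz => hz.trans h4
  have bg : ∀ {u}, MemD3 Ω T N₃ u → ∀ᵐ z ∂volume.restrict (cyl Ω T), gradSq Ω T u z ≤ N ^ 2 :=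
    fun hu => hu.bound_grad.mono fun z hz => gradSq_le_of_sqrt_le hz h3
  have bu : ∀ {u}, MemD3 Ω T N₃ u → ∀ i, ∀ᵐ z ∂volume.restrict (cyl Ω T), |dx Ω T i u z| ≤ N :=
    fun hu i => (bg hu).mono fun z hz => abs_dx_le_of_gradSq_le h0 hz i
  set M := N + N ^ 2 + N ^ 2 * N + |C| * (2 * N) with hM
  have M1 : N ≤ M := by
    have : 0 ≤ N ^ 2 + N ^ 2 * N + |C| * (2 * N) := by positivity
    linarith
  have M2 : N ^ 2 ≤ M := by
    have : 0 ≤ N + N ^ 2 * N + |C| * (2 * N) := by positivity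
    linarith
  have M3 : N ^ 2 * N ≤ M := by
    have : 0 ≤ N + N ^ 2 + |C| * (2 * N) := by positivity
    linarith
  have M4 : |C| * (2 * N) ≤ M := by
    have : 0 ≤ N + N ^ 2 + N ^ 2 * N := by positivity
    linarith
  have hκ1 : MemH1 (cyl Ω T) (fun z => κ z.1 ^ 2) := hκ.memH1_sq hΩ hΩb
  have hq : ∀ {p}, MemD4 Ω T N₄ p → MemH1 (cyl Ω T) (fun z => κ z.1 ^ 2 * p z) := fun hp =>
    hκ1.mul_of_bounded hQ hp.memH20.1.memH1 (M := M) (bκ.mono fun z hz => hz.trans M2)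
      ((bp hp).mono fun z hz => hz.trans M1)
  have hqM : ∀ {p}, MemD4 Ω T N₄ p →
      ∀ᵐ z ∂volume.restrict (cyl Ω T), |κ z.1 ^ 2 * p z| ≤ M := fun hp => by
    filter_upwards [bκ, bp hp] with z hz1 hz2
    rw [abs_mul]
    exact (mul_le_mul hz1 hz2 (abs_nonneg _) (sq_nonneg _)).trans M3
  have hφ : MemH1 (cyl Ω T) (fun z => weight Λ μ z.2 * (p₁ - p₂) z) :=
    hp.1.memH1.time_mul hΩ hΩb cE
  have hφM : ∀ᵐ z ∂volume.restrict (cyl Ω T), |weight Λ μ z.2 * (p₁ - p₂) z| ≤ M := by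
    filter_upwards [bp hp₁, bp hp₂, ae_restrict_mem hQ.measurableSet] with z hz1 hz2 hz3
    rw [abs_mul]
    refine le_trans (mul_le_mul ((hC _ (Ioo_subset_Icc_self hz3.2)).trans (le_abs_self C)) ?_
      (abs_nonneg _) (abs_nonneg _)) M4
    have := abs_sub (p₁ z) (p₂ z)
    simp only [Pi.sub_apply]
    linarith
  obtain ⟨i1, k1, e1⟩ := hu₁.memH20.integral_divergence hΩ hΩb (hq hp₁) hφ
    (fun i => (bu hu₁ i).mono fun z hz => hz.trans M1) (hqM hp₁) hφM
  obtain ⟨i2, k2, e2⟩ := hu₂.memH20.integral_divergence hΩ hΩb (hq hp₂) hφ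
    (fun i => (bu hu₂ i).mono fun z hz => hz.trans M1) (hqM hp₂) hφM
  have e : ∫ z in cyl Ω T, weight Λ μ z.2
        * ((p₁ - p₂) z * (dt Ω T (p₁ - p₂) z - β * lap Ω T (p₁ - p₂) z))
      = ∫ z in cyl Ω T, ((∑ i, κ z.1 ^ 2 * p₁ z * dx Ω T i u₁ z
          * dx Ω T i (fun z => weight Λ μ z.2 * (p₁ - p₂) z) z)
        - ∑ i, κ z.1 ^ 2 * p₂ z * dx Ω T i u₂ z
          * dx Ω T i (fun z => weight Λ μ z.2 * (p₁ - p₂) z) z) := by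
    rw [integral_sub k1 k2, ← neg_eq_iff_eq_neg.2 e1, ← neg_eq_iff_eq_neg.2 e2, neg_sub_neg,
      ← integral_sub i2 i1]
    refine integral_congr_ae ?_
    filter_upwards [dt_sub hΩ hp₁.memH20.1.memH1 hp₂.memH20.1.memH1,
      lap_sub hΩ hp₁.memH20.1 hp₂.memH20.1, hs₁.fokkerPlanck, hs₂.fokkerPlanck] with z z1 z2 z3 z4
    rw [z1, z2]
    simp only [Pi.sub_apply] at *
    have : dt Ω T p₁ z - dt Ω T p₂ z - β * (lap Ω T p₁ z - lap Ω T p₂ z)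
        = (∑ i, dx Ω T i (fun w => κ w.1 ^ 2 * p₂ w * dx Ω T i u₂ w) z)
          - ∑ i, dx Ω T i (fun w => κ w.1 ^ 2 * p₁ w * dx Ω T i u₁ w) z := by linarith
    rw [this]
    ring
  have key := integral_linear_combination j1 j2 j3 j3 (β / 2) (N ^ 6 / β) (N ^ 6 / β) 0
  have le : _ ≤ _ := integral_mono_ae (k1.sub k2) ((((j1.const_mul (β / 2)).add
    (j2.const_mul (N ^ 6 / β))).add (j3.const_mul (N ^ 6 / β))).add (j3.const_mul 0)) ?_
  · refine e.trans_le (le.trans (key.trans_le ?_))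
    linarith
  filter_upwards [ae_all_iff.2 fun i => dx_time_mul hΩ hp.1.memH1 cE i,
    ae_all_iff.2 fun i => dx_sub hΩ hu₁.memH20.1.memH1 hu₂.memH20.1.memH1 i,
    bκ, bp hp₂, bg hu₁] with z z1 z2 z3 z4 z5
  simp only [Pi.add_apply, Pi.sub_apply] at z1 z2 ⊢
  simp only [z1, gradSq, z2]
  have hE := weight_pos Λ μ z.2
  set E := weight Λ μ z.2
  set k := κ z.1 ^ 2
  have hk0 : 0 ≤ k := sq_nonneg _
  rw [abs_of_nonneg hk0] at z3
  have hk2 : k ^ 2 ≤ N ^ 4 := (pow_le_pow_left₀ hk0 z3 2).trans_eq (by ring)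
  have hp2 : p₂ z ^ 2 ≤ N ^ 2 := by
    rw [← sq_abs]; exact pow_le_pow_left₀ (abs_nonneg _) z4 2
  have term : ∀ i, k * p₁ z * dx Ω T i u₁ z * (E * dx Ω T i (p₁ - p₂) z)
        - k * p₂ z * dx Ω T i u₂ z * (E * dx Ω T i (p₁ - p₂) z)
      ≤ E * (β / 2 * dx Ω T i (p₁ - p₂) z ^ 2
        + N ^ 4 / β * ((p₁ z - p₂ z) ^ 2 * dx Ω T i u₁ z ^ 2
          + N ^ 2 * (dx Ω T i u₁ z - dx Ω T i u₂ z) ^ 2)) := by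
    intro i
    set c := dx Ω T i (p₁ - p₂) z
    set a := dx Ω T i u₁ z
    set d := dx Ω T i u₁ z - dx Ω T i u₂ z with hd
    set x := (p₁ z - p₂ z) * a + p₂ z * d with hx
    have e1 : k * p₁ z * a * (E * c) - k * p₂ z * dx Ω T i u₂ z * (E * c) = E * (k * x * c) := by
      rw [hx, hd]; ring
    rw [e1]
    refine mul_le_mul_of_nonneg_left ?_ hE.le
    -- Young's inequality, with the constant that leaves half of the diffusion
    have y1 : k * x * c ≤ β / 2 * c ^ 2 + (k * x) ^ 2 / (2 * β) := by
      have h := div_nonneg (sq_nonneg (β * c - k * x)) (mul_pos two_pos hβ).le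
      have : (β * c - k * x) ^ 2 / (2 * β) = β / 2 * c ^ 2 + (k * x) ^ 2 / (2 * β) - k * x * c := by
        field_simp; ring
      linarith
    have y2 : (k * x) ^ 2 ≤ N ^ 4 * (2 * ((p₁ z - p₂ z) ^ 2 * a ^ 2 + N ^ 2 * d ^ 2)) := by
      rw [mul_pow]
      refine mul_le_mul hk2 ?_ (sq_nonneg _) (by positivity)
      have y3 : p₂ z ^ 2 * d ^ 2 ≤ N ^ 2 * d ^ 2 := mul_le_mul_of_nonneg_right hp2 (sq_nonneg _)
      have y4 : x ^ 2 ≤ 2 * (((p₁ z - p₂ z) * a) ^ 2 + (p₂ z * d) ^ 2) := by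
        rw [hx]
        nlinarith [sq_nonneg ((p₁ z - p₂ z) * a - p₂ z * d)]
      rw [mul_pow, mul_pow] at y4
      linarith
    have y5 : (k * x) ^ 2 / (2 * β)
        ≤ N ^ 4 * (2 * ((p₁ z - p₂ z) ^ 2 * a ^ 2 + N ^ 2 * d ^ 2)) / (2 * β) := by gcongr
    have y6 : N ^ 4 * (2 * ((p₁ z - p₂ z) ^ 2 * a ^ 2 + N ^ 2 * d ^ 2)) / (2 * β)
        = N ^ 4 / β * ((p₁ z - p₂ z) ^ 2 * a ^ 2 + N ^ 2 * d ^ 2) := by field_simp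
    linarith
  rw [← Finset.sum_sub_distrib]
  refine (Finset.sum_le_sum fun i _ => term i).trans ?_
  rw [← Finset.mul_sum, Finset.sum_add_distrib, ← Finset.mul_sum, ← Finset.mul_sum,
    Finset.sum_add_distrib, ← Finset.mul_sum, ← Finset.mul_sum]
  have hg : ∑ i, dx Ω T i u₁ z ^ 2 ≤ N ^ 2 := z5
  have hfin : N ^ 4 / β * ((p₁ z - p₂ z) ^ 2 * ∑ i, dx Ω T i u₁ z ^ 2)
      ≤ N ^ 4 / β * ((p₁ z - p₂ z) ^ 2 * N ^ 2) := by gcongr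
  have := mul_le_mul_of_nonneg_left hfin hE.le
  have e6 : N ^ 6 / β = N ^ 4 / β * N ^ 2 := by ring
  rw [e6]
  linarith

end Differences

/-! ### Absorption of the lower order terms -/

section Absorption

variable {n : ℕ} {Ω : Set (EuclideanSpace ℝ (Fin n))} {T : ℝ}

theorem HasTimeTrace.sub {f g : EuclideanSpace ℝ (Fin n) × ℝ → ℝ} {τ : ℝ}
    {a b : EuclideanSpace ℝ (Fin n) → ℝ}
    (hf : AEStronglyMeasurable f ((volume.restrict Ω).prod (volume.restrict (Ioo 0 T))))
    (ha : HasTimeTrace Ω T f τ a) (hb : HasTimeTrace Ω T g τ b) :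
    HasTimeTrace Ω T (f - g) τ (a - b) := by
  refine ⟨ha.1.sub hb.1, ?_⟩
  have hlim := (ENNReal.Tendsto.const_mul (a := 2) (ha.2.add hb.2) (Or.inr (by simp)))
  rw [add_zero, mul_zero] at hlim
  refine tendsto_of_tendsto_of_tendsto_of_le_of_le tendsto_const_nhds hlim (fun _ => zero_le)
    fun h => ?_
  dsimp only
  rw [← mul_add, mul_left_comm]
  refine mul_le_mul_right ?_ _
  have hma : AEMeasurable (fun z : EuclideanSpace ℝ (Fin n) × ℝ => ‖f z - a z.1‖ₑ ^ 2)
      (volume.restrict (Ω ×ˢ (Ioo 0 T ∩ Ioo (τ - h) (τ + h)))) := by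
    rw [restrict_window]
    refine (((hf.mono_measure ?_).sub ha.1.1.comp_fst).enorm).pow_const 2
    exact Measure.prod_mono le_rfl (Measure.restrict_mono_set volume inter_subset_left)
  rw [← lintegral_add_left' hma, ← lintegral_const_mul' _ _ (by simp)]
  refine lintegral_mono fun z => ?_
  simp only [Pi.sub_apply]
  rw [enorm_sq_eq_ofReal, enorm_sq_eq_ofReal, enorm_sq_eq_ofReal,
    ← ENNReal.ofReal_add (sq_nonneg _) (sq_nonneg _),
    show (2 : ℝ≥0∞) = ENNReal.ofReal 2 by simp, ← ENNReal.ofReal_mul (by norm_num)]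
  refine ENNReal.ofReal_le_ofReal ?_
  nlinarith [sq_nonneg (f z - a z.1 + (g z - b z.1))]

/-- The absorption argument. `A`, `B₀`, `S`, `R` are the weighted integrals of `|∇u|²`, `u²`, `p²`
and `|∇p|²`, and `B`, `P` carry in addition the factor `σ ≥ s`. The rate `μ` of the weight is chosen
so large that the Carleman estimate `h₁` controls the term `B` of the backward energy estimate `h₂`
(taken `M` times); then `s` is chosen so large that `P` and `B` control the remaining lower order
terms. -/
theorem absorption {β C₂ C₃ M μ s A B B₀ S P R F D₁ D₂ D₃ : ℝ} (hβ : 0 < β) (hC₂ : 0 < C₂)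
    (hC₃ : 0 ≤ C₃) (hM : M = 2 * (C₂ + C₃ + 1) / β) (hμ : μ = 2 * M + 1)
    (hs : s = 2 * (2 * C₂ + 2 * C₃ + 1) + C₂ / (2 * β) + 2)
    (hB₀ : 0 ≤ B₀) (hS : 0 ≤ S) (hsB : s * B₀ ≤ B) (hsS : s * S ≤ P)
    (hF : F ≤ C₂ * (A + S)) (h₁ : μ * B ≤ F + D₁)
    (h₂ : β * A ≤ D₂ + B + (β / (2 * C₂) * F + C₂ / (2 * β) * B₀))
    (h₃ : P + β * R ≤ D₃ + (β / 2 * R + C₃ * (S + A))) :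
    A + B₀ + S + β / 2 * R ≤ M * D₂ + D₁ + D₃ := by
  subst hμ
  have hM0 : 0 ≤ M := by rw [hM]; positivity
  have hMβ : M * β = 2 * (C₂ + C₃ + 1) := by rw [hM]; field_simp
  have e₁ : β / (2 * C₂) * F ≤ β / 2 * (A + S) :=
    (mul_le_mul_of_nonneg_left hF (by positivity)).trans_eq (by field_simp)
  have h₂' : M * (β * A)
      ≤ M * (D₂ + B + (β / 2 * (A + S) + C₂ / (2 * β) * B₀)) :=
    mul_le_mul_of_nonneg_left (by linarith) hM0
  have h₄ : M * (β * A) = 2 * (C₂ + C₃ + 1) * A := by rw [← hMβ]; ring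
  have h₅ : M * (β / 2 * (A + S)) = (C₂ + C₃ + 1) * (A + S) := by
    rw [show M * (β / 2 * (A + S)) = M * β / 2 * (A + S) by ring, hMβ]; ring
  have hc : 0 ≤ C₂ / (2 * β) := by positivity
  -- the three consequences of the choice of `s`
  have s₁ : (2 * (2 * C₂ + 2 * C₃ + 1) + 2) * S ≤ P :=
    (mul_le_mul_of_nonneg_right (by linarith) hS).trans hsS
  have s₂ : C₂ / (2 * β) * B₀ ≤ B :=
    (mul_le_mul_of_nonneg_right (by linarith) hB₀).trans hsB
  have s₃ : B₀ ≤ B := (le_mul_of_one_le_left hB₀ (by linarith)).trans hsB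
  have s₄ : M * (C₂ / (2 * β) * B₀) ≤ M * B := mul_le_mul_of_nonneg_left s₂ hM0
  have s₅ : 0 ≤ (2 * C₂ + 2 * C₃ + 1) * S := by positivity
  have h₂'' : M * (D₂ + B + (β / 2 * (A + S) + C₂ / (2 * β) * B₀))
      = M * D₂ + M * B + M * (β / 2 * (A + S)) + M * (C₂ / (2 * β) * B₀) := by ring
  linarith

theorem rate_nonneg {Λ μ : ℝ} (hΛ : 0 ≤ Λ) (hμ : 0 ≤ μ) (t : ℝ) : 0 ≤ rate Λ μ t :=
  mul_nonneg (mul_nonneg hΛ hμ) (Real.exp_pos _).le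

theorem rate_antitone {Λ μ : ℝ} (hΛ : 0 ≤ Λ) (hμ : 0 ≤ μ) : Antitone (rate Λ μ) := fun s t hst =>
  mul_le_mul_of_nonneg_left (Real.exp_le_exp.2 (by nlinarith)) (mul_nonneg hΛ hμ)

theorem one_le_weight {Λ : ℝ} (hΛ : 0 ≤ Λ) (μ t : ℝ) : 1 ≤ weight Λ μ t :=
  Real.one_le_exp (mul_nonneg (by linarith) (Real.exp_pos _).le)

/-- A stability estimate for a pair of functions that satisfy the differences of the Bellman and
Fokker-Planck equations up to lower order terms, for every choice of the weight. -/
theorem exists_stability_constant (hΩ : IsOpen Ω) (hΩb : Bornology.IsBounded Ω) (hT : 0 < T)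
    {β C₂ C₃ : ℝ} (hβ : 0 < β) (hC₂ : 0 < C₂) (hC₃ : 0 ≤ C₃) :
    ∃ C : ℝ, 0 < C ∧ ∀ (u p : EuclideanSpace ℝ (Fin n) × ℝ → ℝ)
      (uT u₀ p₀ : EuclideanSpace ℝ (Fin n) → ℝ), MemH20 Ω T u → MemH20 Ω T p →
      HasTimeTrace Ω T u T uT → HasTimeTrace Ω T u 0 u₀ → HasTimeTrace Ω T p 0 p₀ →
      (∀ Λ μ, ∫ z in cyl Ω T, weight Λ μ z.2 * (dt Ω T u z + β * lap Ω T u z) ^ 2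
        ≤ C₂ * ((∫ z in cyl Ω T, weight Λ μ z.2 * gradSq Ω T u z)
          + ∫ z in cyl Ω T, weight Λ μ z.2 * p z ^ 2)) →
      (∀ Λ μ, ∫ z in cyl Ω T, weight Λ μ z.2 * (p z * (dt Ω T p z - β * lap Ω T p z))
        ≤ β / 2 * (∫ z in cyl Ω T, weight Λ μ z.2 * gradSq Ω T p z)
          + C₃ * ((∫ z in cyl Ω T, weight Λ μ z.2 * p z ^ 2)
            + ∫ z in cyl Ω T, weight Λ μ z.2 * gradSq Ω T u z)) →
      (∫ z in cyl Ω T, (u z ^ 2 + gradSq Ω T u z))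
          + (∫ z in cyl Ω T, (p z ^ 2 + gradSq Ω T p z))
        ≤ C * ((∫ x in Ω, (uT x ^ 2 + ∑ i, weakDeriv Ω (EuclideanSpace.single i 1) uT x ^ 2))
          + (∫ x in Ω, u₀ x ^ 2) + ∫ x in Ω, p₀ x ^ 2) := by
  obtain ⟨M, hM⟩ : ∃ M, M = 2 * (C₂ + C₃ + 1) / β := ⟨_, rfl⟩
  obtain ⟨s, hs⟩ : ∃ s, s = 2 * (2 * C₂ + 2 * C₃ + 1) + C₂ / (2 * β) + 2 := ⟨_, rfl⟩
  have hM0 : 0 ≤ M := by rw [hM]; positivity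
  have hs0 : 0 ≤ s := by rw [hs]; positivity
  obtain ⟨μ, hμ⟩ : ∃ μ, μ = 2 * M + 1 := ⟨_, rfl⟩
  have hμ0 : 0 < μ := by linarith
  -- the size of the weight makes the rate at the final time equal to `s`
  obtain ⟨Λ, hΛ⟩ : ∃ Λ, Λ = s / (μ * Real.exp (-μ * T)) := ⟨_, rfl⟩
  have hΛ0 : 0 ≤ Λ := by rw [hΛ]; exact div_nonneg hs0 (mul_pos hμ0 (Real.exp_pos _)).le
  have hrT : rate Λ μ T = s := by
    rw [rate, hΛ, mul_assoc, div_mul_cancel₀ _ (mul_pos hμ0 (Real.exp_pos _)).ne']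
  have hr0 : 0 ≤ rate Λ μ 0 := rate_nonneg hΛ0 hμ0.le 0
  have hW := weight_pos Λ μ 0
  have hWT := weight_pos Λ μ T
  obtain ⟨c, hc⟩ : ∃ c, c = M * (weight Λ μ T / 2) + β * weight Λ μ T + rate Λ μ 0 * weight Λ μ 0
    + weight Λ μ 0 / 2 := ⟨_, rfl⟩
  have hc0 : 0 < c := by rw [hc]; positivity
  refine ⟨(1 + 2 / β) * c, by positivity, fun u p uT u₀ p₀ hu hp huT hu₀ hp₀ hB hP => ?_⟩
  have cE : Continuous (weight Λ μ) := (contDiff_weight Λ μ).continuous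
  have cr : Continuous (rate Λ μ) := (contDiff_rate Λ μ).continuous
  have hQ := (isOpen_cyl (T := T) hΩ).measurableSet
  have tm := @integrable_time_mul n Ω T hΩ hΩb (weight Λ μ) cE
  have ku := hu.1.1.integrable_sq
  have kp := hp.1.1.integrable_sq
  have gu := hu.1.memH1.integrable_gradSq hΩ
  have gp := hp.1.memH1.integrable_gradSq hΩ
  have kF := ((hu.1.memH1.memLp_dt hΩ).add ((hu.1.memLp_lap hΩ).const_mul β)).integrable_sq
  have kuF := hu.1.1.integrable_mul
    ((hu.1.memH1.memLp_dt hΩ).add ((hu.1.memLp_lap hΩ).const_mul β))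
  -- weights can be bounded below inside the integrals
  have low : ∀ f : EuclideanSpace ℝ (Fin n) × ℝ → ℝ, IntegrableOn f (cyl Ω T) volume →
      (∀ z, 0 ≤ f z) → ∫ z in cyl Ω T, f z ≤ ∫ z in cyl Ω T, weight Λ μ z.2 * f z :=
    fun f hf h0 => integral_mono hf (tm hf) fun z =>
      le_mul_of_one_le_left (h0 z) (one_le_weight hΛ0 μ z.2)
  have lowr : ∀ f : EuclideanSpace ℝ (Fin n) × ℝ → ℝ, IntegrableOn f (cyl Ω T) volume →
      (∀ z, 0 ≤ f z) → s * (∫ z in cyl Ω T, weight Λ μ z.2 * f z)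
        ≤ ∫ z in cyl Ω T, rate Λ μ z.2 * weight Λ μ z.2 * f z := fun f hf h0 => by
    rw [← integral_const_mul]
    refine integral_mono_ae ((tm hf).const_mul s)
      (integrable_time_mul hΩ hΩb (cr.mul cE) hf) ?_
    filter_upwards [ae_restrict_mem hQ] with z hz
    rw [mul_assoc, ← hrT]
    exact mul_le_mul_of_nonneg_right (rate_antitone hΛ0 hμ0.le hz.2.2.le)
      (mul_nonneg (weight_pos Λ μ z.2).le (h0 z))
  have young : -(∫ z in cyl Ω T, weight Λ μ z.2 * (u z * (dt Ω T u z + β * lap Ω T u z)))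
      ≤ β / (2 * C₂) * (∫ z in cyl Ω T, weight Λ μ z.2 * (dt Ω T u z + β * lap Ω T u z) ^ 2)
        + C₂ / (2 * β) * ∫ z in cyl Ω T, weight Λ μ z.2 * u z ^ 2 := by
    have i1 : IntegrableOn (fun z => weight Λ μ z.2 * (dt Ω T u z + β * lap Ω T u z) ^ 2)
        (cyl Ω T) volume := tm kF
    have i2 : IntegrableOn (fun z => weight Λ μ z.2 * u z ^ 2) (cyl Ω T) volume := tm ku
    have i3 : IntegrableOn (fun z => weight Λ μ z.2 * (u z * (dt Ω T u z + β * lap Ω T u z)))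
        (cyl Ω T) volume := tm kuF
    rw [← integral_neg, ← integral_const_mul, ← integral_const_mul,
      ← integral_add (i1.const_mul _) (i2.const_mul _)]
    refine integral_mono i3.neg ((i1.const_mul _).add (i2.const_mul _))
      fun (z : EuclideanSpace ℝ (Fin n) × ℝ) => ?_
    have hE := weight_pos Λ μ z.2
    generalize dt Ω T u z + β * lap Ω T u z = f
    -- Young's inequality, with the constant for which the Bellman bound on `f` costs `β / 2`
    have h : 0 ≤ weight Λ μ z.2 * ((β * f + C₂ * u z) ^ 2 / (2 * C₂ * β)) := by positivity
    have e : weight Λ μ z.2 * ((β * f + C₂ * u z) ^ 2 / (2 * C₂ * β))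
        = β / (2 * C₂) * (weight Λ μ z.2 * f ^ 2) + C₂ / (2 * β) * (weight Λ μ z.2 * u z ^ 2)
          + weight Λ μ z.2 * (u z * f) := by
      field_simp
      ring
    simp only
    linarith
  have e₁ := hu.carleman_estimate hΩ hΩb hT hΛ0 hμ0.le hβ.le huT hu₀
  have e₂ := hu.backward_energy (Λ := Λ) (μ := μ) (β := β) hΩ hΩb hT huT
  have e₃ := hp.forward_energy (Λ := Λ) (μ := μ) (β := β) hΩ hΩb hT hp₀
  rw [add_assoc] at e₁
  have l₁ := low _ ku fun z => sq_nonneg _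
  have l₂ := low _ gu fun z => gradSq_nonneg _ z
  have l₃ := low _ kp fun z => sq_nonneg _
  have l₄ := low _ gp fun z => gradSq_nonneg _ z
  have n₁ : 0 ≤ ∫ z in cyl Ω T, u z ^ 2 := integral_nonneg fun _ => sq_nonneg _
  have n₂ : 0 ≤ ∫ z in cyl Ω T, gradSq Ω T u z := integral_nonneg fun z => gradSq_nonneg _ z
  have n₃ : 0 ≤ ∫ z in cyl Ω T, p z ^ 2 := integral_nonneg fun _ => sq_nonneg _
  have n₄ : 0 ≤ ∫ z in cyl Ω T, gradSq Ω T p z := integral_nonneg fun z => gradSq_nonneg _ z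
  have key := absorption hβ hC₂ hC₃ hM hμ hs (n₁.trans l₁) (n₃.trans l₃)
    (lowr _ ku fun z => sq_nonneg _) (lowr _ kp fun z => sq_nonneg _) (hB Λ μ) e₁
    ((e₂.trans_eq (sub_eq_add_neg _ _)).trans (add_le_add_right young _))
    (e₃.trans (add_le_add_right (hP Λ μ) _))
  have hw := hu.1.memH1_trace hΩ hΩb hT huT
  have hwi : ∀ i : Fin n, IntegrableOn
      (fun x => weakDeriv Ω (EuclideanSpace.single i 1) uT x ^ 2) Ω volume :=
    fun i => (hw.memLp_weakDeriv hΩ _).integrable_sq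
  rw [integral_add ku gu, integral_add kp gp, integral_add hw.1.integrable_sq
    (integrable_finsetSum _ fun i _ => hwi i), integral_finsetSum _ fun i _ => hwi i]
  have y₁ : 0 ≤ ∫ x in Ω, uT x ^ 2 := integral_nonneg fun _ => sq_nonneg _
  have y₂ : 0 ≤ ∑ i, ∫ x in Ω, weakDeriv Ω (EuclideanSpace.single i 1) uT x ^ 2 :=
    Finset.sum_nonneg fun _ _ => integral_nonneg fun _ => sq_nonneg _
  have y₃ : 0 ≤ ∫ x in Ω, u₀ x ^ 2 := integral_nonneg fun _ => sq_nonneg _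
  have y₄ : 0 ≤ ∫ x in Ω, p₀ x ^ 2 := integral_nonneg fun _ => sq_nonneg _
  revert key l₁ l₂ l₃ l₄ n₁ n₂ n₃ n₄ y₁ y₂ y₃ y₄
  clear * - hc hM0 hβ hr0 hW hWT hc0
  generalize (∫ z in cyl Ω T, u z ^ 2) = b
  generalize (∫ z in cyl Ω T, gradSq Ω T u z) = a
  generalize (∫ z in cyl Ω T, p z ^ 2) = q
  generalize (∫ z in cyl Ω T, gradSq Ω T p z) = r
  generalize (∫ z in cyl Ω T, weight Λ μ z.2 * u z ^ 2) = b'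
  generalize (∫ z in cyl Ω T, weight Λ μ z.2 * gradSq Ω T u z) = a'
  generalize (∫ z in cyl Ω T, weight Λ μ z.2 * p z ^ 2) = q'
  generalize (∫ z in cyl Ω T, weight Λ μ z.2 * gradSq Ω T p z) = r'
  generalize (∫ x in Ω, uT x ^ 2) = y
  generalize (∑ i, ∫ x in Ω, weakDeriv Ω (EuclideanSpace.single i 1) uT x ^ 2) = g
  generalize (∫ x in Ω, u₀ x ^ 2) = y'
  generalize (∫ x in Ω, p₀ x ^ 2) = q₀
  intro l₁ l₂ l₃ l₄ n₁ n₂ n₃ n₄ key y₁ y₂ y₃ y₄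
  have m₁ : 0 ≤ M * (weight Λ μ T / 2) := by positivity
  have m₂ : 0 ≤ β * weight Λ μ T := by positivity
  have m₃ : 0 ≤ rate Λ μ 0 * weight Λ μ 0 := by positivity
  have c₁ : M * (weight Λ μ T / 2) * y ≤ c * y := mul_le_mul_of_nonneg_right (by linarith) y₁
  have c₂ : β * weight Λ μ T * g ≤ c * g := mul_le_mul_of_nonneg_right (by linarith) y₂
  have c₃ : rate Λ μ 0 * weight Λ μ 0 * y' ≤ c * y' :=
    mul_le_mul_of_nonneg_right (by linarith) y₃
  have c₄ : weight Λ μ 0 / 2 * q₀ ≤ c * q₀ := mul_le_mul_of_nonneg_right (by linarith) y₄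
  have hD : a' + b' + q' + β / 2 * r' ≤ c * (y + g + y' + q₀) := by linarith
  have hX : 0 ≤ 2 / β * (a' + b' + q') :=
    mul_nonneg (by positivity) (by linarith)
  have hr : 2 / β * (β / 2 * r') = r' := by field_simp
  have hr' : 0 ≤ β / 2 * r' := mul_nonneg (by positivity) (n₄.trans l₄)
  calc b + a + (q + r) ≤ (1 + 2 / β) * (a' + b' + q' + β / 2 * r') := by linarith
    _ ≤ (1 + 2 / β) * (c * (y + g + y' + q₀)) := mul_le_mul_of_nonneg_left hD (by positivity)
    _ = _ := by ring

end Absorption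

/-! ### Stability and uniqueness -/

section Stability

variable {n : ℕ} {Ω : Set (EuclideanSpace ℝ (Fin n))} {T : ℝ}

theorem normH1_eq_zero_of_ae_eq_zero (hΩ : IsOpen Ω) {f : EuclideanSpace ℝ (Fin n) → ℝ}
    (hf : MemH1 Ω f) (h : f =ᵐ[volume.restrict Ω] 0) : normH1 Ω f = 0 := by
  have hd : ∀ i : Fin n,
      weakDeriv Ω (EuclideanSpace.single i 1) f =ᵐ[volume.restrict Ω] 0 := fun i => by
    have h1 := hf.hasWeakDeriv (EuclideanSpace.single i 1)
    have h2 := h1.sub h1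
    rw [sub_self, sub_self] at h2
    exact (h1.congr hΩ h EventuallyEq.rfl).unique hΩ h2
  rw [normH1, integral_eq_zero_of_ae, Real.sqrt_zero]
  filter_upwards [h, ae_all_iff.2 hd] with x h1 h2
  simp [h1, h2]

theorem normL2_eq_zero_of_ae_eq_zero {f : EuclideanSpace ℝ (Fin n) → ℝ}
    (h : f =ᵐ[volume.restrict Ω] 0) : normL2 Ω f = 0 := by
  rw [normL2, integral_eq_zero_of_ae, Real.sqrt_zero]
  filter_upwards [h] with x h1
  simp [h1]

theorem MemH1.ae_eq_zero_of_normH10_eq_zero (hΩ : IsOpen Ω)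
    {f : EuclideanSpace ℝ (Fin n) × ℝ → ℝ} (hf : MemH1 (cyl Ω T) f) (h : normH10 Ω T f = 0) :
    f =ᵐ[volume.restrict (cyl Ω T)] 0 := by
  have hn : ∀ z, 0 ≤ f z ^ 2 + gradSq Ω T f z := fun z =>
    add_nonneg (sq_nonneg _) (gradSq_nonneg f z)
  have h0 := (Real.sqrt_eq_zero (integral_nonneg hn)).1 h
  have h1 := (integral_eq_zero_iff_of_nonneg hn
    (hf.1.integrable_sq.add (hf.integrable_gradSq hΩ))).1 h0
  filter_upwards [h1] with z hz
  have h2 := gradSq_nonneg (Ω := Ω) (T := T) f z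
  have h3 : f z ^ 2 + gradSq Ω T f z = 0 := hz
  exact pow_eq_zero_iff two_ne_zero |>.1 (le_antisymm (by linarith) (sq_nonneg _))

end Stability

end MFG

end

theorem theorem4p1 {n : ℕ} (hn : 1 ≤ n) (Ω : Set (EuclideanSpace ℝ (Fin n)))
    (hΩo : IsOpen Ω) (hΩc : IsConnected Ω) (hΩb : Bornology.IsBounded Ω)
    (T : ℝ) (hT : 0 < T) (β : ℝ) (hβ : 0 < β) (N : ℝ) :
    ∃ C : ℝ, 0 < C ∧
      ∀ N₁ N₂ N₃ N₄ : ℝ, 0 < N₁ → 0 < N₂ → 0 < N₃ → 0 < N₄ →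
      N = max (max N₁ N₂) (max N₃ N₄) →
      ∀ (G : EuclideanSpace ℝ (Fin n) × ℝ → ℝ → ℝ → ℝ)
        (K : EuclideanSpace ℝ (Fin n) → EuclideanSpace ℝ (Fin n) → ℝ)
        (κ : EuclideanSpace ℝ (Fin n) → ℝ),
      MFG.IsInteraction Ω T N₁ G → MFG.IsKernel Ω N₂ K → MFG.C1Bounded Ω N₂ κ →
      ∀ (u₁ p₁ u₂ p₂ : EuclideanSpace ℝ (Fin n) × ℝ → ℝ),
      MFG.MemD3 Ω T N₃ u₁ → MFG.MemD4 Ω T N₄ p₁ →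
      MFG.MemD3 Ω T N₃ u₂ → MFG.MemD4 Ω T N₄ p₂ →
      MFG.SolvesMFG Ω T β κ K G u₁ p₁ → MFG.SolvesMFG Ω T β κ K G u₂ p₂ →
      ∀ (uT₁ uT₂ u0₁ u0₂ p0₁ p0₂ : EuclideanSpace ℝ (Fin n) → ℝ),
      MFG.HasTimeTrace Ω T u₁ T uT₁ → MFG.HasTimeTrace Ω T u₂ T uT₂ →
      MFG.HasTimeTrace Ω T u₁ 0 u0₁ → MFG.HasTimeTrace Ω T u₂ 0 u0₂ →
      MFG.HasTimeTrace Ω T p₁ 0 p0₁ → MFG.HasTimeTrace Ω T p₂ 0 p0₂ →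
      (MFG.MemH1 Ω (uT₁ - uT₂) ∧
        MFG.normH10 Ω T (u₁ - u₂) + MFG.normH10 Ω T (p₁ - p₂)
          ≤ C * (MFG.normH1 Ω (uT₁ - uT₂) + MFG.normL2 Ω (u0₁ - u0₂)
              + MFG.normL2 Ω (p0₁ - p0₂))) ∧
      (uT₁ =ᵐ[volume.restrict Ω] uT₂ → u0₁ =ᵐ[volume.restrict Ω] u0₂ →
        p0₁ =ᵐ[volume.restrict Ω] p0₂ →
        u₁ =ᵐ[volume.restrict (MFG.cyl Ω T)] u₂ ∧ p₁ =ᵐ[volume.restrict (MFG.cyl Ω T)] p₂) := by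
  obtain ⟨c, hc0, hc⟩ := MFG.exists_stability_constant (T := T)
    (C₂ := 2 * N ^ 6 + 4 * N ^ 2 + 4 * N ^ 4 * volume.real Ω ^ 2 + 1) (C₃ := N ^ 6 / β) hΩo hΩb hT hβ
    (by positivity) (by positivity)
  refine ⟨√(2 * c), by positivity, fun N₁ N₂ N₃ N₄ hN₁ hN₂ hN₃ hN₄ hN G K κ hG hK hκ u₁ p₁ u₂ p₂
    hu₁ hp₁ hu₂ hp₂ hs₁ hs₂ uT₁ uT₂ u0₁ u0₂ p0₁ p0₂ tT₁ tT₂ t0₁ t0₂ q0₁ q0₂ => ?_⟩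
  have h1 : N₁ ≤ N := by rw [hN]; simp
  have h2 : N₂ ≤ N := by rw [hN]; simp
  have h3 : N₃ ≤ N := by rw [hN]; simp
  have h4 : N₄ ≤ N := by rw [hN]; simp
  have hu := hu₁.memH20.sub hΩo hu₂.memH20
  have hp := hp₁.memH20.sub hΩo hp₂.memH20
  have mu := hu₁.memH20.1.1.1
  have mp := hp₁.memH20.1.1.1
  rw [MFG.restrict_cyl] at mu mp
  have tT := tT₁.sub mu tT₂
  have t0 := t0₁.sub mu t0₂
  have q0 := q0₁.sub mp q0₂
  have hw := hu.1.memH1_trace hΩo hΩb hT tT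
  have est := hc _ _ _ _ _ hu hp tT t0 q0
    (fun Λ μ => (MFG.bellman_difference hΩo hΩb h1 hN₂.le h2 h3 hG hK hκ hu₁ hu₂ hp₁ hp₂ hs₁
      hs₂).trans (mul_le_mul_of_nonneg_right (by linarith)
        (add_nonneg
          (integral_nonneg fun z => mul_nonneg (MFG.weight_pos Λ μ z.2).le (MFG.gradSq_nonneg _ z))
          (integral_nonneg fun z => mul_nonneg (MFG.weight_pos Λ μ z.2).le (sq_nonneg _)))))
    (fun Λ μ => MFG.fokkerPlanck_difference hΩo hΩb hβ (hN₁.le.trans h1) h2 h3 h4 hκ hu₁ hu₂ hp₁ hp₂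
      hs₁ hs₂)
  have main : MFG.normH10 Ω T (u₁ - u₂) + MFG.normH10 Ω T (p₁ - p₂)
      ≤ √(2 * c) * (MFG.normH1 Ω (uT₁ - uT₂) + MFG.normL2 Ω (u0₁ - u0₂)
        + MFG.normL2 Ω (p0₁ - p0₂)) := by
    have sq10 : ∀ f, MFG.normH10 Ω T f ^ 2 = ∫ z in MFG.cyl Ω T, (f z ^ 2 + MFG.gradSq Ω T f z) :=
      fun f => Real.sq_sqrt (integral_nonneg fun z =>
        add_nonneg (sq_nonneg _) (MFG.gradSq_nonneg f z))
    have sq1 : ∀ f, MFG.normH1 Ω f ^ 2 = ∫ x in Ω, (f x ^ 2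
        + ∑ i, MFG.weakDeriv Ω (EuclideanSpace.single i 1) f x ^ 2) :=
      fun f => Real.sq_sqrt (integral_nonneg fun x =>
        add_nonneg (sq_nonneg _) (Finset.sum_nonneg fun _ _ => sq_nonneg _))
    have sq2 : ∀ f, MFG.normL2 Ω f ^ 2 = ∫ x in Ω, f x ^ 2 :=
      fun f => Real.sq_sqrt (integral_nonneg fun x => sq_nonneg _)
    rw [← sq10, ← sq10, ← sq1, ← sq2, ← sq2] at est
    have na : 0 ≤ MFG.normH1 Ω (uT₁ - uT₂) := Real.sqrt_nonneg _
    have nb : 0 ≤ MFG.normL2 Ω (u0₁ - u0₂) := Real.sqrt_nonneg _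
    have nd : 0 ≤ MFG.normL2 Ω (p0₁ - p0₂) := Real.sqrt_nonneg _
    generalize MFG.normH1 Ω (uT₁ - uT₂) = a at *
    generalize MFG.normL2 Ω (u0₁ - u0₂) = b at *
    generalize MFG.normL2 Ω (p0₁ - p0₂) = d at *
    refine abs_le_of_sq_le_sq' ?_ (by positivity) |>.2
    rw [mul_pow, Real.sq_sqrt (by positivity)]
    have hab : a ^ 2 + b ^ 2 + d ^ 2 ≤ (a + b + d) ^ 2 := by
      have : 0 ≤ a * b + b * d + a * d := by positivity
      linarith
    have := mul_le_mul_of_nonneg_left hab hc0.le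
    refine add_sq_le.trans ?_
    linarith
  refine ⟨⟨hw, main⟩, fun eT e0 e0' => ?_⟩
  have z : ∀ {f g : EuclideanSpace ℝ (Fin n) → ℝ}, f =ᵐ[volume.restrict Ω] g →
      f - g =ᵐ[volume.restrict Ω] 0 := fun h => h.mono fun x hx => sub_eq_zero.2 hx
  rw [MFG.normH1_eq_zero_of_ae_eq_zero hΩo hw (z eT), MFG.normL2_eq_zero_of_ae_eq_zero (z e0),
    MFG.normL2_eq_zero_of_ae_eq_zero (z e0'), add_zero, add_zero, mul_zero] at main
  have nu : 0 ≤ MFG.normH10 Ω T (u₁ - u₂) := Real.sqrt_nonneg _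
  have np : 0 ≤ MFG.normH10 Ω T (p₁ - p₂) := Real.sqrt_nonneg _
  exact ⟨(hu.1.memH1.ae_eq_zero_of_normH10_eq_zero hΩo (by linarith)).mono fun x hx =>
      sub_eq_zero.1 hx,
    (hp.1.memH1.ae_eq_zero_of_normH10_eq_zero hΩo (by linarith)).mono fun x hx =>
      sub_eq_zero.1 hx⟩
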